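/- Let $X$ be a smooth surface and let $M=\mathbb{R}\times X$ be oriented. Let $\beta_t$ (nowhere vanishing functions), $F_t$ (functions), $\alpha^\perp_t$ (one-forms) and $q_t$ (Riemannian metrics) be families on $X$ depending smoothly on $(t,x)$; completeness of $q_t$ and global hyperbolicity of the metric below are allowed but not required. Put $$g=-\beta_t^2\,dt\otimes dt+q_t,\qquad \alpha=F_t\,e^0+\alpha^\perp_t,\qquad e^0=\beta_t\,dt,\qquad n_t=\tfrac1{\beta_t}\partial_t ,$$ time-orient $(M,g)$ by $n_t$ and orient $X_t=\{t\}\times X$ so that $(n_t,v_1,v_2)$ is positive on $M$ exactly when $(v_1,v_2)$ is positive on $X_t$. Let $\varepsilon\in\{-1,0,1\}$, $\lambda,\kappa\in\mathbb{R}$, $\kappa\ge 0$. The triple $(g,\alpha,\varepsilon)$ is called a Lorentzian $\varepsilon\eta$-Einstein $\varepsilon$-contact structure (with constants $\lambda,\kappa$) if $$\alpha=\ast_g d\alpha,\qquad |\alpha|_g^2=\varepsilon,\qquad \mathrm{Ric}^g=-\tfrac12(\lambda^2+\kappa\varepsilon)\,g+\kappa\,\alpha\otimes\alpha ,$$ with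 the Hodge convention $\eta\wedge\ast\theta=g(\eta,\theta)\,\nu_g$. Let $W_t=-\nabla n_t|_{TX_t}$ (with $\nabla$ the Levi-Civita connection of $g$) and $\Theta_t=-\frac1{2\beta_t}\mathcal{L}_{\partial_t}g|_{TX_t\times TX_t}$ be the Weingarten tensor and the second fundamental form, $\dot\Theta_t=\partial_t\Theta_t$, $\nu_{q_t}$ the area form, $\mathrm{R}^{q_t}$ the scalar curvature, $|\cdot|_{q_t}$ the norm on tensors with $|\Theta|^2_{q}=q^{ik}q^{jl}\Theta_{ij}\Theta_{kl}$, and let $\mathrm{div}_{q}$ be taken with the sign of the formal adjoint of $\nabla^{q}$: $(\mathrm{div}_q\Theta)_k=-q^{ij}\nabla^q_i\Theta_{jk}$. Set $\mathfrak{c}=\frac12(\lambda^2-\kappa\varepsilon)$. (1) $(g,\alpha,\varepsilon)$ is a Lorentzian $\varepsilon\eta$-Einstein $\varepsilon$-contact structure on $M$ with constants $\lambda,\kappa$ if and only if for all $t$, on $X_t$, $$d_X\alpha^\perp_t=F_t\,\nu_{q_t},\qquad \ast_{q_t}\alpha^\perp_t+\tfrac1{\beta_t}d_X(\beta_tF_t)=\mathcal{L}_{n_t}\alpha^\perp_t,\qquad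 |\alpha^\perp_t|^2_{q_t}=\varepsilon+F_t^2,$$ $$\mathrm{R}^{q_t}-|\Theta_t|^2_{q_t}+(\mathrm{Tr}_{q_t}\Theta_t)^2+\mathfrak{c}=2\kappa F_t^2,\qquad d_X\mathrm{Tr}_{q_t}(\Theta_t)+\mathrm{div}_{q_t}(\Theta_t)=\kappa F_t\,\alpha^\perp_t,$$ $$\mathrm{Ric}^{q_t}+\mathrm{Tr}_{q_t}(\Theta_t)\,\Theta_t-2\,\Theta_t(\mathrm{Id}\otimes W_t)-\tfrac1{\beta_t}\big(\dot\Theta_t+\nabla^{q_t}d_X\beta_t\big)=\kappa\,\alpha^\perp_t\otimes\alpha^\perp_t-\tfrac12(\lambda^2+\kappa\varepsilon)\,q_t .$$ (2) Consequently, if the tuple solves this system, then the initial data $(q,\Theta,F,\alpha^\perp)=(q_0,\Theta_0,F_0,\alpha^\perp_0)$ on $X$ satisfy, with $\Theta$ a symmetric bilinear form, the constraint equations $$d_X\alpha^\perp=F\,\nu_q,\qquad |\alpha^\perp|^2_q=\varepsilon+F^2,$$ $$\mathrm{R}^{q}-|\Theta|^2_{q}+(\mathrm{Tr}_{q}\Theta)^2+\mathfrak{c}=2\kappa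 F^2,\qquad d_X\mathrm{Tr}_{q}(\Theta)+\mathrm{div}_{q}(\Theta)=\kappa F\,\alpha^\perp .$$ -/

import Mathlib

open scoped Manifold ContDiff Topology
open Module

noncomputable section

/-! ### Pointwise algebra of a metric on a vector space `V` with basis `b` -/

section Pointwise

variable {ι V : Type*} [Fintype ι] [DecidableEq ι] [AddCommGroup V] [Module ℝ V]

/-- The coefficients `g^{ij}` of the inverse of a metric `g` in the basis `b`. -/
def gramInv (b : Basis ι ℝ V) (g : V → V → ℝ) (i j : ι) : ℝ :=
  (Matrix.of fun k l => g (b k) (b l))⁻¹ i j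

/-- The trace `g^{ij} T_{ij}` of a bilinear form. -/
def trMetric (b : Basis ι ℝ V) (g T : V → V → ℝ) : ℝ :=
  ∑ i, ∑ j, gramInv b g i j * T (b i) (b j)

/-- The squared norm `g^{ij} θ_i θ_j` of a one-form. -/
def normSqForm (b : Basis ι ℝ V) (g : V → V → ℝ) (θ : V → ℝ) : ℝ :=
  ∑ i, ∑ j, gramInv b g i j * (θ (b i) * θ (b j))

/-- The squared norm `g^{ik} g^{jl} T_{ij} T_{kl}` of a bilinear form. -/
def normSqBilin (b : Basis ι ℝ V) (g T : V → V → ℝ) : ℝ :=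
  ∑ i, ∑ j, ∑ k, ∑ l,
    gramInv b g i k * gramInv b g j l * (T (b i) (b j) * T (b k) (b l))

/-- The metric volume form `ν = √|det (g (b i) (b j))| b⁰ ∧ ⋯ ∧ bⁿ⁻¹` (for a positive basis `b`)
of the metric `g` and the orientation represented by the nonzero top-degree form `o`; the
sign accounts for bases that are not positive. It does not depend on the basis. -/
def volForm (b : Basis ι ℝ V) (g : V → V → ℝ) (o : V [⋀^ι]→ₗ[ℝ] ℝ) : V [⋀^ι]→ₗ[ℝ] ℝ :=
  (Real.sign (o b) * √|(Matrix.of fun k l => g (b k) (b l)).det|) • b.det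

/-- The Hodge dual of a one-form in dimension two: `(∗θ)_k = θ^i ν_{ik}`, that is, the
convention `η ∧ ∗θ = g(η, θ) ν`. -/
def hodgeOne (b : Basis (Fin 2) ℝ V) (g : V → V → ℝ) (o : V [⋀^Fin 2]→ₗ[ℝ] ℝ)
    (θ : V → ℝ) (v : V) : ℝ :=
  ∑ i, ∑ j, gramInv b g i j * θ (b j) * volForm b g o ![b i, v]

/-- The Hodge dual of a two-form in dimension three: `(∗θ)_k = ½ θ^{ij} ν_{ijk}`, that is, the
convention `η ∧ ∗θ = g(η, θ) ν`. -/
def hodgeTwo (b : Basis (Fin 3) ℝ V) (g : V → V → ℝ) (o : V [⋀^Fin 3]→ₗ[ℝ] ℝ)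
    (θ : V → V → ℝ) (v : V) : ℝ :=
  (1 / 2) * ∑ i, ∑ j, ∑ k, ∑ l,
    gramInv b g i k * gramInv b g j l * θ (b k) (b l) * volForm b g o ![b i, b j, v]

end Pointwise

/-! ### Levi-Civita connection and curvature in a coordinate domain

`E` is the coordinate space, `b` a basis of it, and `G u v w` is the value at the point `u` of a
metric on the vectors `v`, `w`. -/

section Local

variable {ι E : Type*} [Fintype ι] [DecidableEq ι] [NormedAddCommGroup E] [NormedSpace ℝ E]

/-- `Γ_u(v, w) = v^i w^j Γ^k_{ij}(u) b_k`, with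
`Γ^k_{ij} = ½ g^{kl} (∂_i g_{jl} + ∂_j g_{il} - ∂_l g_{ij})`. -/
def christoffel (b : Basis ι ℝ E) (G : E → E → E → ℝ) (u v w : E) : E :=
  ∑ k, (∑ l, gramInv b (G u) k l *
    ((fderiv ℝ (fun y => G y w (b l)) u v + fderiv ℝ (fun y => G y v (b l)) u w
      - fderiv ℝ (fun y => G y v w) u (b l)) / 2)) • b k

/-- The Riemann tensor `R(v, w) z = ∇_v ∇_w z - ∇_w ∇_v z - ∇_{[v, w]} z`, evaluated on
coordinate-constant fields. -/
def localRiemann (b : Basis ι ℝ E) (G : E → E → E → ℝ) (u v w z : E) : E :=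
  fderiv ℝ (fun y => christoffel b G y w z) u v - fderiv ℝ (fun y => christoffel b G y v z) u w
    + christoffel b G u v (christoffel b G u w z) - christoffel b G u w (christoffel b G u v z)

/-- The Ricci tensor `Ric(w, z) = tr (v ↦ R(v, w) z)`. -/
def localRicci (b : Basis ι ℝ E) (G : E → E → E → ℝ) (u w z : E) : ℝ :=
  ∑ i, b.repr (localRiemann b G u (b i) w z) i

end Local

/-! ### Tensor calculus on a manifold without boundary

Derivatives at `x` are computed in the preferred chart at `x`, through which `TangentSpace I x` is
identified with the model space `E`. -/

section Manifold

variable {ι E H M : Type*} [Fintype ι] [DecidableEq ι] [NormedAddCommGroup E] [NormedSpace ℝ E]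
  [TopologicalSpace H] (I : ModelWithCorners ℝ E H) [TopologicalSpace M] [ChartedSpace H M]

/-- The coordinate frame at `x` of the preferred chart at `x`. -/
def coordBasis (b : Basis ι ℝ E) (x : M) : Basis ι ℝ (TangentSpace I x) := b

/-- The differential at `u` of the inverse of the chart at `x`. -/
def coordTangent (x : M) (u v : E) : TangentSpace I ((extChartAt I x).symm u) :=
  mfderiv 𝓘(ℝ, E) I (extChartAt I x).symm u v

/-- A one-form in the chart at `x`. -/
def coordForm (θ : ∀ y : M, TangentSpace I y → ℝ) (x : M) (u v : E) : ℝ :=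
  θ _ (coordTangent I x u v)

/-- A field of bilinear forms in the chart at `x`. -/
def coordBilin (T : ∀ y : M, TangentSpace I y → TangentSpace I y → ℝ) (x : M) (u v w : E) : ℝ :=
  T _ (coordTangent I x u v) (coordTangent I x u w)

/-- A vector field in the chart at `x`. -/
def coordVec (Y : ∀ y : M, TangentSpace I y) (x : M) (u : E) : E :=
  mfderiv I 𝓘(ℝ, E) (extChartAt I x) ((extChartAt I x).symm u) (Y ((extChartAt I x).symm u))

/-- The differential of a function. -/
def dFun (f : M → ℝ) (x : M) (v : TangentSpace I x) : ℝ := mfderiv I 𝓘(ℝ, ℝ) f x v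

/-- The exterior derivative of a one-form,
`dθ(v, w) = v(θ(w)) - w(θ(v))` for coordinate-constant `v`, `w`. -/
def dForm (θ : ∀ y : M, TangentSpace I y → ℝ) (x : M) (v w : TangentSpace I x) : ℝ :=
  fderiv ℝ (fun u => coordForm I θ x u w) (extChartAt I x x) v
    - fderiv ℝ (fun u => coordForm I θ x u v) (extChartAt I x x) w

/-- The Lie derivative of a one-form, `(L_Y θ)_j = Y^i ∂_i θ_j + θ_i ∂_j Y^i`. -/
def lieForm (Y : ∀ y : M, TangentSpace I y) (θ : ∀ y : M, TangentSpace I y → ℝ) (x : M)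
    (v : TangentSpace I x) : ℝ :=
  fderiv ℝ (fun u => coordForm I θ x u v) (extChartAt I x x) (coordVec I Y x (extChartAt I x x))
    + coordForm I θ x (extChartAt I x x) (fderiv ℝ (coordVec I Y x) (extChartAt I x x) v)

/-- The Ricci tensor of the metric `g`. -/
def ricci (b : Basis ι ℝ E) (g : ∀ y : M, TangentSpace I y → TangentSpace I y → ℝ) (x : M)
    (v w : TangentSpace I x) : ℝ :=
  localRicci b (coordBilin I g x) (extChartAt I x x) v w

/-- The scalar curvature of the metric `g`. -/
def scalarCurv (b : Basis ι ℝ E) (g : ∀ y : M, TangentSpace I y → TangentSpace I y → ℝ)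
    (x : M) : ℝ :=
  trMetric (coordBasis I b x) (g x) (ricci I b g x)

/-- The Levi-Civita covariant derivative `∇_v Y` of a vector field. -/
def covVec (b : Basis ι ℝ E) (g : ∀ y : M, TangentSpace I y → TangentSpace I y → ℝ)
    (Y : ∀ y : M, TangentSpace I y) (x : M) (v : TangentSpace I x) : TangentSpace I x :=
  (fderiv ℝ (coordVec I Y x) (extChartAt I x x) v
    + christoffel b (coordBilin I g x) (extChartAt I x x) v (coordVec I Y x (extChartAt I x x)) : E)

/-- The Levi-Civita covariant derivative `(∇_v θ)(w)` of a one-form. -/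
def covForm (b : Basis ι ℝ E) (g : ∀ y : M, TangentSpace I y → TangentSpace I y → ℝ)
    (θ : ∀ y : M, TangentSpace I y → ℝ) (x : M) (v w : TangentSpace I x) : ℝ :=
  fderiv ℝ (fun u => coordForm I θ x u w) (extChartAt I x x) v
    - coordForm I θ x (extChartAt I x x) (christoffel b (coordBilin I g x) (extChartAt I x x) v w)

/-- The Levi-Civita covariant derivative `(∇_v T)(w, z)` of a field of bilinear forms. -/
def covBilin (b : Basis ι ℝ E) (g T : ∀ y : M, TangentSpace I y → TangentSpace I y → ℝ)
    (x : M) (v w z : TangentSpace I x) : ℝ :=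
  fderiv ℝ (fun u => coordBilin I T x u w z) (extChartAt I x x) v
    - coordBilin I T x (extChartAt I x x)
        (christoffel b (coordBilin I g x) (extChartAt I x x) v w) z
    - coordBilin I T x (extChartAt I x x) w
        (christoffel b (coordBilin I g x) (extChartAt I x x) v z)

/-- The divergence of a symmetric bilinear form, with the sign of the formal adjoint of `∇`:
`(div_g T)(w) = - g^{ij} (∇_i T)(b_j, w)`. -/
def divBilin (b : Basis ι ℝ E) (g T : ∀ y : M, TangentSpace I y → TangentSpace I y → ℝ)
    (x : M) (w : TangentSpace I x) : ℝ :=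
  - ∑ i, ∑ j, gramInv (coordBasis I b x) (g x) i j *
      covBilin I b g T x (coordBasis I b x i) (coordBasis I b x j) w

/-- Smoothness of a one-form: its components in charts are smooth. -/
def SmoothForm (θ : ∀ y : M, TangentSpace I y →ₗ[ℝ] ℝ) : Prop :=
  ∀ (x : M) (v : E),
    ContDiffOn ℝ ∞ (fun u => coordForm I (fun y => θ y) x u v) (extChartAt I x).target

/-- Smoothness of a field of bilinear forms: its components in charts are smooth. -/
def SmoothBilin (T : ∀ y : M, TangentSpace I y →ₗ[ℝ] TangentSpace I y →ₗ[ℝ] ℝ) : Prop :=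
  ∀ (x : M) (v w : E),
    ContDiffOn ℝ ∞ (fun u => coordBilin I (fun y a c => T y a c) x u v w) (extChartAt I x).target

/-- A continuous nowhere vanishing form of top degree (`ι` indexes a basis of `E`). It represents an
orientation; only its sign on bases is ever used. -/
structure IsOrientationForm (o : ∀ y : M, TangentSpace I y [⋀^ι]→ₗ[ℝ] ℝ) : Prop where
  ne_zero : ∀ y, o y ≠ 0
  continuous : ∀ (x : M) (v : ι → E),
    ContinuousOn (fun u => o ((extChartAt I x).symm u) (fun i => coordTangent I x u (v i)))
      (extChartAt I x).target

/-- `(g, α, ε)` is an `ε`-contact metric structure, with `g` Lorentzian, on the three-manifold `M`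
oriented by `o` and time-oriented by the vector field `T`: `α = ∗dα` and `|α|² = ε`. -/
structure IsLorentzianContact (b : Basis (Fin 3) ℝ E)
    (o : ∀ y : M, TangentSpace I y [⋀^Fin 3]→ₗ[ℝ] ℝ) (T : ∀ y : M, TangentSpace I y)
    (g : ∀ y : M, TangentSpace I y →ₗ[ℝ] TangentSpace I y →ₗ[ℝ] ℝ)
    (α : ∀ y : M, TangentSpace I y →ₗ[ℝ] ℝ) (ε : ℝ) : Prop where
  orientation : IsOrientationForm I o
  smooth_metric : SmoothBilin I g
  symm : ∀ x v w, g x v w = g x w v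
  lorentzian : ∀ x, ∃ e : Basis (Fin 3) ℝ (TangentSpace I x), ∀ i j,
    g x (e i) (e j) = if i = j then (if i = 0 then -1 else 1) else 0
  time_continuous : ∀ x : M, ContinuousOn (coordVec I T x) (extChartAt I x).target
  timelike : ∀ x, g x (T x) (T x) < 0
  epsilon : ε = -1 ∨ ε = 0 ∨ ε = 1
  smooth_form : SmoothForm I α
  contact : ∀ x v, α x v = hodgeTwo (coordBasis I b x) (fun a c => g x a c) (o x)
    (dForm I (fun y a => α y a) x) v
  norm : ∀ x, normSqForm (coordBasis I b x) (fun a c => g x a c) (fun a => α x a) = ε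

/-- `(g, α, ε)` is a Lorentzian `εη`-Einstein `ε`-contact structure with constants `lam`, `κ`
(and `𝔰_g = -1` in the Einstein condition). -/
structure IsLorentzianEtaEinstein (b : Basis (Fin 3) ℝ E)
    (o : ∀ y : M, TangentSpace I y [⋀^Fin 3]→ₗ[ℝ] ℝ) (T : ∀ y : M, TangentSpace I y)
    (g : ∀ y : M, TangentSpace I y →ₗ[ℝ] TangentSpace I y →ₗ[ℝ] ℝ)
    (α : ∀ y : M, TangentSpace I y →ₗ[ℝ] ℝ) (ε lam κ : ℝ) : Prop
    extends IsLorentzianContact I b o T g α ε where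
  kappa_nonneg : 0 ≤ κ
  einstein : ∀ x v w, ricci I b (fun y a c => g y a c) x v w
    = -(1 / 2) * (lam ^ 2 + κ * ε) * g x v w + κ * (α x v * α x w)

end Manifold

/-! ### The splitting `ℝ × X` -/

/-- The model space of surfaces. -/
abbrev Plane := EuclideanSpace ℝ (Fin 2)

/-- The model with corners of `ℝ × X`. -/
abbrev modelRX : ModelWithCorners ℝ (ℝ × Plane) (ModelProd ℝ Plane) :=
  𝓘(ℝ, ℝ).prod 𝓘(ℝ, Plane)

/-- The standard basis of `Plane`. -/
def basis2 : Basis (Fin 2) ℝ Plane := (EuclideanSpace.basisFun (Fin 2) ℝ).toBasis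

/-- The basis of `ℝ × Plane` made of `(1, 0)` and the `(0, e_i)`. -/
def basis3 : Basis (Fin 3) ℝ (ℝ × Plane) :=
  ((Basis.singleton (Fin 1) ℝ).prod basis2).reindex finSumFinEquiv

/-- Jointly smooth families `β_t` (nowhere vanishing functions), `F_t` (functions), `α_t^⊥`
(one-forms) and `q_t` (Riemannian metrics) on the surface `X`. -/
structure SplitTuple (X : Type*) [TopologicalSpace X] [ChartedSpace Plane X] where
  β : ℝ → X → ℝ
  F : ℝ → X → ℝ
  α : ℝ → ∀ x : X, TangentSpace 𝓘(ℝ, Plane) x →ₗ[ℝ] ℝ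
  q : ℝ → ∀ x : X, TangentSpace 𝓘(ℝ, Plane) x →ₗ[ℝ] TangentSpace 𝓘(ℝ, Plane) x →ₗ[ℝ] ℝ
  β_ne_zero : ∀ t x, β t x ≠ 0
  β_smooth : ContMDiff modelRX 𝓘(ℝ, ℝ) ∞ (fun p : ℝ × X => β p.1 p.2)
  F_smooth : ContMDiff modelRX 𝓘(ℝ, ℝ) ∞ (fun p : ℝ × X => F p.1 p.2)
  α_smooth : ∀ (x : X) (v : Plane),
    ContDiffOn ℝ ∞
      (fun p : ℝ × Plane => coordForm 𝓘(ℝ, Plane) (fun y a => α p.1 y a) x p.2 v)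
      (Set.univ ×ˢ (extChartAt 𝓘(ℝ, Plane) x).target)
  q_smooth : ∀ (x : X) (v w : Plane),
    ContDiffOn ℝ ∞
      (fun p : ℝ × Plane => coordBilin 𝓘(ℝ, Plane) (fun y a c => q p.1 y a c) x p.2 v w)
      (Set.univ ×ˢ (extChartAt 𝓘(ℝ, Plane) x).target)
  q_symm : ∀ t x v w, q t x v w = q t x w v
  q_pos : ∀ t x v, v ≠ 0 → 0 < q t x v v

namespace SplitTuple

variable {X : Type*} [TopologicalSpace X] [ChartedSpace Plane X]

/-- `T_{(t,x)}(ℝ × X) → ℝ`, the differential `dt`. -/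
def dt (p : ℝ × X) : TangentSpace modelRX p →ₗ[ℝ] ℝ := LinearMap.fst ℝ ℝ Plane

/-- `T_{(t,x)}(ℝ × X) → T_x X`, the differential of the projection to `X`. -/
def proj (p : ℝ × X) : TangentSpace modelRX p →ₗ[ℝ] TangentSpace 𝓘(ℝ, Plane) p.2 :=
  LinearMap.snd ℝ ℝ Plane

/-- `T_x X → T_{(t,x)}(ℝ × X)`, the differential of the embedding of `X` as `{t} × X`. -/
def incl (p : ℝ × X) : TangentSpace 𝓘(ℝ, Plane) p.2 →ₗ[ℝ] TangentSpace modelRX p :=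
  LinearMap.inr ℝ ℝ Plane

/-- The vector field `∂_t` on `ℝ × X`. -/
def partialT (p : ℝ × X) : TangentSpace modelRX p := ((1, 0) : ℝ × Plane)

variable (D : SplitTuple X)

/-- The unit vector field `n_t = β_t⁻¹ ∂_t`. -/
def normal (p : ℝ × X) : TangentSpace modelRX p := (D.β p.1 p.2)⁻¹ • partialT p

/-- The metric `g = -β_t² dt ⊗ dt + q_t`. -/
def metric (p : ℝ × X) : TangentSpace modelRX p →ₗ[ℝ] TangentSpace modelRX p →ₗ[ℝ] ℝ :=
  (-(D.β p.1 p.2) ^ 2) • (LinearMap.mul ℝ ℝ).compl₁₂ (dt p) (dt p)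
    + (D.q p.1 p.2).compl₁₂ (proj p) (proj p)

/-- `α_t^⊥` as a one-form on `ℝ × X`. -/
def perpForm (p : ℝ × X) : TangentSpace modelRX p →ₗ[ℝ] ℝ := (D.α p.1 p.2) ∘ₗ (proj p)

/-- The one-form `α = F_t e⁰ + α_t^⊥`, with `e⁰ = β_t dt`. -/
def form (p : ℝ × X) : TangentSpace modelRX p →ₗ[ℝ] ℝ :=
  (D.F p.1 p.2 * D.β p.1 p.2) • dt p + D.perpForm p

/-- The orientation of `X` at time `t` induced by an orientation form `o` of `ℝ × X` and the
time orientation `n_t`: the form `o(n_t, ·, ·)` restricted to `{t} × X`. -/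
def inducedOrientation (o : ∀ p : ℝ × X, TangentSpace modelRX p [⋀^Fin 3]→ₗ[ℝ] ℝ) (t : ℝ)
    (x : X) : TangentSpace 𝓘(ℝ, Plane) x [⋀^Fin 2]→ₗ[ℝ] ℝ :=
  ((o (t, x)).curryLeft (D.normal (t, x))).compLinearMap (incl (t, x))

/-- `q_t` as a field of functions of two vectors. -/
def metricX (t : ℝ) (x : X) (v w : TangentSpace 𝓘(ℝ, Plane) x) : ℝ := D.q t x v w

/-- `α_t^⊥` as a field of functions of a vector. -/
def formX (t : ℝ) (x : X) (v : TangentSpace 𝓘(ℝ, Plane) x) : ℝ := D.α t x v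

/-- The second fundamental form `Θ_t = -(2β_t)⁻¹ L_{∂_t} g` restricted to `TX_t`: the flow of `∂_t`
is the translation in `t`, so `L_{∂_t} g` restricts to `∂_t q_t`. -/
def secondFF (t : ℝ) (x : X) (v w : TangentSpace 𝓘(ℝ, Plane) x) : ℝ :=
  -(1 / (2 * D.β t x)) * deriv (fun s => D.q s x v w) t

/-- The time derivative of `Θ_t`. -/
def secondFFDot (t : ℝ) (x : X) (v w : TangentSpace 𝓘(ℝ, Plane) x) : ℝ :=
  deriv (fun s => D.secondFF s x v w) t

/-- The Weingarten tensor `W_t = -∇n_t` restricted to `TX_t`, with `∇` the Levi-Civita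
connection of the metric on `ℝ × X`. -/
def weingarten (t : ℝ) (x : X) (v : TangentSpace 𝓘(ℝ, Plane) x) : TangentSpace 𝓘(ℝ, Plane) x :=
  -proj (t, x) (covVec modelRX basis3 (fun p a c => D.metric p a c) D.normal (t, x) (incl (t, x) v))

/-- The trace `Tr_{q_t} Θ_t`. -/
def meanCurv (t : ℝ) (x : X) : ℝ :=
  trMetric (coordBasis 𝓘(ℝ, Plane) basis2 x) (D.metricX t x) (D.secondFF t x)

end SplitTuple

section Equations

variable {X : Type*} [TopologicalSpace X] [ChartedSpace Plane X]

/-- The system for the tuple `D`: the contact equations, the Hamiltonian-type, momentum-type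
and evolution equations. `o` is the orientation form of `ℝ × X`. -/
structure EtaEinsteinSystem (o : ∀ p : ℝ × X, TangentSpace modelRX p [⋀^Fin 3]→ₗ[ℝ] ℝ)
    (D : SplitTuple X) (ε lam κ : ℝ) : Prop where
  /-- `d_X α_t^⊥ = F_t ν_{q_t}` -/
  contact_d : ∀ t x v w, dForm 𝓘(ℝ, Plane) (D.formX t) x v w
    = D.F t x * volForm (coordBasis 𝓘(ℝ, Plane) basis2 x) (D.metricX t x)
        (D.inducedOrientation o t x) ![v, w]
  /-- `∗_{q_t} α_t^⊥ + β_t⁻¹ d_X (β_t F_t) = L_{n_t} α_t^⊥` on `X_t` -/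
  contact_evol : ∀ t x v,
    hodgeOne (coordBasis 𝓘(ℝ, Plane) basis2 x) (D.metricX t x)
        (D.inducedOrientation o t x) (D.formX t x) v
      + 1 / D.β t x * dFun 𝓘(ℝ, Plane) (fun y => D.β t y * D.F t y) x v
    = lieForm modelRX D.normal (fun p a => D.perpForm p a) (t, x) (SplitTuple.incl (t, x) v)
  /-- `|α_t^⊥|² = ε + F_t²` -/
  norm : ∀ t x, normSqForm (coordBasis 𝓘(ℝ, Plane) basis2 x) (D.metricX t x) (D.formX t x)
    = ε + D.F t x ^ 2
  /-- `R^{q_t} - |Θ_t|² + (Tr Θ_t)² + 𝔠 = 2 κ F_t²` with `𝔠 = (λ² - κ ε) / 2` -/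
  hamiltonian : ∀ t x, scalarCurv 𝓘(ℝ, Plane) basis2 (D.metricX t) x
      - normSqBilin (coordBasis 𝓘(ℝ, Plane) basis2 x) (D.metricX t x) (D.secondFF t x)
      + D.meanCurv t x ^ 2 + (lam ^ 2 - κ * ε) / 2
    = 2 * κ * D.F t x ^ 2
  /-- `d_X Tr Θ_t + div Θ_t = κ F_t α_t^⊥` -/
  momentum : ∀ t x v, dFun 𝓘(ℝ, Plane) (D.meanCurv t) x v
      + divBilin 𝓘(ℝ, Plane) basis2 (D.metricX t) (D.secondFF t) x v
    = κ * D.F t x * D.formX t x v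
  /-- `Ric^{q_t} + (Tr Θ_t) Θ_t - 2 Θ_t(Id ⊗ W_t) - β_t⁻¹ (∂_t Θ_t + ∇ dβ_t)
  = κ α_t^⊥ ⊗ α_t^⊥ - ½ (λ² + κ ε) q_t` -/
  evolution : ∀ t x v w, ricci 𝓘(ℝ, Plane) basis2 (D.metricX t) x v w
      + D.meanCurv t x * D.secondFF t x v w - 2 * D.secondFF t x v (D.weingarten t x w)
      - 1 / D.β t x * (D.secondFFDot t x v w
        + covForm 𝓘(ℝ, Plane) basis2 (D.metricX t) (dFun 𝓘(ℝ, Plane) (D.β t)) x v w)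
    = κ * (D.formX t x v * D.formX t x w)
      - 1 / 2 * (lam ^ 2 + κ * ε) * D.metricX t x v w

/-- The constraint equations for a metric `q`, a symmetric bilinear form `Θ`, a function `F` and
a one-form `θ` on the surface `X` oriented by `o`. -/
structure ConstraintEquations (o : ∀ x : X, TangentSpace 𝓘(ℝ, Plane) x [⋀^Fin 2]→ₗ[ℝ] ℝ)
    (q Θ : ∀ x : X, TangentSpace 𝓘(ℝ, Plane) x → TangentSpace 𝓘(ℝ, Plane) x → ℝ)
    (F : X → ℝ) (θ : ∀ x : X, TangentSpace 𝓘(ℝ, Plane) x → ℝ) (ε lam κ : ℝ) : Prop where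
  bilinear_symm : ∀ x, ∃ B : TangentSpace 𝓘(ℝ, Plane) x →ₗ[ℝ] TangentSpace 𝓘(ℝ, Plane) x →ₗ[ℝ] ℝ,
    ∀ v w, Θ x v w = B v w ∧ B v w = B w v
  contact_d : ∀ x v w, dForm 𝓘(ℝ, Plane) θ x v w
    = F x * volForm (coordBasis 𝓘(ℝ, Plane) basis2 x) (q x) (o x) ![v, w]
  norm : ∀ x, normSqForm (coordBasis 𝓘(ℝ, Plane) basis2 x) (q x) (θ x) = ε + F x ^ 2
  hamiltonian : ∀ x, scalarCurv 𝓘(ℝ, Plane) basis2 q x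
      - normSqBilin (coordBasis 𝓘(ℝ, Plane) basis2 x) (q x) (Θ x)
      + trMetric (coordBasis 𝓘(ℝ, Plane) basis2 x) (q x) (Θ x) ^ 2 + (lam ^ 2 - κ * ε) / 2
    = 2 * κ * F x ^ 2
  momentum : ∀ x v,
    dFun 𝓘(ℝ, Plane) (fun y => trMetric (coordBasis 𝓘(ℝ, Plane) basis2 y) (q y) (Θ y)) x v
      + divBilin 𝓘(ℝ, Plane) basis2 q Θ x v
    = κ * F x * θ x v

end Equations

end

/-! The theorem is the Gauss–Codazzi–Mainardi decomposition of the Einstein equation, together with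
the splitting of `α = ∗dα` into time and space components. No evolution problem is solved: at each
point of `ℝ × X` the spacetime equations are equivalent to their components along `∂_t` and along
`X`, and these components are, up to powers of `β` and one linear combination, the equations of the
system.

Contact part. Write `dα = dt ∧ A + K` with `K = d_X α^⊥` and `A = ∂_t α^⊥ - d_X(βF)`. For `g = -β²
dt² + q`, the time component of `∗dα` is `β` times the ratio `K / ν_q`, and the space component is
`-β⁻¹ ∗_q A`. Comparison with `α = Fβ dt + α^⊥` gives `K = F ν_q` and `α^⊥ = -β⁻¹ ∗_q A`. Since `∗_q
∗_q = -1` on one-forms of a surface, the latter says `β ∗_q α^⊥ = A`, which is `β` times the second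
contact equation. The norm equation is `|α|² = -F² + |α^⊥|²`. The lemmas are `contact_split` and
`normSqForm_split`.

Einstein part. The Koszul formula gives the Christoffel symbols of `g`
(`SplitMetricOn.connection_eq`), hence its curvature. The space-space part of `Ric` is the left side
of the evolution equation, and the mixed part is `β (d Tr Θ + div Θ)`. The time-time part contains
`∂_t Θ` and the Hessian of `β`, but these cancel once `β²` times the `q`-trace of the space-space
part is added (`ricci_time_time`); the sum is `β² (R^q - |Θ|² + (Tr Θ)²)`. On the right side the
same combination, with `|α^⊥|² = ε + F²`, produces `2κF² - 𝔠`, so the norm equation is needed to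
obtain the Hamiltonian one.

For the converse, the three components must determine `Ric` on all pairs of vectors. This uses
bilinearity and symmetry, which are not visible in the coordinate formula for `Ric`; they are
`SmoothMetricOn.localRicci_linear` and `SmoothMetricOn.localRicci_symm`.

All derivatives at a point are taken in one chart, where index contractions become traces of
endomorphisms (`IsMetric.trMetric_eq`). The mean curvature at a nearby point is defined with the
frame of another chart, so its derivative requires that traces do not depend on the basis
(`IsMetric.trMetric_comp`).

Part (2) is the restriction to `t = 0` of the four equations that involve only `q`, `Θ`, `F` and
`α^⊥` on a single slice. -/

noncomputable section

/-! ### Metric contractions as traces of endomorphisms -/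

section MetricAlgebra

variable {ι V : Type*} [Fintype ι] [DecidableEq ι] [AddCommGroup V] [Module ℝ V]

/-- The vector `g^{kl} θ_l b_k` that is dual to the form `θ`. -/
def sharp (b : Basis ι ℝ V) (g : V → V → ℝ) (θ : V → ℝ) : V :=
  ∑ k, (∑ l, gramInv b g k l * θ (b l)) • b k

/-- The trace of `f : V → V` computed in the basis `b`. -/
def basisTrace (b : Basis ι ℝ V) (f : V → V) : ℝ := ∑ i, b.repr (f (b i)) i

/-- A symmetric bilinear form without kernel. -/
structure IsMetric (g : V →ₗ[ℝ] V →ₗ[ℝ] ℝ) : Prop where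
  symm : ∀ v w, g v w = g w v
  nondeg : ∀ v, (∀ w, g v w = 0) → v = 0

omit [DecidableEq ι] in
theorem linear_apply_eq_sum (b : Basis ι ℝ V) (θ : V →ₗ[ℝ] ℝ) (z : V) :
    θ z = ∑ i, b.repr z i * θ (b i) := by
  conv_lhs => rw [← b.sum_repr z]
  rw [map_sum]
  simp only [map_smul, smul_eq_mul]

namespace IsMetric

variable {g : V →ₗ[ℝ] V →ₗ[ℝ] ℝ} (hg : IsMetric g) (b : Basis ι ℝ V)
include hg

theorem det_ne_zero : (Matrix.of fun k l => g (b k) (b l)).det ≠ 0 := by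
  intro h
  obtain ⟨c, hc, hz⟩ := Matrix.exists_mulVec_eq_zero_iff.mpr h
  have h0 : ∑ i, c i • b i = 0 := by
    refine hg.nondeg _ fun w => ?_
    have : ∀ k, g (b k) (∑ i, c i • b i) = 0 := fun k => by
      have := congrFun hz k
      simpa [Matrix.mulVec, dotProduct, mul_comm] using this
    rw [linear_apply_eq_sum b]
    refine Finset.sum_eq_zero fun k _ => ?_
    rw [hg.symm, this, mul_zero]
  exact hc (funext fun i => (Fintype.linearIndependent_iff.mp b.linearIndependent) c h0 i)

theorem gramInv_mul (i j : ι) :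
    ∑ k, gramInv b (fun v w => g v w) i k * g (b k) (b j) = if i = j then 1 else 0 := by
  have h := Matrix.nonsing_inv_mul (Matrix.of fun k l => g (b k) (b l))
    (isUnit_iff_ne_zero.mpr (hg.det_ne_zero b))
  have := congrFun (congrFun h i) j
  rwa [Matrix.mul_apply, Matrix.one_apply] at this

theorem gramInv_symm (i j : ι) :
    gramInv b (fun v w => g v w) i j = gramInv b (fun v w => g v w) j i := by
  have h : (Matrix.of fun k l => g (b k) (b l)).transpose = Matrix.of fun k l => g (b k) (b l) := by
    ext k l
    exact hg.symm _ _
  have := congrFun (congrFun (Matrix.transpose_nonsing_inv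
    (Matrix.of fun k l => g (b k) (b l))) j) i
  rw [h] at this
  exact this

/-- Raising the index of `g(z, ·)` returns the coordinates of `z`. All conversions from index
notation to endomorphisms below rest on this identity. -/
theorem sum_gramInv (z : V) (i : ι) :
    ∑ j, gramInv b (fun v w => g v w) i j * g z (b j) = b.repr z i := by
  conv_lhs => rw [← b.sum_repr z]
  simp only [map_sum, map_smul, LinearMap.sum_apply, LinearMap.smul_apply, smul_eq_mul,
    Finset.mul_sum]
  rw [Finset.sum_comm]
  have : ∀ k, ∑ j, gramInv b (fun v w => g v w) i j * (b.repr z k * g (b k) (b j))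
      = b.repr z k * if i = k then 1 else 0 := fun k => by
    rw [← hg.gramInv_mul b, Finset.mul_sum]
    refine Finset.sum_congr rfl fun j _ => ?_
    rw [hg.symm (b k)]
    ring
  simp [this]

theorem apply_sharp (θ : V →ₗ[ℝ] ℝ) (x : V) : g (sharp b (fun v w => g v w) θ) x = θ x := by
  have h : ∀ j, g (sharp b (fun v w => g v w) θ) (b j) = θ (b j) := fun j => by
    simp only [sharp, map_sum, map_smul, LinearMap.sum_apply, LinearMap.smul_apply, smul_eq_mul,
      Finset.sum_mul]
    rw [Finset.sum_comm]
    have : ∀ l, ∑ k, gramInv b (fun v w => g v w) k l * θ (b l) * g (b k) (b j)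
        = θ (b l) * if l = j then 1 else 0 := fun l => by
      rw [← hg.gramInv_mul b, Finset.mul_sum]
      refine Finset.sum_congr rfl fun k _ => ?_
      rw [hg.gramInv_symm b k l]
      ring
    simp [this]
  exact LinearMap.congr_fun (b.ext h : g (sharp b (fun v w => g v w) θ) = θ) x

/-- The standard way below to prove an identity between vectors defined by `sharp`: pair both sides
with an arbitrary vector, so that the inverse Gram matrix never has to be expanded. -/
theorem ext_left {v w : V} (h : ∀ x, g v x = g w x) : v = w :=
  sub_eq_zero.mp (hg.nondeg _ fun x => by simp [h])

/-- Once the contraction is the trace of the dual endomorphism, cyclicity and basis independence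
become available. -/
theorem trMetric_eq {T : V → V → ℝ} {S : V → V} (h : ∀ v w, g (S v) w = T v w) :
    trMetric b (fun v w => g v w) T = basisTrace b S := by
  simp only [trMetric, basisTrace, ← h, hg.sum_gramInv b]

theorem normSqForm_eq (θ : V →ₗ[ℝ] ℝ) {z : V} (h : ∀ x, g z x = θ x) :
    normSqForm b (fun v w => g v w) θ = θ z := by
  have : ∀ i, ∑ j, gramInv b (fun v w => g v w) i j * (θ (b i) * θ (b j))
      = θ (b i) * b.repr z i := fun i => by
    rw [← hg.sum_gramInv b, Finset.mul_sum]
    refine Finset.sum_congr rfl fun j _ => ?_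
    rw [h]
    ring
  simp only [normSqForm, this]
  rw [linear_apply_eq_sum b θ z]
  exact Finset.sum_congr rfl fun i _ => mul_comm _ _

theorem normSqBilin_eq {T : V →ₗ[ℝ] V →ₗ[ℝ] ℝ} (hT : ∀ v w, T v w = T w v) {S : V → V}
    (h : ∀ v w, g (S v) w = T v w) :
    normSqBilin b (fun v w => g v w) (fun v w => T v w) = basisTrace b (fun v => S (S v)) := by
  have h1 : ∀ i k, ∑ j, ∑ l, gramInv b (fun v w => g v w) i k * gramInv b (fun v w => g v w) j l *
      (T (b i) (b j) * T (b k) (b l)) = gramInv b (fun v w => g v w) k i * g (S (S (b k))) (b i) :=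
    fun i k => by
    have : ∀ j, ∑ l, gramInv b (fun v w => g v w) i k * gramInv b (fun v w => g v w) j l *
      (T (b i) (b j) * T (b k) (b l)) = gramInv b (fun v w => g v w) i k *
        (b.repr (S (b k)) j * T (b i) (b j)) := fun j => by
      rw [← hg.sum_gramInv b, Finset.sum_mul, Finset.mul_sum]
      refine Finset.sum_congr rfl fun l _ => ?_
      rw [h]
      ring
    simp only [this, ← Finset.mul_sum]
    rw [hg.gramInv_symm b i k, h, ← hT, linear_apply_eq_sum b (T (b i))]
  simp only [normSqBilin]
  calc _ = ∑ i, ∑ k, ∑ j, ∑ l, gramInv b (fun v w => g v w) i k *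
      gramInv b (fun v w => g v w) j l * (T (b i) (b j) * T (b k) (b l)) :=
        Finset.sum_congr rfl fun i _ => Finset.sum_comm
    _ = _ := by
      simp only [h1]
      rw [Finset.sum_comm]
      simp only [hg.sum_gramInv b, basisTrace]

end IsMetric

theorem basisTrace_eq (b : Basis ι ℝ V) (f : V →ₗ[ℝ] V) :
    basisTrace b f = LinearMap.trace ℝ V f := by
  rw [LinearMap.trace_eq_matrix_trace ℝ b, Matrix.trace]
  simp [basisTrace, LinearMap.toMatrix_apply]

theorem basisTrace_comm (b : Basis ι ℝ V) {f g : V → V} (hf : IsLinearMap ℝ f)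
    (hg : IsLinearMap ℝ g) : basisTrace b (fun v => f (g v)) = basisTrace b (fun v => g (f v)) := by
  have := LinearMap.trace_mul_comm ℝ (hf.mk' f) (hg.mk' g)
  rwa [← basisTrace_eq b, ← basisTrace_eq b] at this

omit [DecidableEq ι] in
theorem basisTrace_add (b : Basis ι ℝ V) (f g : V → V) :
    basisTrace b (fun v => f v + g v) = basisTrace b f + basisTrace b g := by
  simp [basisTrace, Finset.sum_add_distrib]

omit [DecidableEq ι] in
theorem basisTrace_sub (b : Basis ι ℝ V) (f g : V → V) :
    basisTrace b (fun v => f v - g v) = basisTrace b f - basisTrace b g := by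
  simp [basisTrace, Finset.sum_sub_distrib]

omit [DecidableEq ι] in
theorem basisTrace_smul (b : Basis ι ℝ V) (c : ℝ) (f : V → V) :
    basisTrace b (fun v => c • f v) = c * basisTrace b f := by
  simp [basisTrace, Finset.mul_sum]

omit [DecidableEq ι] in
/-- The trace of the rank one map `v ↦ θ(v) z` is `θ(z)`. -/
theorem basisTrace_smulRight (b : Basis ι ℝ V) (θ : V →ₗ[ℝ] ℝ) (z : V) :
    basisTrace b (fun v => θ v • z) = θ z := by
  rw [linear_apply_eq_sum b θ z]
  simp [basisTrace, mul_comm]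

end MetricAlgebra

/-! ### Smooth families of metrics and their Levi-Civita connections -/

section Calculus

variable {ι P E : Type*} [Fintype ι] [DecidableEq ι] [NormedAddCommGroup P] [NormedSpace ℝ P]
  [NormedAddCommGroup E] [NormedSpace ℝ E]

theorem contDiffAt_det {n : ℕ∞ω} {A : P → Matrix ι ι ℝ} {p : P}
    (h : ∀ i j, ContDiffAt ℝ n (fun y => A y i j) p) : ContDiffAt ℝ n (fun y => (A y).det) p := by
  simp only [Matrix.det_apply, Units.smul_def, zsmul_eq_mul]
  exact ContDiffAt.sum fun σ _ => contDiffAt_const.mul (contDiffAt_prod fun i _ => h _ _)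

/-- By Cramer's rule the entries of the inverse are polynomials in the entries divided by the
determinant. -/
theorem contDiffAt_matrix_inv {n : ℕ∞ω} {A : P → Matrix ι ι ℝ} {p : P}
    (h : ∀ i j, ContDiffAt ℝ n (fun y => A y i j) p) (h0 : (A p).det ≠ 0) (i j : ι) :
    ContDiffAt ℝ n (fun y => (A y)⁻¹ i j) p := by
  simp only [Matrix.inv_def, Ring.inverse_eq_inv', Matrix.smul_apply, smul_eq_mul,
    Matrix.adjugate_apply]
  refine ((contDiffAt_det h).inv h0).mul (contDiffAt_det fun k l => ?_)
  simp only [Matrix.updateRow_apply]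
  split_ifs
  · exact contDiffAt_const
  · exact h k l

theorem ContDiffAt.fderiv_apply {F : Type*} [NormedAddCommGroup F] [NormedSpace ℝ F]
    {f : P → F} {p : P} (h : ContDiffAt ℝ ∞ f p) (X : P) :
    ContDiffAt ℝ ∞ (fun y => fderiv ℝ f y X) p :=
  (h.fderiv_right (m := ∞) (by simp)).clm_apply contDiffAt_const

theorem ContDiffAt.diff {F : Type*} [NormedAddCommGroup F] [NormedSpace ℝ F]
    {f : P → F} {p : P} (h : ContDiffAt ℝ ∞ f p) : DifferentiableAt ℝ f p :=
  h.differentiableAt (by simp)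

theorem fderiv_fderiv_comm {f : P → ℝ} {p : P} (h : ContDiffAt ℝ ∞ f p) (X Y : P) :
    fderiv ℝ (fun y => fderiv ℝ f y X) p Y = fderiv ℝ (fun y => fderiv ℝ f y Y) p X := by
  have hd : DifferentiableAt ℝ (fderiv ℝ f) p := (h.fderiv_right (m := ∞) (by simp)).diff
  have e : ∀ X Y, fderiv ℝ (fun y => fderiv ℝ f y X) p Y = fderiv ℝ (fderiv ℝ f) p Y X :=
    fun X Y => by
      rw [fderiv_clm_apply hd (differentiableAt_const X)]
      simp
  rw [e, e]
  exact (h.isSymmSndFDerivAt (by simpa using ENat.LEInfty.out)).eq Y X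

omit [DecidableEq ι] in
-- Product rule for a moving form applied to a moving vector. The form is differentiable only in the
-- sense that each of its values is; expanding in the finite basis reduces the claim to products of
-- scalar functions.
theorem differentiableAt_linear_apply (b : Basis ι ℝ E) {θ : P → E →ₗ[ℝ] ℝ} {Z : P → E} {p : P}
    (hθ : ∀ v, DifferentiableAt ℝ (fun y => θ y v) p) (hZ : DifferentiableAt ℝ Z p) :
    DifferentiableAt ℝ (fun y => θ y (Z y)) p
    ∧ ∀ X, fderiv ℝ (fun y => θ y (Z y)) p X
      = fderiv ℝ (fun y => θ y (Z p)) p X + θ p (fderiv ℝ Z p X) := by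
  have : FiniteDimensional ℝ E := b.finiteDimensional_of_finite
  let c : ι → E →L[ℝ] ℝ := fun i => (b.coord i).toContinuousLinearMap
  have hc : ∀ i v, c i v = b.repr v i := fun i v => rfl
  have e : (fun y => θ y (Z y)) = fun y => ∑ i, c i (Z y) * θ y (b i) :=
    funext fun y => by simp only [hc]; exact linear_apply_eq_sum b _ _
  have e' : (fun y => θ y (Z p)) = fun y => ∑ i, c i (Z p) * θ y (b i) :=
    funext fun y => by simp only [hc]; exact linear_apply_eq_sum b _ _
  have hcZ : ∀ i, HasFDerivAt (fun y => c i (Z y)) ((c i).comp (fderiv ℝ Z p)) p := fun i =>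
    (c i).hasFDerivAt.comp p hZ.hasFDerivAt
  have h1 : HasFDerivAt (fun y => ∑ i, c i (Z y) * θ y (b i))
      (∑ i, (c i (Z p) • fderiv ℝ (fun y => θ y (b i)) p
        + θ p (b i) • (c i).comp (fderiv ℝ Z p))) p :=
    HasFDerivAt.fun_sum fun i _ => (hcZ i).mul (hθ (b i)).hasFDerivAt
  have h2 : HasFDerivAt (fun y => ∑ i, c i (Z p) * θ y (b i))
      (∑ i, c i (Z p) • fderiv ℝ (fun y => θ y (b i)) p) p :=
    HasFDerivAt.fun_sum fun i _ => (hθ (b i)).hasFDerivAt.const_mul _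
  refine ⟨e ▸ h1.differentiableAt, fun X => ?_⟩
  rw [e, e', h1.fderiv, h2.fderiv, linear_apply_eq_sum b (θ p)]
  simp [Finset.sum_add_distrib, hc, mul_comm]

/-- The derivative in a parameter of a linear form is linear. -/
theorem exists_linear_fderiv {θ : P → E →ₗ[ℝ] ℝ} {p : P}
    (hθ : ∀ v, DifferentiableAt ℝ (fun y => θ y v) p) (X : P) :
    ∃ η : E →ₗ[ℝ] ℝ, ∀ v, fderiv ℝ (fun y => θ y v) p X = η v := by
  refine ⟨{ toFun := fun v => fderiv ℝ (fun y => θ y v) p X, map_add' := ?_, map_smul' := ?_ },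
    fun v => rfl⟩
  · intro v w
    simp only [map_add]
    rw [fderiv_fun_add (hθ v) (hθ w)]
    rfl
  · intro c v
    simp only [map_smul, smul_eq_mul]
    rw [fderiv_const_mul (hθ v)]
    rfl

/-- A smooth family of metrics on `E`, with parameter in the open set `Ω`. -/
structure SmoothMetricOn (Ω : Set P) (Q : P → E →ₗ[ℝ] E →ₗ[ℝ] ℝ) : Prop where
  isOpen : IsOpen Ω
  smooth : ∀ v w, ContDiffOn ℝ ∞ (fun p => Q p v w) Ω
  symm : ∀ p v w, Q p v w = Q p w v
  nondeg : ∀ p ∈ Ω, ∀ v, (∀ w, Q p v w = 0) → v = 0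

/-- The form of the Levi-Civita connection, where `j` embeds the tangent space into the parameter
space. -/
def koszul (j : E →ₗ[ℝ] P) (Q : P → E →ₗ[ℝ] E →ₗ[ℝ] ℝ) (p : P) (v w x : E) : ℝ :=
  (fderiv ℝ (fun y => Q y w x) p (j v) + fderiv ℝ (fun y => Q y v x) p (j w)
    - fderiv ℝ (fun y => Q y v w) p (j x)) / 2

/-- The Christoffel symbol of the family `Q` along the directions in the range of `j`. -/
def connection (b : Basis ι ℝ E) (j : E →ₗ[ℝ] P) (Q : P → E →ₗ[ℝ] E →ₗ[ℝ] ℝ) (p : P) (v w : E) : E :=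
  sharp b (fun v w => Q p v w) (koszul j Q p v w)

namespace SmoothMetricOn

variable {Ω : Set P} {Q : P → E →ₗ[ℝ] E →ₗ[ℝ] ℝ} (h : SmoothMetricOn Ω Q) (b : Basis ι ℝ E)
  (j : E →ₗ[ℝ] P) {p : P} (hp : p ∈ Ω)
include h

theorem mem_nhds (hp : p ∈ Ω) : Ω ∈ 𝓝 p := h.isOpen.mem_nhds hp

theorem fderiv_symm (v w : E) (X : P) :
    fderiv ℝ (fun y => Q y v w) p X = fderiv ℝ (fun y => Q y w v) p X := by
  simp only [fun y => h.symm y v w]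

include hp

theorem isMetric : IsMetric (Q p) := ⟨h.symm p, h.nondeg p hp⟩

theorem contDiffAt (v w : E) : ContDiffAt ℝ ∞ (fun y => Q y v w) p :=
  (h.smooth v w).contDiffAt (h.mem_nhds hp)

theorem contDiffAt_sharp {θ : P → E → ℝ} (hθ : ∀ x, ContDiffAt ℝ ∞ (fun y => θ y x) p) :
    ContDiffAt ℝ ∞ (fun y => sharp b (fun v w => Q y v w) (θ y)) p := by
  unfold sharp gramInv
  refine ContDiffAt.sum fun k _ => ContDiffAt.smul (ContDiffAt.sum fun l _ =>
    ContDiffAt.mul (contDiffAt_matrix_inv (fun i j => ?_) ?_ k l) (hθ _)) contDiffAt_const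
  · exact h.contDiffAt hp _ _
  · exact (h.isMetric hp).det_ne_zero b

theorem fderiv_add (v v' w : E) (X : P) : fderiv ℝ (fun y => Q y (v + v') w) p X
    = fderiv ℝ (fun y => Q y v w) p X + fderiv ℝ (fun y => Q y v' w) p X := by
  simp only [map_add, LinearMap.add_apply]
  rw [fderiv_fun_add (h.contDiffAt hp v w).diff (h.contDiffAt hp v' w).diff]
  rfl

theorem fderiv_smul (c : ℝ) (v w : E) (X : P) : fderiv ℝ (fun y => Q y (c • v) w) p X
    = c * fderiv ℝ (fun y => Q y v w) p X := by
  simp only [map_smul, LinearMap.smul_apply, smul_eq_mul]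
  rw [fderiv_const_mul (h.contDiffAt hp v w).diff]
  rfl

theorem fderiv_add_right (v w w' : E) (X : P) : fderiv ℝ (fun y => Q y v (w + w')) p X
    = fderiv ℝ (fun y => Q y v w) p X + fderiv ℝ (fun y => Q y v w') p X := by
  rw [h.fderiv_symm v, h.fderiv_add hp, h.fderiv_symm v, h.fderiv_symm v]

theorem fderiv_smul_right (c : ℝ) (v w : E) (X : P) : fderiv ℝ (fun y => Q y v (c • w)) p X
    = c * fderiv ℝ (fun y => Q y v w) p X := by
  rw [h.fderiv_symm v, h.fderiv_smul hp, h.fderiv_symm v]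

omit [DecidableEq ι] in
theorem fderiv_apply (b : Basis ι ℝ E) {Z : P → E} (hZ : DifferentiableAt ℝ Z p) (x : E) (X : P) :
    fderiv ℝ (fun y => Q y (Z y) x) p X
      = fderiv ℝ (fun y => Q y (Z p) x) p X + Q p (fderiv ℝ Z p X) x :=
  (differentiableAt_linear_apply b (θ := fun y => (Q y).flip x)
    (fun v => (h.contDiffAt hp v x).diff) hZ).2 X

omit [DecidableEq ι] in
/-- The derivative of a vector field that is dual to a family of forms. -/
theorem apply_fderiv (b : Basis ι ℝ E) {Z : P → E} (hZ : DifferentiableAt ℝ Z p) {θ : P → E → ℝ}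
    (hθ : ∀ y ∈ Ω, ∀ x, Q y (Z y) x = θ y x) (X : P) (x : E) :
    Q p (fderiv ℝ Z p X) x
      = fderiv ℝ (fun y => θ y x) p X - fderiv ℝ (fun y => Q y (Z p) x) p X := by
  have e : (fun y => θ y x) =ᶠ[𝓝 p] fun y => Q y (Z y) x :=
    Filter.eventually_of_mem (h.mem_nhds hp) fun y hy => (hθ y hy x).symm
  rw [e.fderiv_eq, h.fderiv_apply hp b hZ]
  ring

/-- The Koszul expression is linear in its last argument, so the vector built from its values on the
basis represents it on all vectors. Taking `j` to be the identity gives the connection of a metric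
on the whole parameter space; taking `j = LinearMap.inr ℝ ℝ E` gives the connection of a
time-dependent metric on the slices. -/
theorem apply_connection (v w x : E) : Q p (connection b j Q p v w) x = koszul j Q p v w x := by
  let θ : E →ₗ[ℝ] ℝ :=
    { toFun := koszul j Q p v w
      map_add' := fun x y => by
        simp only [koszul, h.fderiv_add_right hp, map_add j, (fderiv ℝ _ p).map_add]
        ring
      map_smul' := fun c x => by
        simp only [koszul, h.fderiv_smul_right hp, map_smul j, (fderiv ℝ _ p).map_smul, smul_eq_mul,
          RingHom.id_apply]
        ring }
  exact (h.isMetric hp).apply_sharp b θ x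

theorem connection_symm (v w : E) : connection b j Q p v w = connection b j Q p w v := by
  refine (h.isMetric hp).ext_left fun x => ?_
  rw [h.apply_connection b j hp, h.apply_connection b j hp, koszul, koszul, h.fderiv_symm v w]
  ring

theorem connection_linear (v : E) : IsLinearMap ℝ (connection b j Q p v) := by
  constructor
  · intro w w'
    refine (h.isMetric hp).ext_left fun x => ?_
    simp only [(Q p).map_add, LinearMap.add_apply, h.apply_connection b j hp, koszul,
      h.fderiv_add hp, h.fderiv_add_right hp, map_add j, (fderiv ℝ _ p).map_add]
    ring
  · intro c w
    refine (h.isMetric hp).ext_left fun x => ?_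
    simp only [(Q p).map_smul, LinearMap.smul_apply, h.apply_connection b j hp, koszul,
      h.fderiv_smul hp, h.fderiv_smul_right hp, map_smul j, (fderiv ℝ _ p).map_smul, smul_eq_mul]
    ring

theorem connection_compatible (z v w : E) : fderiv ℝ (fun y => Q y v w) p (j z)
    = Q p (connection b j Q p z v) w + Q p v (connection b j Q p z w) := by
  rw [h.symm p v, h.apply_connection b j hp, h.apply_connection b j hp, koszul, koszul,
    h.fderiv_symm w v]
  ring

theorem contDiffAt_connection (v w : E) : ContDiffAt ℝ ∞ (fun y => connection b j Q y v w) p := by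
  refine h.contDiffAt_sharp b hp fun x => ?_
  unfold koszul
  exact (((((h.contDiffAt hp _ _).fderiv_apply _).add ((h.contDiffAt hp _ _).fderiv_apply _)).sub
    ((h.contDiffAt hp _ _).fderiv_apply _)).div_const 2)

end SmoothMetricOn

end Calculus

/-! ### Symmetry of the Ricci tensor -/

section RicciSymmetry

variable {ι P E : Type*} [Fintype ι] [DecidableEq ι] [NormedAddCommGroup P] [NormedSpace ℝ P]
  [NormedAddCommGroup E] [NormedSpace ℝ E]

omit [DecidableEq ι] in
theorem hasFDerivAt_basisTrace (b : Basis ι ℝ E) {f : P → E → E} {p : P}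
    (hf : ∀ v, DifferentiableAt ℝ (fun y => f y v) p) :
    DifferentiableAt ℝ (fun y => basisTrace b (f y)) p
    ∧ ∀ X, fderiv ℝ (fun y => basisTrace b (f y)) p X
      = basisTrace b (fun v => fderiv ℝ (fun y => f y v) p X) := by
  have : FiniteDimensional ℝ E := b.finiteDimensional_of_finite
  let c : ι → E →L[ℝ] ℝ := fun i => (b.coord i).toContinuousLinearMap
  have h : HasFDerivAt (fun y => ∑ i, c i (f y (b i)))
      (∑ i, (c i).comp (fderiv ℝ (fun y => f y (b i)) p)) p :=
    HasFDerivAt.fun_sum fun i _ => (c i).hasFDerivAt.comp p (hf (b i)).hasFDerivAt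
  refine ⟨h.differentiableAt, fun X => ?_⟩
  have e := congrArg (fun L : P →L[ℝ] ℝ => L X) h.fderiv
  simp only [sum_apply, ContinuousLinearMap.comp_apply] at e
  exact e

theorem trMetric_add (b : Basis ι ℝ E) (g T T' : E → E → ℝ) :
    trMetric b g (fun v w => T v w + T' v w) = trMetric b g T + trMetric b g T' := by
  simp [trMetric, mul_add, Finset.sum_add_distrib]

theorem trMetric_smul (b : Basis ι ℝ E) (g : E → E → ℝ) (c : ℝ) (T : E → E → ℝ) :
    trMetric b g (fun v w => c * T v w) = c * trMetric b g T := by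
  simp only [trMetric, Finset.mul_sum]
  exact Finset.sum_congr rfl fun i _ => Finset.sum_congr rfl fun j _ => by ring

theorem trMetric_sub (b : Basis ι ℝ E) (g T T' : E → E → ℝ) :
    trMetric b g (fun v w => T v w - T' v w) = trMetric b g T - trMetric b g T' := by
  simp [trMetric, mul_sub, Finset.sum_sub_distrib]

theorem IsMetric.trMetric_swap {g : E →ₗ[ℝ] E →ₗ[ℝ] ℝ} (hg : IsMetric g) (b : Basis ι ℝ E)
    (T : E → E → ℝ) :
    trMetric b (fun v w => g v w) (fun v w => T w v) = trMetric b (fun v w => g v w) T := by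
  simp only [trMetric]
  rw [Finset.sum_comm]
  exact Finset.sum_congr rfl fun i _ => Finset.sum_congr rfl fun j _ => by
    rw [hg.gramInv_symm b]

/-- The endomorphism that is dual to the derivative of the metric in the direction `X`. -/
def metricDeriv (b : Basis ι ℝ E) (Q : P → E →ₗ[ℝ] E →ₗ[ℝ] ℝ) (p X : P) (v : E) : E :=
  sharp b (fun v w => Q p v w) (fun x => fderiv ℝ (fun y => Q y v x) p X)

namespace SmoothMetricOn

variable {Ω : Set P} {Q : P → E →ₗ[ℝ] E →ₗ[ℝ] ℝ} (h : SmoothMetricOn Ω Q) (b : Basis ι ℝ E)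
  {p : P} (hp : p ∈ Ω)
include h hp

theorem apply_metricDeriv (X : P) (v x : E) :
    Q p (metricDeriv b Q p X v) x = fderiv ℝ (fun y => Q y v x) p X := by
  obtain ⟨η, hη⟩ := exists_linear_fderiv (θ := fun y => Q y v)
    (fun x => (h.contDiffAt hp v x).diff) X
  simp only [metricDeriv, hη]
  exact (h.isMetric hp).apply_sharp b η x

theorem metricDeriv_linear (X : P) : IsLinearMap ℝ (metricDeriv b Q p X) := by
  constructor
  · intro v w
    refine (h.isMetric hp).ext_left fun x => ?_
    simp only [(Q p).map_add, LinearMap.add_apply, h.apply_metricDeriv b hp, h.fderiv_add hp]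
  · intro c v
    refine (h.isMetric hp).ext_left fun x => ?_
    simp only [(Q p).map_smul, LinearMap.smul_apply, h.apply_metricDeriv b hp, h.fderiv_smul hp,
      smul_eq_mul]

theorem contDiffAt_metricDeriv (X : P) (v : E) :
    ContDiffAt ℝ ∞ (fun y => metricDeriv b Q y X v) p :=
  h.contDiffAt_sharp b hp fun x => (h.contDiffAt hp v x).fderiv_apply X

/-- The derivative of `g⁻¹ ∂_X g` is `g⁻¹ ∂_Y ∂_X g - (g⁻¹ ∂_Y g)(g⁻¹ ∂_X g)`; this is the rule for
differentiating an inverse, with one index lowered. -/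
theorem apply_fderiv_metricDeriv (X Y : P) (v x : E) :
    Q p (fderiv ℝ (fun y => metricDeriv b Q y X v) p Y) x
      = fderiv ℝ (fun y => fderiv ℝ (fun y => Q y v x) y X) p Y
        - Q p (metricDeriv b Q p Y (metricDeriv b Q p X v)) x := by
  rw [h.apply_metricDeriv b hp]
  exact h.apply_fderiv hp b (h.contDiffAt_metricDeriv b hp X v).diff
    (θ := fun y x => fderiv ℝ (fun y => Q y v x) y X)
    (fun y hy x => h.apply_metricDeriv b hy X v x) Y x

/-- A replacement for the equality of mixed derivatives of `log |det g|`. The second derivatives of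
`g` commute, and the two quadratic corrections have the same trace by cyclicity. -/
theorem fderiv_metricDeriv_comm (X Y : P) :
    basisTrace b (fun v => fderiv ℝ (fun y => metricDeriv b Q y X v) p Y)
      = basisTrace b (fun v => fderiv ℝ (fun y => metricDeriv b Q y Y v) p X) := by
  have e : ∀ v, fderiv ℝ (fun y => metricDeriv b Q y X v) p Y
      + metricDeriv b Q p Y (metricDeriv b Q p X v)
      = fderiv ℝ (fun y => metricDeriv b Q y Y v) p X
      + metricDeriv b Q p X (metricDeriv b Q p Y v) := fun v => by
    refine (h.isMetric hp).ext_left fun x => ?_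
    simp only [map_add, LinearMap.add_apply, h.apply_fderiv_metricDeriv b hp]
    rw [fderiv_fderiv_comm (h.contDiffAt hp v x)]
    ring
  have t := congrArg (basisTrace b) (funext e)
  rw [basisTrace_add, basisTrace_add,
    basisTrace_comm b (h.metricDeriv_linear b hp Y) (h.metricDeriv_linear b hp X)] at t
  linarith

/-- The classical identity `Γ^k_{kz} = ½ g^{kl} ∂_z g_{kl}`: the other two terms of the Koszul
formula are exchanged by swapping the contracted arguments, hence cancel in the trace. -/
theorem trace_connection (j : E →ₗ[ℝ] P) (z : E) :
    basisTrace b (fun v => connection b j Q p v z)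
      = 1 / 2 * basisTrace b (metricDeriv b Q p (j z)) := by
  have e1 := (h.isMetric hp).trMetric_eq b (h.apply_metricDeriv b hp (j z))
  have e2 := (h.isMetric hp).trMetric_eq b (T := fun v x => koszul j Q p v z x)
    (S := fun v => connection b j Q p v z) (fun v x => h.apply_connection b j hp v z x)
  rw [← e1, ← e2]
  have e3 : (fun v x => koszul j Q p v z x) = fun v x =>
      1 / 2 * (fderiv ℝ (fun y => Q y v x) p (j z) +
        (fderiv ℝ (fun y => Q y z x) p (j v) - fderiv ℝ (fun y => Q y z v) p (j x))) := by
    funext v x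
    rw [koszul, h.fderiv_symm v z]
    ring
  rw [e3, trMetric_smul, trMetric_add, trMetric_sub,
    (h.isMetric hp).trMetric_swap b (fun v x => fderiv ℝ (fun y => Q y z x) p (j v))]
  ring

end SmoothMetricOn

/-- Of the four terms of `Ric(w, z)`, those containing `Γ(w, z)` are symmetric because the torsion
vanishes, and the trace of `Γ(w, Γ(z, ·))` is symmetric by cyclicity. The remaining one, `∂_w
Γ^k_{kz}`, is half of a derivative covered by `fderiv_metricDeriv_comm`. -/
theorem SmoothMetricOn.localRicci_symm {Ω : Set E} {Q : E → E →ₗ[ℝ] E →ₗ[ℝ] ℝ}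
    (h : SmoothMetricOn Ω Q) (b : Basis ι ℝ E) {p : E} (hp : p ∈ Ω) (w z : E) :
    localRicci b (fun u v w => Q u v w) p w z = localRicci b (fun u v w => Q u v w) p z w := by
  let Γ := connection b LinearMap.id Q
  have hΓ : ∀ v w, DifferentiableAt ℝ (fun y => Γ y v w) p := fun v w =>
    (h.contDiffAt_connection b _ hp v w).diff
  have e : ∀ w z, localRicci b (fun u v w => Q u v w) p w z
      = basisTrace b (fun v => fderiv ℝ (fun y => Γ y w z) p v)
        - basisTrace b (fun v => fderiv ℝ (fun y => Γ y v z) p w)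
        + basisTrace b (fun v => Γ p v (Γ p w z)) - basisTrace b (fun v => Γ p w (Γ p z v)) :=
    fun w z => by
      rw [← basisTrace_sub, ← basisTrace_add, ← basisTrace_sub]
      simp only [Γ, h.connection_symm b _ hp z]
      rfl
  have t1 : fderiv ℝ (fun y => Γ y w z) p = fderiv ℝ (fun y => Γ y z w) p :=
    Filter.EventuallyEq.fderiv_eq (Filter.eventually_of_mem (h.mem_nhds hp) fun y hy =>
      h.connection_symm b _ hy w z)
  have t2 : ∀ w z, basisTrace b (fun v => fderiv ℝ (fun y => Γ y v z) p w)
      = 1 / 2 * basisTrace b (fun v => fderiv ℝ (fun y => metricDeriv b Q y z v) p w) :=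
    fun w z => by
      have hm := hasFDerivAt_basisTrace b (f := fun y => metricDeriv b Q y z)
        fun v => (h.contDiffAt_metricDeriv b hp z v).diff
      rw [← (hasFDerivAt_basisTrace b (f := fun y v => Γ y v z) fun v => hΓ v z).2, ← hm.2]
      have : (fun y => basisTrace b fun v => Γ y v z)
          =ᶠ[𝓝 p] fun y => 1 / 2 * basisTrace b (metricDeriv b Q y z) :=
        Filter.eventually_of_mem (h.mem_nhds hp) fun y hy =>
          h.trace_connection b hy LinearMap.id z
      rw [this.fderiv_eq, fderiv_const_mul hm.1]
      rfl
  rw [e, e, t1, t2, t2, h.fderiv_metricDeriv_comm b hp w z,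
    basisTrace_comm b (h.connection_linear b _ hp w) (h.connection_linear b _ hp z),
    show Γ p w z = Γ p z w from h.connection_symm b _ hp w z]

end RicciSymmetry

/-! ### Christoffel symbols of `-β² dt² + Q` -/

section SplitMetric

variable {ι κ E : Type*} [Fintype ι] [DecidableEq ι] [Fintype κ] [DecidableEq κ]
  [NormedAddCommGroup E] [NormedSpace ℝ E]

/-- The differential of `β` along the second factor. -/
def spatialDiff (β : ℝ × E → ℝ) (p : ℝ × E) (v : E) : ℝ := fderiv ℝ β p (0, v)

/-- The gradient of `β` along the second factor. -/
def spatialGrad (b : Basis ι ℝ E) (β : ℝ × E → ℝ) (Q : ℝ × E → E →ₗ[ℝ] E →ₗ[ℝ] ℝ) (p : ℝ × E) : E :=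
  sharp b (fun v w => Q p v w) (spatialDiff β p)

/-- The bilinear form `-(2β)⁻¹ ∂_t Q`. -/
def extrinsic (β : ℝ × E → ℝ) (Q : ℝ × E → E →ₗ[ℝ] E →ₗ[ℝ] ℝ) (p : ℝ × E) (v w : E) : ℝ :=
  -(1 / (2 * β p)) * fderiv ℝ (fun y => Q y v w) p (1, 0)

/-- The endomorphism that is dual to `extrinsic`. -/
def shape (b : Basis ι ℝ E) (β : ℝ × E → ℝ) (Q : ℝ × E → E →ₗ[ℝ] E →ₗ[ℝ] ℝ) (p : ℝ × E) (v : E) : E :=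
  (-(1 / (2 * β p))) • metricDeriv b Q p (1, 0) v

/-- The Levi-Civita connection of `Q` along the second factor. -/
def spatialConnection (b : Basis ι ℝ E) (Q : ℝ × E → E →ₗ[ℝ] E →ₗ[ℝ] ℝ) (p : ℝ × E) (v w : E) : E :=
  connection b (LinearMap.inr ℝ ℝ E) Q p v w

/-- `G = -β² dt² + Q` on the open set `Ω`. -/
structure SplitMetricOn (Ω : Set (ℝ × E)) (β : ℝ × E → ℝ) (Q : ℝ × E → E →ₗ[ℝ] E →ₗ[ℝ] ℝ)
    (G : ℝ × E → (ℝ × E) →ₗ[ℝ] (ℝ × E) →ₗ[ℝ] ℝ) : Prop where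
  metric : SmoothMetricOn Ω G
  spatial : SmoothMetricOn Ω Q
  lapse : ContDiffOn ℝ ∞ β Ω
  lapse_ne : ∀ p ∈ Ω, β p ≠ 0
  apply : ∀ p ∈ Ω, ∀ a c v w, G p (a, v) (c, w) = -(β p) ^ 2 * (a * c) + Q p v w

theorem fderiv_prod_apply {F : Type*} [NormedAddCommGroup F] [NormedSpace ℝ F] (f : ℝ × E → F)
    (p : ℝ × E) (a : ℝ) (v : E) : fderiv ℝ f p (a, v) = a • fderiv ℝ f p (1, 0) + fderiv ℝ f p (0, v) := by
  rw [← map_smul, ← map_add]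
  simp

theorem fderiv_slice {F : Type*} [NormedAddCommGroup F] [NormedSpace ℝ F] {f : ℝ × E → F}
    {t : ℝ} {u : E} (hf : DifferentiableAt ℝ f (t, u)) (v : E) :
    fderiv ℝ (fun y => f (t, y)) u v = fderiv ℝ f (t, u) (0, v) := by
  have := hf.hasFDerivAt.comp u (hasFDerivAt_prodMk_right (𝕜 := ℝ) t u)
  have e := congrArg (fun L : E →L[ℝ] F => L v) this.fderiv
  simpa [Function.comp_def] using e

theorem deriv_slice {F : Type*} [NormedAddCommGroup F] [NormedSpace ℝ F] {f : ℝ × E → F}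
    {t : ℝ} {u : E} (hf : DifferentiableAt ℝ f (t, u)) :
    deriv (fun s => f (s, u)) t = fderiv ℝ f (t, u) (1, 0) := by
  have := hf.hasFDerivAt.comp t (hasFDerivAt_prodMk_left (𝕜 := ℝ) t u)
  have e := congrArg (fun L : ℝ →L[ℝ] F => L 1) this.fderiv
  simpa [Function.comp_def, fderiv_apply_one_eq_deriv] using e

theorem fderiv_fst_snd {F P : Type*} [NormedAddCommGroup F] [NormedSpace ℝ F]
    [NormedAddCommGroup P] [NormedSpace ℝ P] {f : P → ℝ × F} {p : P}
    (hf : DifferentiableAt ℝ f p) (X : P) :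
    (fderiv ℝ f p X).1 = fderiv ℝ (fun y => (f y).1) p X
    ∧ (fderiv ℝ f p X).2 = fderiv ℝ (fun y => (f y).2) p X := by
  constructor
  · have := congrArg (fun L : P →L[ℝ] ℝ => L X) hf.hasFDerivAt.fst.fderiv
    exact this.symm
  · have := congrArg (fun L : P →L[ℝ] F => L X) hf.hasFDerivAt.snd.fderiv
    exact this.symm

namespace SplitMetricOn

variable {Ω : Set (ℝ × E)} {β : ℝ × E → ℝ} {Q : ℝ × E → E →ₗ[ℝ] E →ₗ[ℝ] ℝ}
  {G : ℝ × E → (ℝ × E) →ₗ[ℝ] (ℝ × E) →ₗ[ℝ] ℝ} (h : SplitMetricOn Ω β Q G) (b : Basis ι ℝ E)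
  {p : ℝ × E} (hp : p ∈ Ω)
include h hp

theorem contDiffAt_lapse : ContDiffAt ℝ ∞ β p := h.lapse.contDiffAt (h.spatial.mem_nhds hp)

theorem apply_spatialGrad (x : E) : Q p (spatialGrad b β Q p) x = spatialDiff β p x :=
  (h.spatial.isMetric hp).apply_sharp b
    ((fderiv ℝ β p).toLinearMap ∘ₗ LinearMap.inr ℝ ℝ E) x

theorem apply_shape (v x : E) : Q p (shape b β Q p v) x = extrinsic β Q p v x := by
  simp only [shape, map_smul, LinearMap.smul_apply, smul_eq_mul, h.spatial.apply_metricDeriv b hp,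
    extrinsic]

theorem fderiv_time (v w : E) :
    fderiv ℝ (fun y => Q y v w) p (1, 0) = -2 * β p * extrinsic β Q p v w := by
  have := h.lapse_ne p hp
  rw [extrinsic]
  field_simp

omit hp in
theorem extrinsic_symm (v w : E) : extrinsic β Q p v w = extrinsic β Q p w v := by
  rw [extrinsic, extrinsic, h.spatial.fderiv_symm]

theorem shape_linear : IsLinearMap ℝ (shape b β Q p) := by
  have := h.spatial.metricDeriv_linear b hp (1, 0)
  constructor
  · intro v w
    rw [shape, this.map_add, smul_add]
    rfl
  · intro c v
    rw [shape, this.map_smul, smul_comm]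
    rfl

theorem contDiffAt_extrinsic (v w : E) : ContDiffAt ℝ ∞ (fun y => extrinsic β Q y v w) p := by
  unfold extrinsic
  have := h.lapse_ne p hp
  exact (contDiffAt_const.div (contDiffAt_const.mul (h.contDiffAt_lapse hp)) (by simpa)).neg.mul
    ((h.spatial.contDiffAt hp v w).fderiv_apply _)

theorem contDiffAt_shape (v : E) : ContDiffAt ℝ ∞ (fun y => shape b β Q y v) p := by
  unfold shape
  have := h.lapse_ne p hp
  exact (contDiffAt_const.div (contDiffAt_const.mul (h.contDiffAt_lapse hp)) (by simpa)).neg.smul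
    (h.spatial.contDiffAt_metricDeriv b hp _ v)

theorem contDiffAt_spatialDiff (v : E) : ContDiffAt ℝ ∞ (fun y => spatialDiff β y v) p :=
  (h.contDiffAt_lapse hp).fderiv_apply _

theorem contDiffAt_spatialGrad : ContDiffAt ℝ ∞ (fun y => spatialGrad b β Q y) p :=
  h.spatial.contDiffAt_sharp b hp (h.contDiffAt_spatialDiff hp)

theorem spatialConnection_symm (v w : E) :
    spatialConnection b Q p v w = spatialConnection b Q p w v :=
  h.spatial.connection_symm b _ hp v w

/-- The Christoffel symbols of the split metric. -/
theorem connection_eq (B : Basis κ ℝ (ℝ × E)) (a c : ℝ) (v w : E) :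
    connection B LinearMap.id G p (a, v) (c, w)
      = ((fderiv ℝ β p (1, 0) * (a * c) + a * spatialDiff β p w + c * spatialDiff β p v
          - extrinsic β Q p v w) / β p,
        spatialConnection b Q p v w + (a * c * β p) • spatialGrad b β Q p
          - β p • (a • shape b β Q p w + c • shape b β Q p v)) := by
  have hβ := h.lapse_ne p hp
  have hd := (h.contDiffAt_lapse hp).diff
  -- Both sides are paired with an arbitrary `(e, x)`. The Koszul formula for `G` then needs only
  -- the first derivatives of `G` collected in `k`.
  refine (h.metric.isMetric hp).ext_left fun X => ?_
  obtain ⟨e, x⟩ := X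
  have k : ∀ (a c e d : ℝ) (v w x : E), fderiv ℝ (fun y => G y (c, w) (e, x)) p (a, v)
      = -2 * β p * (a * fderiv ℝ β p (1, 0) + spatialDiff β p v) * (c * e)
        + (a * (-2 * β p * extrinsic β Q p w x) + fderiv ℝ (fun y => Q y w x) p (0, v)) := by
    intro a c e d v w x
    have e1 : (fun y => G y (c, w) (e, x)) =ᶠ[𝓝 p]
        fun y => -(β y) ^ 2 * (c * e) + Q y w x :=
      Filter.eventually_of_mem (h.metric.mem_nhds hp) fun y hy => h.apply y hy _ _ _ _
    have e2 := (((hd.hasFDerivAt.pow 2).neg.mul_const (c * e)).add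
      (h.spatial.contDiffAt hp w x).diff.hasFDerivAt).fderiv
    rw [e1.fderiv_eq]
    have e3 := congrArg (fun L : ℝ × E →L[ℝ] ℝ => L (a, v)) e2
    refine Eq.trans e3 ?_
    simp only [add_apply, smul_apply,
      neg_apply, smul_eq_mul, fderiv_prod_apply _ p a v]
    rw [h.fderiv_time hp, spatialDiff]
    norm_num
    ring
  rw [h.metric.apply_connection B _ hp, h.apply p hp, koszul]
  simp only [LinearMap.id_apply]
  rw [k a c e 0, k c a e 0, k e a c 0]
  simp only [map_add, map_sub, map_smul, LinearMap.add_apply, LinearMap.sub_apply,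
    LinearMap.smul_apply, smul_eq_mul, h.apply_spatialGrad b hp, h.apply_shape b hp]
  rw [spatialConnection, h.spatial.apply_connection b _ hp, koszul]
  simp only [LinearMap.inr_apply]
  field_simp
  ring

end SplitMetricOn

end SplitMetric

/-! ### Curvature components of the split metric -/

section SplitRicci

variable {ι κ E : Type*} [Fintype ι] [DecidableEq ι] [Fintype κ] [DecidableEq κ]
  [NormedAddCommGroup E] [NormedSpace ℝ E]

/-- The Ricci tensor of `Q` along the second factor. -/
def spatialRicci (b : Basis ι ℝ E) (Q : ℝ × E → E →ₗ[ℝ] E →ₗ[ℝ] ℝ) (p : ℝ × E) (w z : E) : ℝ :=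
  basisTrace b fun v => fderiv ℝ (fun y => spatialConnection b Q y w z) p (0, v)
    - fderiv ℝ (fun y => spatialConnection b Q y v z) p (0, w)
    + spatialConnection b Q p v (spatialConnection b Q p w z)
    - spatialConnection b Q p w (spatialConnection b Q p v z)

/-- The Hessian of `β` along the second factor. -/
def spatialHess (b : Basis ι ℝ E) (β : ℝ × E → ℝ) (Q : ℝ × E → E →ₗ[ℝ] E →ₗ[ℝ] ℝ) (p : ℝ × E)
    (v w : E) : ℝ :=
  fderiv ℝ (fun y => spatialDiff β y w) p (0, v) - spatialDiff β p (spatialConnection b Q p v w)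

/-- The covariant derivative along the second factor of `extrinsic`. -/
def spatialCovExtrinsic (b : Basis ι ℝ E) (β : ℝ × E → ℝ) (Q : ℝ × E → E →ₗ[ℝ] E →ₗ[ℝ] ℝ)
    (p : ℝ × E) (v w z : E) : ℝ :=
  fderiv ℝ (fun y => extrinsic β Q y w z) p (0, v)
    - extrinsic β Q p (spatialConnection b Q p v w) z
    - extrinsic β Q p w (spatialConnection b Q p v z)

theorem SmoothMetricOn.christoffel_slice {Ω : Set (ℝ × E)} {Q : ℝ × E → E →ₗ[ℝ] E →ₗ[ℝ] ℝ}
    (h : SmoothMetricOn Ω Q) (b : Basis ι ℝ E) {t : ℝ} {u : E} (hp : (t, u) ∈ Ω) (v w : E) :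
    christoffel b (fun y v w => Q (t, y) v w) u v w = spatialConnection b Q (t, u) v w := by
  have e : ∀ v w x, fderiv ℝ (fun y => Q (t, y) v w) u x
      = fderiv ℝ (fun y => Q y v w) (t, u) (0, x) := fun v w x =>
    fderiv_slice (f := fun y => Q y v w) (h.contDiffAt hp v w).diff x
  simp only [christoffel, e]
  rfl

theorem SmoothMetricOn.localRicci_slice {Ω : Set (ℝ × E)} {Q : ℝ × E → E →ₗ[ℝ] E →ₗ[ℝ] ℝ}
    (h : SmoothMetricOn Ω Q) (b : Basis ι ℝ E) {t : ℝ} {u : E} (hp : (t, u) ∈ Ω) (w z : E) :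
    localRicci b (fun y v w => Q (t, y) v w) u w z = spatialRicci b Q (t, u) w z := by
  have e : ∀ v w x, fderiv ℝ (fun y => christoffel b (fun y v w => Q (t, y) v w) y v w) u x
      = fderiv ℝ (fun y => spatialConnection b Q y v w) (t, u) (0, x) := fun v w x => by
    rw [← fderiv_slice (f := fun y => spatialConnection b Q y v w)
      (h.contDiffAt_connection b _ hp v w).diff]
    congr 1
    -- The two connections agree only where `(t, y)` stays in `Ω`, which holds for `y` near `u`
    -- because `Ω` is open.
    refine Filter.EventuallyEq.fderiv_eq ?_
    filter_upwards [(Continuous.prodMk_right t).continuousAt.preimage_mem_nhds (h.mem_nhds hp)]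
      with y hy
    exact h.christoffel_slice b hy v w
  simp only [localRicci, localRiemann, e, h.christoffel_slice b hp]
  rfl

namespace SplitMetricOn

variable {Ω : Set (ℝ × E)} {β : ℝ × E → ℝ} {Q : ℝ × E → E →ₗ[ℝ] E →ₗ[ℝ] ℝ}
  {G : ℝ × E → (ℝ × E) →ₗ[ℝ] (ℝ × E) →ₗ[ℝ] ℝ} (h : SplitMetricOn Ω β Q G) (b : Basis ι ℝ E)
  {p : ℝ × E} (hp : p ∈ Ω) (B : Basis κ ℝ (ℝ × E))
include h hp

theorem connection_space_space (v w : E) : connection B LinearMap.id G p (0, v) (0, w)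
    = (-(extrinsic β Q p v w / β p), spatialConnection b Q p v w) := by
  rw [h.connection_eq b hp]
  simp [neg_div]

theorem connection_time_space (w : E) : connection B LinearMap.id G p (1, 0) (0, w)
    = (spatialDiff β p w / β p, -(β p • shape b β Q p w)) := by
  have h1 : extrinsic β Q p 0 w = 0 := by simp [extrinsic]
  have h2 : spatialConnection b Q p 0 w = 0 := by
    rw [h.spatialConnection_symm b hp]
    exact (h.spatial.connection_linear b _ hp w).map_zero
  rw [h.connection_eq b hp]
  simp [h1, h2]

theorem connection_space_time (w : E) : connection B LinearMap.id G p (0, w) (1, 0)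
    = (spatialDiff β p w / β p, -(β p • shape b β Q p w)) := by
  rw [h.metric.connection_symm B _ hp]
  exact h.connection_time_space b hp B w

theorem connection_time_time : connection B LinearMap.id G p (1, 0) (1, 0)
    = (fderiv ℝ β p (1, 0) / β p, β p • spatialGrad b β Q p) := by
  have h1 : extrinsic β Q p 0 0 = 0 := by simp [extrinsic]
  have h2 : spatialConnection b Q p 0 0 = 0 :=
    (h.spatial.connection_linear b _ hp 0).map_zero
  have h3 : shape b β Q p 0 = 0 := (h.shape_linear b hp).map_zero
  have h4 : spatialDiff β p 0 = 0 := (fderiv ℝ β p).map_zero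
  rw [h.connection_eq b hp]
  simp [h1, h2, h3, h4]

/-- Allows the closed formulas for the Christoffel symbols to be differentiated one component at a
time. The formula is required on all of `Ω`, since agreement at `p` alone would not determine the
derivative. -/
theorem fderiv_connection {Y Z : ℝ × E} {f₁ : ℝ × E → ℝ} {f₂ : ℝ × E → E}
    (hf : ∀ y ∈ Ω, connection B LinearMap.id G y Y Z = (f₁ y, f₂ y)) (X : ℝ × E) :
    fderiv ℝ (fun y => connection B LinearMap.id G y Y Z) p X
      = (fderiv ℝ f₁ p X, fderiv ℝ f₂ p X) := by
  have hd := fderiv_fst_snd (h.metric.contDiffAt_connection B LinearMap.id hp Y Z).diff X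
  refine Prod.ext ?_ ?_
  · rw [hd.1]
    congr 1
    exact Filter.EventuallyEq.fderiv_eq (Filter.eventually_of_mem (h.metric.mem_nhds hp)
      fun y hy => by simp only [hf y hy])
  · rw [hd.2]
    congr 1
    exact Filter.EventuallyEq.fderiv_eq (Filter.eventually_of_mem (h.metric.mem_nhds hp)
      fun y hy => by simp only [hf y hy])

omit [Fintype κ] [DecidableEq κ] in
theorem fderiv_div_lapse {f : ℝ × E → ℝ} (hf : DifferentiableAt ℝ f p) (X : ℝ × E) :
    fderiv ℝ (fun y => f y / β y) p X
      = fderiv ℝ f p X / β p - f p * fderiv ℝ β p X / β p ^ 2 := by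
  have hβ := h.lapse_ne p hp
  have e := congrArg (fun L : ℝ × E →L[ℝ] ℝ => L X)
    (hf.hasFDerivAt.mul ((hasDerivAt_inv hβ).comp_hasFDerivAt p
      (h.contDiffAt_lapse hp).diff.hasFDerivAt)).fderiv
  refine Eq.trans e ?_
  simp only [add_apply, smul_apply, smul_eq_mul, Function.comp_apply]
  field_simp
  ring

omit [Fintype κ] [DecidableEq κ] in
theorem fderiv_lapse_smul {f : ℝ × E → E} (hf : DifferentiableAt ℝ f p) (X : ℝ × E) :
    fderiv ℝ (fun y => β y • f y) p X = β p • fderiv ℝ f p X + fderiv ℝ β p X • f p := by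
  have e := congrArg (fun L : ℝ × E →L[ℝ] E => L X)
    ((h.contDiffAt_lapse hp).diff.hasFDerivAt.smul hf.hasFDerivAt).fderiv
  refine Eq.trans e ?_
  simp

omit h hp in
theorem localRiemann_eq (X Y Z : ℝ × E) : localRiemann B (fun u v w => G u v w) p X Y Z
    = fderiv ℝ (fun y => connection B LinearMap.id G y Y Z) p X
      - fderiv ℝ (fun y => connection B LinearMap.id G y X Z) p Y
      + connection B LinearMap.id G p X (connection B LinearMap.id G p Y Z)
      - connection B LinearMap.id G p Y (connection B LinearMap.id G p X Z) := rfl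

/-- The Gauss equation. -/
theorem riemann_space_space_space (v w z : E) :
    (localRiemann B (fun u v w => G u v w) p (0, v) (0, w) (0, z)).2
      = fderiv ℝ (fun y => spatialConnection b Q y w z) p (0, v)
        - fderiv ℝ (fun y => spatialConnection b Q y v z) p (0, w)
        + spatialConnection b Q p v (spatialConnection b Q p w z)
        - spatialConnection b Q p w (spatialConnection b Q p v z)
        + (extrinsic β Q p w z • shape b β Q p v - extrinsic β Q p v z • shape b β Q p w) := by
  have hβ := h.lapse_ne p hp
  rw [localRiemann_eq,
    h.fderiv_connection hp B (fun y hy => h.connection_space_space b hy B w z),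
    h.fderiv_connection hp B (fun y hy => h.connection_space_space b hy B v z),
    h.connection_space_space b hp, h.connection_space_space b hp, h.connection_eq b hp,
    h.connection_eq b hp]
  have e : ∀ (r : ℝ) (x : E), β p • -(r / β p) • x = -(r • x) := fun r x => by
    rw [smul_smul, mul_neg, mul_div_cancel₀ _ hβ, neg_smul]
  simp only [Prod.snd_add, Prod.snd_sub, zero_mul, zero_smul, add_zero, zero_add, e]
  abel

/-- The Mainardi equation. It is the only source of `∂_t Θ` and of the Hessian of `β` in the
space-space part of the Ricci tensor. -/
theorem riemann_time_space_space (w z : E) :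
    (localRiemann B (fun u v w => G u v w) p (1, 0) (0, w) (0, z)).1
      = -(extrinsic β Q p w (shape b β Q p z))
        - 1 / β p * (fderiv ℝ (fun y => extrinsic β Q y w z) p (1, 0) + spatialHess b β Q p w z) := by
  have hβ := h.lapse_ne p hp
  rw [localRiemann_eq,
    h.fderiv_connection hp B (fun y hy => h.connection_space_space b hy B w z),
    h.fderiv_connection hp B (fun y hy => h.connection_time_space b hy B z),
    h.connection_space_space b hp, h.connection_time_space b hp, h.connection_eq b hp,
    h.connection_eq b hp]
  have e1 : ∀ x, extrinsic β Q p 0 x = 0 := fun x => by simp [extrinsic]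
  have e2 : extrinsic β Q p w (-(β p • shape b β Q p z))
      = -(β p * extrinsic β Q p w (shape b β Q p z)) := by
    rw [h.extrinsic_symm, ← h.apply_shape b hp, h.extrinsic_symm w, ← h.apply_shape b hp]
    have := (h.shape_linear b hp)
    rw [this.map_neg, this.map_smul]
    simp
  have e4 : spatialDiff β p 0 = 0 := (fderiv ℝ β p).map_zero
  simp only [Prod.fst_add, Prod.fst_sub, fderiv_fun_neg, neg_apply, e4]
  rw [h.fderiv_div_lapse hp (h.contDiffAt_extrinsic hp w z).diff,
    h.fderiv_div_lapse hp (h.contDiffAt_spatialDiff hp z).diff, e1, e2, spatialHess]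
  simp only [spatialDiff]
  field_simp
  ring

include b in
theorem riemann_time_space_time (w : E) :
    (localRiemann B (fun u v w => G u v w) p (1, 0) (0, w) (1, 0)).1 = 0 := by
  have hβ := h.lapse_ne p hp
  rw [localRiemann_eq,
    h.fderiv_connection hp B (fun y hy => h.connection_space_time b hy B w),
    h.fderiv_connection hp B (fun y hy => h.connection_time_time b hy B),
    h.connection_space_time b hp, h.connection_time_time b hp, h.connection_eq b hp,
    h.connection_eq b hp]
  have e1 : ∀ x, extrinsic β Q p 0 x = 0 := fun x => by simp [extrinsic]
  have e2 : extrinsic β Q p w (β p • spatialGrad b β Q p)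
      = β p * spatialDiff β p (shape b β Q p w) := by
    rw [← h.apply_shape b hp, h.spatial.symm, ← h.apply_spatialGrad b hp, map_smul]
    rfl
  have e3 : spatialDiff β p (-(β p • shape b β Q p w))
      = -(β p * spatialDiff β p (shape b β Q p w)) := by
    simp only [← h.apply_spatialGrad b hp, map_neg, map_smul, smul_eq_mul]
  have e4 : spatialDiff β p 0 = 0 := (fderiv ℝ β p).map_zero
  have e5 : spatialDiff β p (β p • spatialGrad b β Q p)
      = β p * spatialDiff β p (spatialGrad b β Q p) := by
    simp only [← h.apply_spatialGrad b hp, map_smul, smul_eq_mul]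
  simp only [Prod.fst_add, Prod.fst_sub]
  rw [h.fderiv_div_lapse hp (h.contDiffAt_spatialDiff hp w).diff,
    h.fderiv_div_lapse hp ((h.contDiffAt_lapse hp).fderiv_apply _).diff, e1, e2, e3, e4]
  -- The component vanishes because the mixed second derivatives of the lapse commute; all other
  -- terms cancel algebraically.
  have e6 : fderiv ℝ (fun y => spatialDiff β y w) p (1, 0)
    = fderiv ℝ (fun y => fderiv ℝ β y (1, 0)) p (0, w) :=
    fderiv_fderiv_comm (h.contDiffAt_lapse hp) _ _
  rw [e6, show fderiv ℝ β p (0, w) = spatialDiff β p w from rfl]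
  field_simp
  ring

/-- The Codazzi equation: the derivatives of `β` cancel, and what remains is `β` times the
antisymmetrized covariant derivative of the shape operator, where the symmetric terms `Γ(v, w)` drop
out. -/
theorem riemann_space_space_time (v w : E) :
    (localRiemann B (fun u v w => G u v w) p (0, v) (0, w) (1, 0)).2
      = β p • ((fderiv ℝ (fun y => shape b β Q y v) p (0, w)
            + spatialConnection b Q p w (shape b β Q p v))
          - (fderiv ℝ (fun y => shape b β Q y w) p (0, v)
            + spatialConnection b Q p v (shape b β Q p w))) := by
  have hβ := h.lapse_ne p hp
  rw [localRiemann_eq,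
    h.fderiv_connection hp B (fun y hy => h.connection_space_time b hy B w),
    h.fderiv_connection hp B (fun y hy => h.connection_space_time b hy B v),
    h.connection_space_time b hp, h.connection_space_time b hp, h.connection_eq b hp,
    h.connection_eq b hp]
  have e : ∀ v w, spatialConnection b Q p v (-(β p • shape b β Q p w))
      = -(β p • spatialConnection b Q p v (shape b β Q p w)) := fun v w => by
    have := h.spatial.connection_linear b (LinearMap.inr ℝ ℝ E) hp v
    exact (this.map_neg _).trans (congrArg _ (this.map_smul _ _))
  simp only [Prod.snd_add, Prod.snd_sub, zero_mul, zero_smul, add_zero, zero_add, e,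
    fderiv_fun_neg, neg_apply, h.fderiv_lapse_smul hp (h.contDiffAt_shape b hp _).diff]
  -- The derivatives of `β` are brought to the quotient form in which they occur in the Christoffel
  -- symbols, so that `module` has no denominator to cancel.
  have e' : ∀ v, fderiv ℝ β p (0, v) = β p * (spatialDiff β p v / β p) := fun v => by
    rw [spatialDiff]
    field_simp
  simp only [e']
  module

theorem riemann_space_time_time (v : E) :
    (localRiemann B (fun u v w => G u v w) p (0, v) (1, 0) (1, 0)).2
      = β p • (fderiv ℝ (fun y => spatialGrad b β Q y) p (0, v)
            + spatialConnection b Q p v (spatialGrad b β Q p)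
          + fderiv ℝ (fun y => shape b β Q y v) p (1, 0)
          - β p • shape b β Q p (shape b β Q p v)) := by
  have hβ := h.lapse_ne p hp
  rw [localRiemann_eq,
    h.fderiv_connection hp B (fun y hy => h.connection_time_time b hy B),
    h.fderiv_connection hp B (fun y hy => h.connection_space_time b hy B v),
    h.connection_time_time b hp, h.connection_space_time b hp, h.connection_eq b hp,
    h.connection_eq b hp]
  have e : spatialConnection b Q p v (β p • spatialGrad b β Q p)
      = β p • spatialConnection b Q p v (spatialGrad b β Q p) :=
    (h.spatial.connection_linear b (LinearMap.inr ℝ ℝ E) hp v).map_smul _ _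
  have e0 : ∀ x, spatialConnection b Q p 0 x = 0 := fun x => by
    rw [h.spatialConnection_symm b hp]
    exact (h.spatial.connection_linear b _ hp x).map_zero
  have l := h.shape_linear b hp
  have e1 : shape b β Q p (-(β p • shape b β Q p v))
      = -(β p • shape b β Q p (shape b β Q p v)) :=
    (l.map_neg _).trans (congrArg _ (l.map_smul _ _))
  simp only [Prod.snd_add, Prod.snd_sub, zero_mul, zero_smul, add_zero, zero_add, e, e0, e1,
    fderiv_fun_neg, neg_apply, h.fderiv_lapse_smul hp (h.contDiffAt_shape b hp _).diff,
    h.fderiv_lapse_smul hp (h.contDiffAt_spatialGrad b hp).diff, l.map_zero, smul_zero]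
  have e' : fderiv ℝ β p (0, v) = β p * (spatialDiff β p v / β p) := by
    rw [spatialDiff]
    field_simp
  have e'' : fderiv ℝ β p (1, 0) = β p * (fderiv ℝ β p (1, 0) / β p) := by
    field_simp
  rw [e', e'']
  generalize fderiv ℝ β p (1, 0) / β p = r at *
  rw [show β p * r / β p = r by field_simp]
  module

end SplitMetricOn

end SplitRicci

/-! ### Ricci components of the split metric -/

section SplitRicciComponents

variable {ι κ E : Type*} [Fintype ι] [DecidableEq ι] [Fintype κ] [DecidableEq κ]
  [NormedAddCommGroup E] [NormedSpace ℝ E]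

namespace SplitMetricOn

variable {Ω : Set (ℝ × E)} {β : ℝ × E → ℝ} {Q : ℝ × E → E →ₗ[ℝ] E →ₗ[ℝ] ℝ}
  {G : ℝ × E → (ℝ × E) →ₗ[ℝ] (ℝ × E) →ₗ[ℝ] ℝ} (h : SplitMetricOn Ω β Q G) (b : Basis ι ℝ E)
  {p : ℝ × E} (hp : p ∈ Ω) (B : Basis κ ℝ (ℝ × E))
include h hp

theorem extrinsic_shape (v w : E) :
    extrinsic β Q p (shape b β Q p v) w = extrinsic β Q p v (shape b β Q p w) := by
  rw [h.extrinsic_symm, ← h.apply_shape b hp, ← h.apply_shape b hp, h.spatial.symm]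

theorem trMetric_extrinsic :
    trMetric b (fun v w => Q p v w) (extrinsic β Q p) = basisTrace b (shape b β Q p) :=
  (h.spatial.isMetric hp).trMetric_eq b (h.apply_shape b hp)

theorem trMetric_extrinsic_shape :
    trMetric b (fun v w => Q p v w) (fun v w => extrinsic β Q p v (shape b β Q p w))
      = basisTrace b (fun v => shape b β Q p (shape b β Q p v)) :=
  (h.spatial.isMetric hp).trMetric_eq b fun v w => by
    rw [h.apply_shape b hp, h.extrinsic_shape b hp]

theorem trMetric_spatialHess :
    trMetric b (fun v w => Q p v w) (spatialHess b β Q p)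
      = basisTrace b (fun v => fderiv ℝ (fun y => spatialGrad b β Q y) p (0, v)
        + spatialConnection b Q p v (spatialGrad b β Q p)) :=
  (h.spatial.isMetric hp).trMetric_eq b fun v w => by
    have e := h.spatial.connection_compatible b (LinearMap.inr ℝ ℝ E) hp v
      (spatialGrad b β Q p) w
    rw [LinearMap.inr_apply] at e
    rw [map_add, LinearMap.add_apply,
      h.spatial.apply_fderiv hp b (h.contDiffAt_spatialGrad b hp).diff
        (fun y hy => h.apply_spatialGrad b hy), e, spatialHess, ← h.apply_spatialGrad b hp]
    simp only [spatialConnection]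
    ring

/-- Lowering an index does not commute with `∂_t`: from `Θ = q(S ·, ·)` and `∂_t q = -2βΘ` one gets
`∂_t Θ = q((∂_t S - 2βS²) ·, ·)`. -/
theorem trMetric_fderiv_extrinsic :
    trMetric b (fun v w => Q p v w)
        (fun v w => fderiv ℝ (fun y => extrinsic β Q y v w) p (1, 0))
      = basisTrace b (fun v => fderiv ℝ (fun y => shape b β Q y v) p (1, 0)
        - (2 * β p) • shape b β Q p (shape b β Q p v)) :=
  (h.spatial.isMetric hp).trMetric_eq b fun v w => by
    rw [map_sub, LinearMap.sub_apply,
      h.spatial.apply_fderiv hp b (h.contDiffAt_shape b hp v).diff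
        (θ := fun y => extrinsic β Q y v) (fun y hy => h.apply_shape b hy v),
      h.fderiv_time hp, map_smul, LinearMap.smul_apply, h.apply_shape b hp, smul_eq_mul]
    ring

/-- In contrast to `∂_t`, the connection along the slices is metric, so `∇Θ` is dual to `∇S` without
correction term. -/
theorem trMetric_spatialCovExtrinsic (w : E) :
    trMetric b (fun v w => Q p v w) (fun v x => spatialCovExtrinsic b β Q p v x w)
      = basisTrace b (fun v => fderiv ℝ (fun y => shape b β Q y w) p (0, v)
        + spatialConnection b Q p v (shape b β Q p w)
        - shape b β Q p (spatialConnection b Q p v w)) :=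
  (h.spatial.isMetric hp).trMetric_eq b fun v x => by
    have e := h.spatial.connection_compatible b (LinearMap.inr ℝ ℝ E) hp v (shape b β Q p w) x
    rw [LinearMap.inr_apply] at e
    rw [map_sub, map_add, LinearMap.sub_apply, LinearMap.add_apply,
      h.spatial.apply_fderiv hp b (h.contDiffAt_shape b hp w).diff
        (θ := fun y => extrinsic β Q y w) (fun y hy => h.apply_shape b hy w), e,
      h.apply_shape b hp, h.apply_shape b hp, spatialCovExtrinsic, h.extrinsic_symm _ w,
      h.extrinsic_symm x]
    simp only [spatialConnection, fun y => h.extrinsic_symm (p := y) x w]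
    ring

variable (hB : ∀ f : ℝ × E → ℝ × E,
  basisTrace B f = (f (1, 0)).1 + basisTrace b (fun v => (f (0, v)).2))
include hB

/-- The time direction contributes the Mainardi term to the trace, the slice contributes the trace
of the Gauss equation. Each gives one copy of `-Θ(w, Sz)`, which explains the factor `2`. -/
theorem ricci_space_space (w z : E) :
    localRicci B (fun u v w => G u v w) p (0, w) (0, z)
      = spatialRicci b Q p w z
        + trMetric b (fun v w => Q p v w) (extrinsic β Q p) * extrinsic β Q p w z
        - 2 * extrinsic β Q p w (shape b β Q p z)
        - 1 / β p * (fderiv ℝ (fun y => extrinsic β Q y w z) p (1, 0)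
          + spatialHess b β Q p w z) := by
  let θ : E →ₗ[ℝ] ℝ := ((Q p).comp (h.shape_linear b hp).mk').flip z
  have hθ : ∀ v, extrinsic β Q p v z = θ v := fun v => (h.apply_shape b hp v z).symm
  have e := hB (fun X => localRiemann B (fun u v w => G u v w) p X (0, w) (0, z))
  simp only [h.riemann_time_space_space b hp, h.riemann_space_space_space b hp] at e
  have t : basisTrace b (fun v => extrinsic β Q p w z • shape b β Q p v
      - extrinsic β Q p v z • shape b β Q p w)
      = extrinsic β Q p w z * basisTrace b (shape b β Q p)
        - extrinsic β Q p w (shape b β Q p z) := by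
    rw [basisTrace_sub, basisTrace_smul, ← h.extrinsic_shape b hp]
    simp only [hθ]
    rw [basisTrace_smulRight]
  refine Eq.trans e ?_
  rw [basisTrace_add, t, h.trMetric_extrinsic b hp, spatialRicci]
  ring

/-- The trace of the Codazzi equation. The terms `tr(S Γ(·, w))` and `tr(Γ(w, S ·))` coincide by
cyclicity and absence of torsion, which turns the coordinate derivative of `S` into the covariant
one. -/
theorem ricci_space_time (w : E) :
    localRicci B (fun u v w => G u v w) p (0, w) (1, 0)
      = β p * (fderiv ℝ (fun y => trMetric b (fun v w => Q y v w) (extrinsic β Q y)) p (0, w)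
        - trMetric b (fun v w => Q p v w) (fun v x => spatialCovExtrinsic b β Q p v x w)) := by
  have e := hB (fun X => localRiemann B (fun u v w => G u v w) p X (0, w) (1, 0))
  simp only [h.riemann_time_space_time b hp, h.riemann_space_space_time b hp, zero_add] at e
  have e1 : (fun y => trMetric b (fun v w => Q y v w) (extrinsic β Q y))
      =ᶠ[𝓝 p] fun y => basisTrace b (shape b β Q y) :=
    Filter.eventually_of_mem (h.spatial.mem_nhds hp) fun y hy => h.trMetric_extrinsic b hy
  have e2 : basisTrace b (fun v => shape b β Q p (spatialConnection b Q p v w))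
      = basisTrace b (fun v => spatialConnection b Q p w (shape b β Q p v)) := by
    simp only [fun v => h.spatialConnection_symm b hp v w]
    exact basisTrace_comm b (h.shape_linear b hp) (h.spatial.connection_linear b _ hp w)
  refine Eq.trans e ?_
  rw [e1.fderiv_eq, (hasFDerivAt_basisTrace b (f := shape b β Q)
      fun v => (h.contDiffAt_shape b hp v).diff).2, h.trMetric_spatialCovExtrinsic b hp,
    basisTrace_smul, basisTrace_sub, basisTrace_sub, basisTrace_add _ _
      (fun v => spatialConnection b Q p w (shape b β Q p v)), e2]
  ring

/-- The Hamiltonian equation. -/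
theorem ricci_time_time :
    localRicci B (fun u v w => G u v w) p (1, 0) (1, 0)
      + β p ^ 2 * trMetric b (fun v w => Q p v w)
          (fun v w => localRicci B (fun u v w => G u v w) p (0, v) (0, w))
      = β p ^ 2 * (trMetric b (fun v w => Q p v w) (spatialRicci b Q p)
        - basisTrace b (fun v => shape b β Q p (shape b β Q p v))
        + trMetric b (fun v w => Q p v w) (extrinsic β Q p) ^ 2) := by
  have hβ := h.lapse_ne p hp
  have e := hB (fun X => localRiemann B (fun u v w => G u v w) p X (1, 0) (1, 0))
  have e0 : localRiemann B (fun u v w => G u v w) p (1, 0) (1, 0) (1, 0) = 0 := by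
    simp [localRiemann]
  simp only [h.riemann_space_time_time b hp, e0, Prod.fst_zero, zero_add] at e
  have e' : localRicci B (fun u v w => G u v w) p (1, 0) (1, 0) = _ := e
  rw [e']
  simp only [h.ricci_space_space b hp B hB]
  rw [trMetric_sub, trMetric_sub, trMetric_add, trMetric_smul, trMetric_smul, trMetric_smul,
    trMetric_add, h.trMetric_extrinsic_shape b hp, basisTrace_smul, basisTrace_sub,
    basisTrace_add, ← h.trMetric_spatialHess b hp, basisTrace_smul]
  -- The Hessian traces and the traces of `∂_t S` cancel. The coefficients of `tr S²` are `-1` from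
  -- the time-time part, `-2` from the space-space part and `+2` from the correction in this
  -- identity.
  have e2 := h.trMetric_fderiv_extrinsic b hp
  rw [basisTrace_sub, basisTrace_smul] at e2
  rw [e2]
  field_simp
  ring

end SplitMetricOn

end SplitRicciComponents

/-- Pulling back by `A` conjugates the dual endomorphism by `A`, and the trace is invariant under
conjugation. -/
theorem IsMetric.trMetric_comp {ι V V' : Type*} [Fintype ι] [DecidableEq ι] [AddCommGroup V]
    [Module ℝ V] [AddCommGroup V'] [Module ℝ V'] {q : V →ₗ[ℝ] V →ₗ[ℝ] ℝ} (hq : IsMetric q)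
    (c : Basis ι ℝ V) (b : Basis ι ℝ V') (A : V' ≃ₗ[ℝ] V) (T : V →ₗ[ℝ] V →ₗ[ℝ] ℝ) :
    trMetric c (fun v w => q v w) (fun v w => T v w)
      = trMetric b (fun v w => q (A v) (A w)) (fun v w => T (A v) (A w)) := by
  let q' : V' →ₗ[ℝ] V' →ₗ[ℝ] ℝ := q.compl₁₂ A.toLinearMap A.toLinearMap
  have hq' : IsMetric q' := ⟨fun v w => hq.symm _ _, fun v hv => by
    have : A v = 0 := hq.nondeg _ fun w => by simpa [q'] using hv (A.symm w)
    simpa using this⟩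
  let S : V → V := fun v => sharp c (fun v w => q v w) (T v)
  have hS : ∀ v w, q (S v) w = T v w := fun v w => hq.apply_sharp c (T v) w
  have lS : IsLinearMap ℝ S :=
    ⟨fun v w => hq.ext_left fun z => by simp [hS], fun r v => hq.ext_left fun z => by simp [hS]⟩
  have e1 := hq.trMetric_eq c (T := fun v w => T v w) hS
  have e2 := hq'.trMetric_eq b (T := fun v w => T (A v) (A w))
    (S := (A.symm.conj (lS.mk' S))) (fun v w => by simp [q', LinearEquiv.conj_apply, hS])
  refine e1.trans (Eq.trans ?_ e2.symm)
  rw [basisTrace_eq, LinearMap.trace_conj', ← basisTrace_eq c]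
  rfl

/-! ### Passing between a manifold and its charts -/

section Charts

variable {ι E H M : Type*} [NormedAddCommGroup E] [NormedSpace ℝ E]
  [TopologicalSpace H] (I : ModelWithCorners ℝ E H) [I.Boundaryless] [TopologicalSpace M]
  [ChartedSpace H M] [IsManifold I 1 M]

omit [I.Boundaryless] [IsManifold I 1 M] in
theorem coordTangent_linear (x : M) (u : E) : IsLinearMap ℝ (coordTangent I x u) :=
  (mfderiv 𝓘(ℝ, E) I (extChartAt I x).symm u).toLinearMap.isLinear

/-- The differential of the inverse of the chart as a linear map. -/
def coordTangentL (x : M) (u : E) : E →ₗ[ℝ] TangentSpace I ((extChartAt I x).symm u) :=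
  (mfderiv 𝓘(ℝ, E) I (extChartAt I x).symm u).toLinearMap

theorem coordTangent_self (x : M) (v : E) :
    (coordTangent I x (extChartAt I x x) v : E) = v := by
  have h := mfderivWithin_range_extChartAt_symm (I := I) (x := x)
  rw [I.range_eq_univ, mfderivWithin_univ] at h
  exact congrArg (fun L : E →L[ℝ] E => L v) h

theorem chart_coordTangent (x : M) {u : E} (hu : u ∈ (extChartAt I x).target) (v : E) :
    (mfderiv I 𝓘(ℝ, E) (extChartAt I x) ((extChartAt I x).symm u) (coordTangent I x u v) : E)
      = v := by
  have h := mfderiv_extChartAt_comp_mfderivWithin_extChartAt_symm hu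
  rw [I.range_eq_univ, mfderivWithin_univ] at h
  exact congrArg (fun L : E →L[ℝ] E => L v) h

theorem coordTangent_chart (x : M) {u : E} (hu : u ∈ (extChartAt I x).target)
    (v : TangentSpace I ((extChartAt I x).symm u)) :
    coordTangent I x u
      (mfderiv I 𝓘(ℝ, E) (extChartAt I x) ((extChartAt I x).symm u) v : E) = v := by
  have h := mfderivWithin_extChartAt_symm_comp_mfderiv_extChartAt hu
  rw [I.range_eq_univ, mfderivWithin_univ] at h
  exact congrArg (fun L : E →L[ℝ] E => L v) h

/-- The differential of the inverse of the chart as a linear equivalence. -/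
def coordTangentEquiv (x : M) {u : E} (hu : u ∈ (extChartAt I x).target) :
    E ≃ₗ[ℝ] TangentSpace I ((extChartAt I x).symm u) :=
  { coordTangentL I x u with
    invFun := mfderiv I 𝓘(ℝ, E) (extChartAt I x) ((extChartAt I x).symm u)
    left_inv := chart_coordTangent I x hu
    right_inv := coordTangent_chart I x hu }

/-- At its own base point the preferred chart has identity differential. The value on the left lives
over the point obtained by applying the chart and then its inverse, which equals `x` only
propositionally; the auxiliary `e` transports along this equality. -/
theorem coordForm_self (θ : ∀ y : M, TangentSpace I y → ℝ) (x : M) (v : E) :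
    coordForm I θ x (extChartAt I x x) v = θ x v := by
  have e : ∀ y (_ : y = x) (v : E), θ y v = θ x v := fun y hy v => by subst hy; rfl
  exact (congrArg (θ _) (coordTangent_self I x v)).trans (e _ (extChartAt_to_inv x) v)

theorem coordBilin_self (T : ∀ y : M, TangentSpace I y → TangentSpace I y → ℝ) (x : M) (v w : E) :
    coordBilin I T x (extChartAt I x x) v w = T x v w := by
  have e : ∀ y (_ : y = x) (v w : E), T y v w = T x v w := fun y hy v w => by subst hy; rfl
  exact (congrArg₂ (T _) (coordTangent_self I x v) (coordTangent_self I x w)).trans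
    (e _ (extChartAt_to_inv x) v w)

omit [IsManifold I 1 M] in
-- `mfderiv` is zero by default unless `f` is differentiable on the manifold, which includes
-- continuity of `f`. Continuity is recovered from the coordinate expression by composing with the
-- chart near `x`.
theorem dFun_eq {f : M → ℝ} {x : M}
    (hf : DifferentiableAt ℝ (f ∘ (extChartAt I x).symm) (extChartAt I x x)) (v : E) :
    dFun I f x v = fderiv ℝ (f ∘ (extChartAt I x).symm) (extChartAt I x x) v := by
  have hc : ContinuousAt f x := by
    have h1 : ContinuousAt ((f ∘ (extChartAt I x).symm) ∘ extChartAt I x) x :=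
      hf.continuousAt.comp (continuousAt_extChartAt x)
    refine h1.congr ?_
    filter_upwards [extChartAt_source_mem_nhds (I := I) x] with y hy
    exact congrArg f ((extChartAt I x).left_inv hy)
  have hm : MDifferentiableAt I 𝓘(ℝ, ℝ) f x := by
    rw [mdifferentiableAt_iff]
    exact ⟨hc, hf.differentiableWithinAt⟩
  have e : (mfderiv I 𝓘(ℝ, ℝ) f x : E →L[ℝ] ℝ)
      = fderivWithin ℝ (f ∘ (extChartAt I x).symm) (Set.range I) (extChartAt I x x) := hm.mfderiv
  rw [I.range_eq_univ, fderivWithin_univ] at e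
  exact congrArg (fun L : E →L[ℝ] ℝ => L v) e

theorem coordForm_dFun {f : M → ℝ} (hf : MDifferentiable I 𝓘(ℝ, ℝ) f) (x : M) {u : E}
    (hu : u ∈ (extChartAt I x).target) (v : E) :
    coordForm I (dFun I f) x u v = fderiv ℝ (f ∘ (extChartAt I x).symm) u v := by
  have hs := mdifferentiableWithinAt_extChartAt_symm (I := I) hu
  rw [I.range_eq_univ, mdifferentiableWithinAt_univ] at hs
  have h := mfderiv_comp u (hf _) hs
  rw [mfderiv_eq_fderiv] at h
  exact (congrArg (fun L : E →L[ℝ] ℝ => L v) h).symm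

/-- The trace of a bilinear form can be computed in any chart. -/
theorem trMetric_coordBilin [Fintype ι] [DecidableEq ι] (b : Basis ι ℝ E) (x : M) {u : E}
    (hu : u ∈ (extChartAt I x).target)
    {q T : TangentSpace I ((extChartAt I x).symm u) →ₗ[ℝ]
      TangentSpace I ((extChartAt I x).symm u) →ₗ[ℝ] ℝ} (hq : IsMetric q) :
    trMetric (coordBasis I b ((extChartAt I x).symm u)) (fun v w => q v w) (fun v w => T v w)
      = trMetric b (fun v w => q (coordTangent I x u v) (coordTangent I x u w))
          (fun v w => T (coordTangent I x u v) (coordTangent I x u w)) :=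
  hq.trMetric_comp (coordBasis I b ((extChartAt I x).symm u)) b (coordTangentEquiv I x hu) T

end Charts

/-! ### Charts of `ℝ × X` -/

section ProductChart

variable {X : Type*} [TopologicalSpace X] [ChartedSpace Plane X]

/-- The domain of the coordinates of `ℝ × X` over the chart at `x`. -/
def cylinder (x : X) : Set (ℝ × Plane) := Set.univ ×ˢ (extChartAt 𝓘(ℝ, Plane) x).target

theorem mem_cylinder {x : X} {p : ℝ × Plane} :
    p ∈ cylinder x ↔ p.2 ∈ (extChartAt 𝓘(ℝ, Plane) x).target := by
  simp [cylinder]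

theorem base_mem_cylinder (t : ℝ) (x : X) : (t, extChartAt 𝓘(ℝ, Plane) x x) ∈ cylinder x :=
  mem_cylinder.mpr (mem_extChartAt_target x)

theorem isOpen_cylinder (x : X) : IsOpen (cylinder x) :=
  isOpen_univ.prod (isOpen_extChartAt_target x)

/-- The chart of `ℝ` is the identity, so the charts at all points `(t, x)` over a given `x` share
one target. -/
theorem target_modelRX (t : ℝ) (x : X) : (extChartAt modelRX (t, x)).target = cylinder x := by
  rw [extChartAt_prod]
  simp [cylinder, chartAt_self_eq]

variable [IsManifold 𝓘(ℝ, Plane) ∞ X]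

theorem coordTangent_prod (t : ℝ) {x : X} {p : ℝ × Plane} (hp : p ∈ cylinder x) (a : ℝ)
    (v : Plane) : (coordTangent modelRX (t, x) p (a, v) : ℝ × Plane)
      = (a, coordTangent 𝓘(ℝ, Plane) x p.2 v) := by
  have hs := mdifferentiableWithinAt_extChartAt_symm (I := 𝓘(ℝ, Plane)) (mem_cylinder.mp hp)
  rw [ModelWithCorners.range_eq_univ, mdifferentiableWithinAt_univ] at hs
  have h1 : HasMFDerivAt 𝓘(ℝ, ℝ × Plane) 𝓘(ℝ, ℝ) (Prod.fst : ℝ × Plane → ℝ) p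
    (ContinuousLinearMap.fst ℝ ℝ Plane) := hasFDerivAt_fst.hasMFDerivAt
  have h2 : HasMFDerivAt 𝓘(ℝ, ℝ × Plane) 𝓘(ℝ, Plane) (Prod.snd : ℝ × Plane → Plane) p
    (ContinuousLinearMap.snd ℝ ℝ Plane) := hasFDerivAt_snd.hasMFDerivAt
  have h3 := h1.prodMk (hs.hasMFDerivAt.comp p h2)
  exact congrArg (fun L : ℝ × Plane →L[ℝ] ℝ × Plane => L (a, v)) h3.mfderiv

end ProductChart

/-! ### The tuple in coordinates -/

namespace SplitTuple

variable {X : Type*} [TopologicalSpace X] [ChartedSpace Plane X] (D : SplitTuple X) (x : X)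

/-- The function `β` in the chart at `x`. -/
def coordLapse (p : ℝ × Plane) : ℝ := D.β p.1 ((extChartAt 𝓘(ℝ, Plane) x).symm p.2)

/-- The function `F` in the chart at `x`. -/
def coordF (p : ℝ × Plane) : ℝ := D.F p.1 ((extChartAt 𝓘(ℝ, Plane) x).symm p.2)

/-- The one-form `α^⊥` in the chart at `x`. -/
def coordPerp (p : ℝ × Plane) : Plane →ₗ[ℝ] ℝ :=
  D.α p.1 ((extChartAt 𝓘(ℝ, Plane) x).symm p.2) ∘ₗ coordTangentL 𝓘(ℝ, Plane) x p.2

/-- The metrics `q` in the chart at `x`. -/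
def coordq (p : ℝ × Plane) : Plane →ₗ[ℝ] Plane →ₗ[ℝ] ℝ :=
  (D.q p.1 ((extChartAt 𝓘(ℝ, Plane) x).symm p.2)).compl₁₂ (coordTangentL 𝓘(ℝ, Plane) x p.2)
    (coordTangentL 𝓘(ℝ, Plane) x p.2)

/-- The metric of `ℝ × X` in the chart at `(t, x)`. -/
def coordMetric (t : ℝ) (p : ℝ × Plane) : (ℝ × Plane) →ₗ[ℝ] (ℝ × Plane) →ₗ[ℝ] ℝ :=
  (D.metric ((extChartAt modelRX (t, x)).symm p)).compl₁₂ (coordTangentL modelRX (t, x) p)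
    (coordTangentL modelRX (t, x) p)

theorem metric_apply (p : ℝ × X) (a c : ℝ) (v w : Plane) :
    D.metric p ((a, v) : ℝ × Plane) ((c, w) : ℝ × Plane)
      = -(D.β p.1 p.2) ^ 2 * (a * c) + D.q p.1 p.2 v w := rfl

variable [IsManifold 𝓘(ℝ, Plane) ∞ X]

theorem contDiffOn_coord {f : ℝ × X → ℝ} (hf : ContMDiff modelRX 𝓘(ℝ, ℝ) ∞ f) :
    ContDiffOn ℝ ∞ (fun p : ℝ × Plane => f (p.1, (extChartAt 𝓘(ℝ, Plane) x).symm p.2))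
      (cylinder x) := by
  have h := hf.comp_contMDiffOn (contMDiffOn_extChartAt_symm (I := modelRX) (n := ∞) ((0 : ℝ), x))
  rw [target_modelRX] at h
  exact contMDiffOn_iff_contDiffOn.mp h

theorem contDiffOn_coordLapse : ContDiffOn ℝ ∞ (D.coordLapse x) (cylinder x) :=
  contDiffOn_coord x D.β_smooth

theorem contDiffOn_coordF : ContDiffOn ℝ ∞ (D.coordF x) (cylinder x) :=
  contDiffOn_coord x D.F_smooth

theorem coordForm_form (t : ℝ) {p : ℝ × Plane} (hp : p ∈ cylinder x) (a : ℝ) (v : Plane) :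
    coordForm modelRX (fun p a => D.form p a) (t, x) p (a, v)
      = D.coordF x p * D.coordLapse x p * a + D.coordPerp x p v := by
  exact congrArg (D.form (p.1, (extChartAt 𝓘(ℝ, Plane) x).symm p.2)) (coordTangent_prod t hp a v)

theorem coordForm_perpForm (t : ℝ) {p : ℝ × Plane} (hp : p ∈ cylinder x) (a : ℝ) (v : Plane) :
    coordForm modelRX (fun p a => D.perpForm p a) (t, x) p (a, v) = D.coordPerp x p v := by
  exact congrArg (D.perpForm (p.1, (extChartAt 𝓘(ℝ, Plane) x).symm p.2))
    (coordTangent_prod t hp a v)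

theorem coordMetric_eq (t : ℝ) {p : ℝ × Plane} (hp : p ∈ cylinder x) (a c : ℝ) (v w : Plane) :
    D.coordMetric x t p (a, v) (c, w)
      = -(D.coordLapse x p) ^ 2 * (a * c) + D.coordq x p v w :=
  congrArg₂ (fun v w => D.metric (p.1, (extChartAt 𝓘(ℝ, Plane) x).symm p.2) v w)
    (coordTangent_prod t hp a v) (coordTangent_prod t hp c w)

omit [IsManifold 𝓘(ℝ, Plane) ∞ X] in
theorem metric_symm (p : ℝ × X) (v w : TangentSpace modelRX p) :
    D.metric p v w = D.metric p w v := by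
  obtain ⟨a, v⟩ : ℝ × Plane := v
  obtain ⟨c, w⟩ : ℝ × Plane := w
  exact (D.metric_apply p a c v w).trans
    (Eq.trans (congrArg₂ (fun r s => -(D.β p.1 p.2) ^ 2 * r + s) (mul_comm a c)
      (D.q_symm p.1 p.2 v w)) (D.metric_apply p c a w v).symm)

theorem smoothMetricOn_coordq : SmoothMetricOn (cylinder x) (D.coordq x) where
  isOpen := isOpen_cylinder x
  smooth v w := D.q_smooth x v w
  symm p v w := D.q_symm _ _ _ _
  nondeg p hp v hv := by
    -- Nondegeneracy comes from positivity of `q`, since the differential of the chart is injective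
    -- on the target.
    by_contra h0
    refine (D.q_pos p.1 _ (coordTangent 𝓘(ℝ, Plane) x p.2 v) fun h => h0 ?_).ne' (hv v)
    have e := chart_coordTangent 𝓘(ℝ, Plane) x (mem_cylinder.mp hp) v
    rw [← e]
    exact (congrArg _ h).trans (map_zero _)

/-- The bridge from the manifold to the coordinate computation: the chart of `ℝ × X` is a product,
so the metric keeps its split form in it. -/
theorem splitMetricOn (t : ℝ) : SplitMetricOn (cylinder x) (D.coordLapse x) (D.coordq x)
    (D.coordMetric x t) where
  metric :=
    { isOpen := isOpen_cylinder x
      smooth := fun v w => by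
        obtain ⟨a, v⟩ := v
        obtain ⟨c, w⟩ := w
        refine ContDiffOn.congr ?_ fun p hp => D.coordMetric_eq x t hp a c v w
        exact ((D.contDiffOn_coordLapse x).pow 2).neg.mul contDiffOn_const |>.add
          (D.q_smooth x v w)
      symm := fun p v w => D.metric_symm _ _ _
      nondeg := fun p hp v hv => by
        obtain ⟨a, v⟩ := v
        have hβ : D.coordLapse x p ≠ 0 := D.β_ne_zero _ _
        have h1 := hv (1, 0)
        rw [D.coordMetric_eq x t hp] at h1
        have ha : a = 0 := by simpa [hβ] using h1
        have hv' : v = 0 := (D.smoothMetricOn_coordq x).nondeg p hp v fun w => by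
          have h2 := hv (0, w)
          rw [D.coordMetric_eq x t hp] at h2
          simpa using h2
        rw [ha, hv']
        rfl }
  spatial := D.smoothMetricOn_coordq x
  lapse := D.contDiffOn_coordLapse x
  lapse_ne p _ := D.β_ne_zero _ _
  apply p hp a c v w := D.coordMetric_eq x t hp a c v w

theorem coordVec_normal (t : ℝ) {p : ℝ × Plane} (hp : p ∈ cylinder x) :
    coordVec modelRX D.normal (t, x) p = ((D.coordLapse x p)⁻¹, 0) := by
  have h0 : coordTangent 𝓘(ℝ, Plane) x p.2 0 = 0 := (coordTangent_linear _ x p.2).map_zero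
  have e1 : (coordTangent modelRX (t, x) p ((D.coordLapse x p)⁻¹, 0) : ℝ × Plane)
      = D.normal ((extChartAt modelRX (t, x)).symm p) := by
    rw [coordTangent_prod t hp]
    refine Prod.ext ?_ ?_
    · exact (mul_one _).symm
    · exact h0.trans (smul_zero _).symm
  have e2 := chart_coordTangent modelRX (t, x) (u := p) (by rwa [target_modelRX])
    ((D.coordLapse x p)⁻¹, 0)
  rw [← e2]
  exact congrArg (mfderiv modelRX 𝓘(ℝ, ℝ × Plane) (extChartAt modelRX (t, x))
    ((extChartAt modelRX (t, x)).symm p)) e1.symm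

end SplitTuple

/-! ### Intrinsic quantities on the slices in coordinates -/

namespace SplitTuple

variable {X : Type*} [TopologicalSpace X] [ChartedSpace Plane X] [IsManifold 𝓘(ℝ, Plane) ∞ X]
  (D : SplitTuple X) (t : ℝ) (x : X)

/-- The coordinates of `(t, x)` in the chart at `(t, x)`. -/
def base : ℝ × Plane := (t, extChartAt 𝓘(ℝ, Plane) x x)

omit [IsManifold 𝓘(ℝ, Plane) ∞ X] in
theorem base_mem : base t x ∈ cylinder x := base_mem_cylinder t x

omit [IsManifold 𝓘(ℝ, Plane) ∞ X] in
theorem isMetric_q : IsMetric (D.q t x) :=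
  ⟨D.q_symm t x, fun v hv => by
    by_contra h
    exact (D.q_pos t x v h).ne' (hv v)⟩

omit [IsManifold 𝓘(ℝ, Plane) ∞ X] in
theorem β_eq : D.β t x = D.coordLapse x (base t x) :=
  congrArg (D.β t) (extChartAt_to_inv x).symm

theorem metricX_eq (v w : Plane) : D.metricX t x v w = D.coordq x (base t x) v w :=
  (coordBilin_self 𝓘(ℝ, Plane) (D.metricX t) x v w).symm

theorem formX_eq (v : Plane) : D.formX t x v = D.coordPerp x (base t x) v :=
  (coordForm_self 𝓘(ℝ, Plane) (D.formX t) x v).symm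

theorem metricX_funext : D.metricX t x = fun v w : Plane => D.coordq x (base t x) v w :=
  funext fun v => funext fun w => D.metricX_eq t x v w

theorem formX_funext : D.formX t x = fun v : Plane => D.coordPerp x (base t x) v :=
  funext fun v => D.formX_eq t x v

/-- The chart of `X` does not move with time, so the time derivative at a fixed point of `X` is a
partial derivative in the chart. -/
theorem coordBilin_secondFF {p : ℝ × Plane} (hp : p ∈ cylinder x) (v w : Plane) :
    coordBilin 𝓘(ℝ, Plane) (D.secondFF p.1) x p.2 v w
      = extrinsic (D.coordLapse x) (D.coordq x) p v w := by
  have h := deriv_slice (f := fun y => D.coordq x y v w) (t := p.1) (u := p.2)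
    ((D.smoothMetricOn_coordq x).contDiffAt hp v w).diff
  exact congrArg (fun r => -(1 / (2 * D.coordLapse x p)) * r) h

theorem secondFF_eq (v w : Plane) :
    D.secondFF t x v w = extrinsic (D.coordLapse x) (D.coordq x) (base t x) v w :=
  (coordBilin_self 𝓘(ℝ, Plane) (D.secondFF t) x v w).symm.trans
    (D.coordBilin_secondFF x (base_mem t x) v w)

theorem secondFFDot_eq (v w : Plane) : D.secondFFDot t x v w
    = fderiv ℝ (fun y => extrinsic (D.coordLapse x) (D.coordq x) y v w) (base t x) (1, 0) := by
  have h := deriv_slice (f := fun y => extrinsic (D.coordLapse x) (D.coordq x) y v w)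
    (t := t) (u := extChartAt 𝓘(ℝ, Plane) x x)
    ((D.splitMetricOn x t).contDiffAt_extrinsic (base_mem t x) v w).diff
  refine Eq.trans ?_ h
  exact congrArg (fun f : ℝ → ℝ => deriv f t) (funext fun s => D.secondFF_eq s x v w)

theorem differentiableAt_q (v w : Plane) : DifferentiableAt ℝ (fun s => D.q s x v w) t := by
  have h := ((D.smoothMetricOn_coordq x).contDiffAt (base_mem t x) v w).diff.comp t
    (hasFDerivAt_prodMk_left (𝕜 := ℝ) t (extChartAt 𝓘(ℝ, Plane) x x)).differentiableAt
  have e : (fun s => D.q s x v w) = fun s => D.coordq x (s, extChartAt 𝓘(ℝ, Plane) x x) v w :=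
    funext fun s => D.metricX_eq s x v w
  rw [e]
  exact h

/-- The second fundamental form as a bilinear map. -/
def secondFFL : TangentSpace 𝓘(ℝ, Plane) x →ₗ[ℝ] TangentSpace 𝓘(ℝ, Plane) x →ₗ[ℝ] ℝ :=
  LinearMap.mk₂ ℝ (D.secondFF t x)
    (fun v v' w => by
      have h := deriv_fun_add (D.differentiableAt_q t x v w) (D.differentiableAt_q t x v' w)
      simp only [secondFF, map_add, LinearMap.add_apply]
      exact (congrArg (fun r => -(1 / (2 * D.β t x)) * r) h).trans (mul_add _ _ _))
    (fun c v w => by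
      have h := deriv_const_mul c (D.differentiableAt_q t x v w)
      simp only [secondFF, map_smul, LinearMap.smul_apply, smul_eq_mul]
      exact (congrArg (fun r => -(1 / (2 * D.β t x)) * r) h).trans (mul_left_comm _ _ _))
    (fun v w w' => by
      have h := deriv_fun_add (D.differentiableAt_q t x v w) (D.differentiableAt_q t x v w')
      simp only [secondFF, map_add]
      exact (congrArg (fun r => -(1 / (2 * D.β t x)) * r) h).trans (mul_add _ _ _))
    (fun c v w => by
      have h := deriv_const_mul c (D.differentiableAt_q t x v w)
      simp only [secondFF, map_smul, smul_eq_mul]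
      exact (congrArg (fun r => -(1 / (2 * D.β t x)) * r) h).trans (mul_left_comm _ _ _))

omit [IsManifold 𝓘(ℝ, Plane) ∞ X] in
theorem secondFF_symm (v w : TangentSpace 𝓘(ℝ, Plane) x) :
    D.secondFF t x v w = D.secondFF t x w v := by
  simp only [secondFF, fun s => D.q_symm s x v w]

/-- At a point near `x` the mean curvature is defined with the frame of that point's preferred
chart. Basis independence of the trace moves it to the fixed chart at `x`, where it can be
differentiated. -/
theorem meanCurv_symm_chart {p : ℝ × Plane} (hp : p ∈ cylinder x) :
    D.meanCurv p.1 ((extChartAt 𝓘(ℝ, Plane) x).symm p.2)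
      = trMetric basis2 (fun v w => D.coordq x p v w)
          (extrinsic (D.coordLapse x) (D.coordq x) p) := by
  refine (trMetric_coordBilin 𝓘(ℝ, Plane) basis2 x (mem_cylinder.mp hp)
    (q := D.q p.1 ((extChartAt 𝓘(ℝ, Plane) x).symm p.2))
    (T := D.secondFFL p.1 ((extChartAt 𝓘(ℝ, Plane) x).symm p.2)) (D.isMetric_q _ _)).trans ?_
  exact congrArg (trMetric basis2 _) (funext fun v => funext fun w =>
    D.coordBilin_secondFF x hp v w)

theorem meanCurv_eq : D.meanCurv t x
    = trMetric basis2 (fun v w => D.coordq x (base t x) v w)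
        (extrinsic (D.coordLapse x) (D.coordq x) (base t x)) := by
  have h := D.meanCurv_symm_chart x (base_mem t x)
  rw [← h]
  exact congrArg (D.meanCurv t) (extChartAt_to_inv x).symm

theorem differentiableAt_trMetric_extrinsic {p : ℝ × Plane} (hp : p ∈ cylinder x) :
    DifferentiableAt ℝ (fun y => trMetric basis2 (fun v w => D.coordq x y v w)
      (extrinsic (D.coordLapse x) (D.coordq x) y)) p := by
  have h := D.splitMetricOn x 0
  refine DifferentiableAt.congr_of_eventuallyEq (hasFDerivAt_basisTrace basis2
    (f := shape basis2 (D.coordLapse x) (D.coordq x))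
    fun v => (h.contDiffAt_shape basis2 hp v).diff).1 ?_
  exact Filter.eventually_of_mem (h.spatial.mem_nhds hp) fun y hy => h.trMetric_extrinsic basis2 hy

theorem dFun_meanCurv (v : Plane) : dFun 𝓘(ℝ, Plane) (D.meanCurv t) x v
    = fderiv ℝ (fun y => trMetric basis2 (fun v w => D.coordq x y v w)
        (extrinsic (D.coordLapse x) (D.coordq x) y)) (base t x) (0, v) := by
  have hd := D.differentiableAt_trMetric_extrinsic x (base_mem t x)
  have e : D.meanCurv t ∘ (extChartAt 𝓘(ℝ, Plane) x).symm
      =ᶠ[𝓝 (extChartAt 𝓘(ℝ, Plane) x x)] fun u => trMetric basis2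
        (fun v w => D.coordq x (t, u) v w) (extrinsic (D.coordLapse x) (D.coordq x) (t, u)) :=
    Filter.eventually_of_mem ((isOpen_extChartAt_target x).mem_nhds (mem_extChartAt_target x))
      fun u hu => D.meanCurv_symm_chart x (p := (t, u)) (mem_cylinder.mpr hu)
  have hd' : DifferentiableAt ℝ (fun u => trMetric basis2
        (fun v w => D.coordq x (t, u) v w) (extrinsic (D.coordLapse x) (D.coordq x) (t, u)))
        (extChartAt 𝓘(ℝ, Plane) x x) :=
    hd.comp (extChartAt 𝓘(ℝ, Plane) x x) (hasFDerivAt_prodMk_right (𝕜 := ℝ) t _).differentiableAt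
  rw [dFun_eq 𝓘(ℝ, Plane) (hd'.congr_of_eventuallyEq e), e.fderiv_eq]
  exact fderiv_slice (f := fun y => trMetric basis2 (fun v w => D.coordq x y v w)
        (extrinsic (D.coordLapse x) (D.coordq x) y)) hd v

omit [IsManifold 𝓘(ℝ, Plane) ∞ X] in
theorem mdifferentiable_β : MDifferentiable 𝓘(ℝ, Plane) 𝓘(ℝ, ℝ) (D.β t) := fun y =>
  ((D.β_smooth (t, y)).mdifferentiableAt (by simp)).comp y
    ((mdifferentiableAt_const (c := t)).prodMk mdifferentiableAt_id)

theorem covForm_dFun_β (v w : Plane) :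
    covForm 𝓘(ℝ, Plane) basis2 (D.metricX t) (dFun 𝓘(ℝ, Plane) (D.β t)) x v w
      = spatialHess basis2 (D.coordLapse x) (D.coordq x) (base t x) v w := by
  have h := D.splitMetricOn x t
  have e : ∀ w : Plane, ∀ u ∈ (extChartAt 𝓘(ℝ, Plane) x).target,
      coordForm 𝓘(ℝ, Plane) (dFun 𝓘(ℝ, Plane) (D.β t)) x u w
        = spatialDiff (D.coordLapse x) (t, u) w := fun w u hu => by
    refine (coordForm_dFun 𝓘(ℝ, Plane) (D.mdifferentiable_β t) x hu w).trans ?_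
    exact fderiv_slice (f := D.coordLapse x) (h.contDiffAt_lapse (mem_cylinder.mpr hu)).diff w
  have hc := h.spatial.christoffel_slice basis2 (base_mem t x) v w
  have e1 : fderiv ℝ (fun u => coordForm 𝓘(ℝ, Plane) (dFun 𝓘(ℝ, Plane) (D.β t)) x u w)
      (extChartAt 𝓘(ℝ, Plane) x x) v
      = fderiv ℝ (fun y => spatialDiff (D.coordLapse x) y w) (base t x) (0, v) := by
    refine Eq.trans ?_ (fderiv_slice (f := fun y => spatialDiff (D.coordLapse x) y w)
      (h.contDiffAt_spatialDiff (base_mem t x) w).diff v)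
    congr 1
    exact Filter.EventuallyEq.fderiv_eq (Filter.eventually_of_mem
      ((isOpen_extChartAt_target x).mem_nhds (mem_extChartAt_target x)) (e w))
  refine congrArg₂ (· - ·) e1 ?_
  refine (e _ _ (mem_extChartAt_target x)).trans ?_
  exact congrArg (spatialDiff (D.coordLapse x) (base t x)) hc

theorem covBilin_secondFF (v w z : Plane) :
    covBilin 𝓘(ℝ, Plane) basis2 (D.metricX t) (D.secondFF t) x v w z
      = spatialCovExtrinsic basis2 (D.coordLapse x) (D.coordq x) (base t x) v w z := by
  have h := D.splitMetricOn x t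
  have e : ∀ w z : Plane, ∀ u ∈ (extChartAt 𝓘(ℝ, Plane) x).target,
      coordBilin 𝓘(ℝ, Plane) (D.secondFF t) x u w z
        = extrinsic (D.coordLapse x) (D.coordq x) (t, u) w z := fun w z u hu =>
    D.coordBilin_secondFF x (p := (t, u)) (mem_cylinder.mpr hu) w z
  have hc := h.spatial.christoffel_slice basis2 (base_mem t x)
  have e1 : fderiv ℝ (fun u => coordBilin 𝓘(ℝ, Plane) (D.secondFF t) x u w z)
      (extChartAt 𝓘(ℝ, Plane) x x) v
      = fderiv ℝ (fun y => extrinsic (D.coordLapse x) (D.coordq x) y w z) (base t x) (0, v) := by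
    refine Eq.trans ?_ (fderiv_slice (f := fun y => extrinsic (D.coordLapse x) (D.coordq x) y w z)
      (h.contDiffAt_extrinsic (base_mem t x) w z).diff v)
    congr 1
    exact Filter.EventuallyEq.fderiv_eq (Filter.eventually_of_mem
      ((isOpen_extChartAt_target x).mem_nhds (mem_extChartAt_target x)) (e w z))
  refine congrArg₂ (· - ·) (congrArg₂ (· - ·) e1 ?_) ?_
  · refine (e _ _ _ (mem_extChartAt_target x)).trans ?_
    exact congrArg (fun y => extrinsic (D.coordLapse x) (D.coordq x) (base t x) y z) (hc v w)
  · refine (e _ _ _ (mem_extChartAt_target x)).trans ?_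
    exact congrArg (fun y => extrinsic (D.coordLapse x) (D.coordq x) (base t x) w y) (hc v z)

theorem divBilin_secondFF (w : Plane) :
    divBilin 𝓘(ℝ, Plane) basis2 (D.metricX t) (D.secondFF t) x w
      = -trMetric basis2 (fun v w => D.coordq x (base t x) v w) (fun v z =>
        spatialCovExtrinsic basis2 (D.coordLapse x) (D.coordq x) (base t x) v z w) := by
  unfold divBilin trMetric
  rw [D.metricX_funext t x]
  congr 1
  refine Finset.sum_congr rfl fun i _ => Finset.sum_congr rfl fun j _ => ?_
  exact congrArg _ (D.covBilin_secondFF t x _ _ w)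

theorem ricci_metricX (v w : Plane) : ricci 𝓘(ℝ, Plane) basis2 (D.metricX t) x v w
    = spatialRicci basis2 (D.coordq x) (base t x) v w :=
  (D.splitMetricOn x t).spatial.localRicci_slice basis2 (base_mem t x) v w

theorem scalarCurv_metricX : scalarCurv 𝓘(ℝ, Plane) basis2 (D.metricX t) x
    = trMetric basis2 (fun v w => D.coordq x (base t x) v w)
        (spatialRicci basis2 (D.coordq x) (base t x)) := by
  have e : ricci 𝓘(ℝ, Plane) basis2 (D.metricX t) x
      = spatialRicci basis2 (D.coordq x) (base t x) :=
    funext fun v => funext fun w => D.ricci_metricX t x v w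
  unfold scalarCurv
  rw [D.metricX_funext t x, e]
  rfl

theorem normSqBilin_secondFF :
    normSqBilin (coordBasis 𝓘(ℝ, Plane) basis2 x) (D.metricX t x) (D.secondFF t x)
      = basisTrace basis2 (fun v => shape basis2 (D.coordLapse x) (D.coordq x) (base t x)
          (shape basis2 (D.coordLapse x) (D.coordq x) (base t x) v)) := by
  have h := D.splitMetricOn x t
  rw [D.metricX_funext t x]
  exact (h.spatial.isMetric (base_mem t x)).normSqBilin_eq basis2 (T := D.secondFFL t x)
    (D.secondFF_symm t x) (fun v w =>
      (h.apply_shape basis2 (base_mem t x) v w).trans (D.secondFF_eq t x v w).symm)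

/-- In `∇_v(β⁻¹ ∂_t)` the derivative of `β⁻¹` has only a time component, and the Christoffel term
contributes `β⁻¹ · (-β S v)` along the slice. -/
theorem weingarten_eq (v : Plane) : D.weingarten t x v
    = shape basis2 (D.coordLapse x) (D.coordq x) (base t x) v := by
  have h := D.splitMetricOn x t
  have hp := base_mem t x
  have hβ := h.lapse_ne _ hp
  have e1 := D.coordVec_normal x t hp
  have e : coordVec modelRX D.normal (t, x)
      =ᶠ[𝓝 (base t x)] fun p => ((D.coordLapse x p)⁻¹, 0) :=
    Filter.eventually_of_mem (h.spatial.mem_nhds hp) fun y hy => D.coordVec_normal x t hy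
  have hd : HasFDerivAt (fun p : ℝ × Plane => ((D.coordLapse x p)⁻¹, (0 : Plane))) _ (base t x) :=
    ((h.contDiffAt_lapse hp).inv hβ).diff.hasFDerivAt.prodMk (hasFDerivAt_const 0 (base t x))
  have e2 : (fderiv ℝ (coordVec modelRX D.normal (t, x)) (base t x) (0, v)).2 = 0 := by
    rw [e.fderiv_eq, hd.fderiv]
    rfl
  have e3 : christoffel basis3 (coordBilin modelRX (fun p a c => D.metric p a c) (t, x))
      (base t x) (0, v) (coordVec modelRX D.normal (t, x) (base t x))
      = connection basis3 LinearMap.id (D.coordMetric x t) (base t x) (0, v)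
        ((D.coordLapse x (base t x))⁻¹, 0) := by
    rw [e1]
    rfl
  have h0 : shape basis2 (D.coordLapse x) (D.coordq x) (base t x) 0 = 0 :=
    (h.shape_linear basis2 hp).map_zero
  have h1 : spatialConnection basis2 (D.coordq x) (base t x) v 0 = 0 :=
    (h.spatial.connection_linear basis2 _ hp v).map_zero
  have e4 : D.weingarten t x v
      = -((fderiv ℝ (coordVec modelRX D.normal (t, x)) (base t x) (0, v)).2
        + (christoffel basis3 (coordBilin modelRX (fun p a c => D.metric p a c) (t, x))
      (base t x) (0, v) (coordVec modelRX D.normal (t, x) (base t x))).2) := rfl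
  rw [e4, e2, e3, h.connection_eq basis2 hp, h1, h0]
  simp [smul_smul, hβ]
  rfl

end SplitTuple

/-! ### The contact equation for a split metric -/

section SplitHodge

variable {V : Type*} [AddCommGroup V] [Module ℝ V]

/-- The coefficient of the metric volume form with respect to the determinant of the basis. -/
def volCoeff {ι : Type*} [Fintype ι] [DecidableEq ι] (b : Basis ι ℝ V) (g : V → V → ℝ)
    (o : V [⋀^ι]→ₗ[ℝ] ℝ) : ℝ :=
  Real.sign (o b) * √|(Matrix.of fun k l => g (b k) (b l)).det|

theorem volForm_two (b : Basis (Fin 2) ℝ V) (g : V → V → ℝ) (o : V [⋀^Fin 2]→ₗ[ℝ] ℝ) (v w : V) :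
    volForm b g o ![v, w]
      = volCoeff b g o * (b.repr v 0 * b.repr w 1 - b.repr w 0 * b.repr v 1) := by
  have h : b.det ![v, w] = b.repr v 0 * b.repr w 1 - b.repr w 0 * b.repr v 1 := by
    rw [Basis.det_apply, Matrix.det_fin_two]
    simp [Basis.toMatrix_apply]
  rw [← h]
  rfl

theorem volForm_three (b : Basis (Fin 3) ℝ V) (g : V → V → ℝ) (o : V [⋀^Fin 3]→ₗ[ℝ] ℝ)
    (v w z : V) : volForm b g o ![v, w, z]
      = volCoeff b g o * (b.repr v 0 * b.repr w 1 * b.repr z 2 - b.repr v 0 * b.repr z 1 * b.repr w 2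
        - b.repr w 0 * b.repr v 1 * b.repr z 2 + b.repr w 0 * b.repr z 1 * b.repr v 2
        + b.repr z 0 * b.repr v 1 * b.repr w 2 - b.repr z 0 * b.repr w 1 * b.repr v 2) := by
  have h : b.det ![v, w, z]
      = b.repr v 0 * b.repr w 1 * b.repr z 2 - b.repr v 0 * b.repr z 1 * b.repr w 2
        - b.repr w 0 * b.repr v 1 * b.repr z 2 + b.repr w 0 * b.repr z 1 * b.repr v 2
        + b.repr z 0 * b.repr v 1 * b.repr w 2 - b.repr z 0 * b.repr w 1 * b.repr v 2 := by
    rw [Basis.det_apply, Matrix.det_fin_three]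
    simp [Basis.toMatrix_apply]
  rw [← h]
  rfl

theorem hodgeOne_eq (b : Basis (Fin 2) ℝ V) (g : V → V → ℝ) (o : V [⋀^Fin 2]→ₗ[ℝ] ℝ)
    (θ : V → ℝ) (v : V) : hodgeOne b g o θ v = volCoeff b g o *
      ((gramInv b g 0 0 * θ (b 0) + gramInv b g 0 1 * θ (b 1)) * b.repr v 1
        - (gramInv b g 1 0 * θ (b 0) + gramInv b g 1 1 * θ (b 1)) * b.repr v 0) := by
  simp only [hodgeOne, Fin.sum_univ_two, volForm_two, Basis.repr_self]
  simp
  ring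

/-- The determinant of a definite metric on a plane is the square of the volume coefficient. -/
theorem volCoeff_sq {b : Basis (Fin 2) ℝ V} {g : V → V → ℝ} {o : V [⋀^Fin 2]→ₗ[ℝ] ℝ}
    (ho : o b ≠ 0) (hd : 0 < g (b 0) (b 0) * g (b 1) (b 1) - g (b 0) (b 1) * g (b 1) (b 0)) :
    volCoeff b g o ^ 2 = g (b 0) (b 0) * g (b 1) (b 1) - g (b 0) (b 1) * g (b 1) (b 0) := by
  have hs : Real.sign (o b) ^ 2 = 1 := by
    rcases Real.sign_apply_eq_of_ne_zero _ ho with h | h <;> rw [h] <;> norm_num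
  rw [volCoeff, mul_pow, hs, one_mul, Real.sq_sqrt (abs_nonneg _), Matrix.det_fin_two]
  exact abs_of_pos hd

/-- Cramer's rule. No invertibility is required: for determinant zero both sides take the default
value `0`. -/
theorem gramInv_two (b : Basis (Fin 2) ℝ V) (g : V → V → ℝ) :
    gramInv b g 0 0 = g (b 1) (b 1) / (g (b 0) (b 0) * g (b 1) (b 1) - g (b 0) (b 1) * g (b 1) (b 0))
    ∧ gramInv b g 0 1
      = -g (b 0) (b 1) / (g (b 0) (b 0) * g (b 1) (b 1) - g (b 0) (b 1) * g (b 1) (b 0))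
    ∧ gramInv b g 1 0
      = -g (b 1) (b 0) / (g (b 0) (b 0) * g (b 1) (b 1) - g (b 0) (b 1) * g (b 1) (b 0))
    ∧ gramInv b g 1 1
      = g (b 0) (b 0) / (g (b 0) (b 0) * g (b 1) (b 1) - g (b 0) (b 1) * g (b 1) (b 0)) := by
  simp only [gramInv, Matrix.inv_def, Ring.inverse_eq_inv', Matrix.smul_apply, smul_eq_mul,
    Matrix.adjugate_fin_two, Matrix.det_fin_two]
  refine ⟨?_, ?_, ?_, ?_⟩ <;> simp <;> ring

/-- In dimension two, the square of the Hodge operator on one-forms is `-1`. -/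
theorem hodgeOne_hodgeOne {b : Basis (Fin 2) ℝ V} {g : V → V → ℝ} {o : V [⋀^Fin 2]→ₗ[ℝ] ℝ}
    (ho : o b ≠ 0) (hs : g (b 0) (b 1) = g (b 1) (b 0))
    (hd : 0 < g (b 0) (b 0) * g (b 1) (b 1) - g (b 0) (b 1) * g (b 1) (b 0)) (θ : V →ₗ[ℝ] ℝ) (v : V) :
    hodgeOne b g o (hodgeOne b g o θ) v = -θ v := by
  obtain ⟨h1, h2, h3, h4⟩ := gramInv_two b g
  have hσ := volCoeff_sq ho hd
  simp only [hodgeOne_eq, Basis.repr_self, linear_apply_eq_sum b θ v, Fin.sum_univ_two, h1, h2, h3,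
    h4]
  simp only [Finsupp.single_eq_same, ne_eq, one_ne_zero, zero_ne_one, not_false_eq_true,
    Finsupp.single_eq_of_ne]
  rw [← hs] at hσ hd ⊢
  rw [← hσ] at hd ⊢
  have hσ0 : volCoeff b g o ≠ 0 := fun h => by rw [h] at hd; norm_num at hd
  field_simp
  linear_combination (b.repr v 0 * θ (b 0) + b.repr v 1 * θ (b 1)) * hσ

variable (b : Basis (Fin 2) ℝ V) (B : Basis (Fin 3) ℝ (ℝ × V)) {q : V →ₗ[ℝ] V →ₗ[ℝ] ℝ}
  {g : (ℝ × V) →ₗ[ℝ] (ℝ × V) →ₗ[ℝ] ℝ} {β : ℝ}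

theorem IsMetric.split (hq : IsMetric q) (hβ : β ≠ 0)
    (hg : ∀ a c v w, g (a, v) (c, w) = -β ^ 2 * (a * c) + q v w) : IsMetric g where
  symm := by
    rintro ⟨a, v⟩ ⟨c, w⟩
    rw [hg, hg, hq.symm, mul_comm a]
  nondeg := by
    rintro ⟨a, v⟩ h
    have h1 := h (1, 0)
    rw [hg] at h1
    have ha : a = 0 := by simpa [hβ] using h1
    have hv : v = 0 := hq.nondeg v fun w => by
      have h2 := h (0, w)
      rw [hg] at h2
      simpa using h2
    rw [ha, hv]
    rfl

theorem normSqForm_split (hq : IsMetric q) (hβ : β ≠ 0)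
    (hg : ∀ a c v w, g (a, v) (c, w) = -β ^ 2 * (a * c) + q v w) (F : ℝ) (θ : V →ₗ[ℝ] ℝ)
    (η : ℝ × V →ₗ[ℝ] ℝ) (hη : ∀ a v, η (a, v) = F * β * a + θ v) :
    normSqForm B (fun v w => g v w) η = -F ^ 2 + normSqForm b (fun v w => q v w) θ := by
  let s := sharp b (fun v w => q v w) θ
  have hs : ∀ x, q s x = θ x := hq.apply_sharp b θ
  -- The vector dual to `η`: its time component is `Fβ` divided by `g(∂_t, ∂_t) = -β²`.
  rw [(hq.split hβ hg).normSqForm_eq B η (z := (-(F / β), s)), hη, hq.normSqForm_eq b θ hs]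
  · field_simp
  · rintro ⟨c, w⟩
    rw [hg, hη, hs]
    field_simp

variable (hB0 : B 0 = (1, 0)) (hB1 : B 1 = (0, b 0)) (hB2 : B 2 = (0, b 1))
include hB0 hB1 hB2

theorem repr_split (a : ℝ) (v : V) :
    B.repr (a, v) 0 = a ∧ B.repr (a, v) 1 = b.repr v 0 ∧ B.repr (a, v) 2 = b.repr v 1 := by
  have h : (a, v) = a • B 0 + b.repr v 0 • B 1 + b.repr v 1 • B 2 := by
    rw [hB0, hB1, hB2]
    refine Prod.ext (by simp) ?_
    have e := b.sum_repr v
    rw [Fin.sum_univ_two] at e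
    simp [e]
  rw [h]
  simp only [map_add, map_smul, Basis.repr_self, Finsupp.add_apply, Finsupp.smul_apply]
  simp

theorem basisTrace_split (f : ℝ × V → ℝ × V) :
    basisTrace B f = (f (1, 0)).1 + basisTrace b (fun v => (f (0, v)).2) := by
  have h := repr_split b B hB0 hB1 hB2
  simp only [basisTrace, Fin.sum_univ_three, Fin.sum_univ_two, hB0, hB1, hB2]
  rw [(h _ _).1, (h _ _).2.1, (h _ _).2.2, add_assoc]

theorem gramInv_split (hq : IsMetric q) (hβ : β ≠ 0)
    (hg : ∀ a c v w, g (a, v) (c, w) = -β ^ 2 * (a * c) + q v w) (i j : Fin 3) :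
    gramInv B (fun v w => g v w) i j
      = !![-1 / β ^ 2, 0, 0;
          0, gramInv b (fun v w => q v w) 0 0, gramInv b (fun v w => q v w) 0 1;
          0, gramInv b (fun v w => q v w) 1 0, gramInv b (fun v w => q v w) 1 1] i j := by
  have h := hq.gramInv_mul b
  simp only [Fin.sum_univ_two] at h
  refine congrFun (congrFun (Matrix.inv_eq_left_inv ?_) i) j
  ext i j
  fin_cases i <;> fin_cases j <;>
    simp [Matrix.mul_apply, Fin.sum_univ_three, hB0, hB1, hB2, hg, h, hβ]

/-- The square root contributes only `|β|`. Its missing sign is the one by which the induced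
orientation `o' = o(β⁻¹ ∂_t, ·, ·)` differs from `o(∂_t, ·, ·)`, so the factor is `β` for either
sign of the lapse. -/
theorem volCoeff_split (hβ : β ≠ 0)
    (hg : ∀ a c v w, g (a, v) (c, w) = -β ^ 2 * (a * c) + q v w)
    {o : (ℝ × V) [⋀^Fin 3]→ₗ[ℝ] ℝ} {o' : V [⋀^Fin 2]→ₗ[ℝ] ℝ} (ho : o' b = β⁻¹ * o B) :
    volCoeff B (fun v w => g v w) o = β * volCoeff b (fun v w => q v w) o' := by
  have hd : (Matrix.of fun k l => g (B k) (B l)).det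
      = -β ^ 2 * (Matrix.of fun k l => q (b k) (b l)).det := by
    rw [Matrix.det_fin_three, Matrix.det_fin_two]
    simp [hB0, hB1, hB2, hg]
    ring
  simp only [volCoeff]
  rw [hd, ho, abs_mul, Real.sqrt_mul (abs_nonneg _), abs_neg, abs_of_nonneg (sq_nonneg β),
    Real.sqrt_sq_eq_abs]
  rcases lt_trichotomy (o B) 0 with h | h | h <;> rcases lt_or_gt_of_ne hβ with h' | h'
  · rw [Real.sign_of_neg h, Real.sign_of_pos (mul_pos_of_neg_of_neg (inv_lt_zero.mpr h') h),
      abs_of_neg h']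
    ring
  · rw [Real.sign_of_neg h, Real.sign_of_neg (mul_neg_of_pos_of_neg (inv_pos.mpr h') h),
      abs_of_pos h']
    ring
  · simp [h]
  · simp [h]
  · rw [Real.sign_of_pos h, Real.sign_of_neg (mul_neg_of_neg_of_pos (inv_lt_zero.mpr h') h),
      abs_of_neg h']
    ring
  · rw [Real.sign_of_pos h, Real.sign_of_pos (mul_pos (inv_pos.mpr h') h), abs_of_pos h']
    ring

/-- The Hodge dual of `dt ∧ A + K`. -/
theorem hodgeTwo_split (hq : IsMetric q) (hβ : β ≠ 0)
    (hd : 0 < q (b 0) (b 0) * q (b 1) (b 1) - q (b 0) (b 1) * q (b 1) (b 0))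
    (hg : ∀ a c v w, g (a, v) (c, w) = -β ^ 2 * (a * c) + q v w)
    {o : (ℝ × V) [⋀^Fin 3]→ₗ[ℝ] ℝ} {o' : V [⋀^Fin 2]→ₗ[ℝ] ℝ} (ho : o' b = β⁻¹ * o B)
    (ho' : o' b ≠ 0) {η : ℝ × V → ℝ × V → ℝ} {A : V →ₗ[ℝ] ℝ} {K : V →ₗ[ℝ] V →ₗ[ℝ] ℝ}
    (hK : ∀ v w, K v w = -K w v)
    (hη : ∀ a c v w, η (a, v) (c, w) = a * A w - c * A v + K v w) (a : ℝ) (v : V) :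
    hodgeTwo B (fun v w => g v w) o η (a, v)
      = a * (β * K (b 0) (b 1) / volCoeff b (fun v w => q v w) o')
        - β⁻¹ * hodgeOne b (fun v w => q v w) o' A v := by
  have hK0 : ∀ v, K v v = 0 := fun v => by linarith [hK v v]
  have hη' : ∀ i j, η (B i) (B j) = !![0, A (b 0), A (b 1); -A (b 0), 0, K (b 0) (b 1);
      -A (b 1), -K (b 0) (b 1), 0] i j := fun i j => by
    fin_cases i <;> fin_cases j <;> simp [hB0, hB1, hB2, hη, hK0, hK (b 1) (b 0)]
  obtain ⟨r0, r1, r2⟩ := repr_split b B hB0 hB1 hB2 a v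
  have hσ := volCoeff_sq (g := fun v w => q v w) ho' hd
  obtain ⟨h1, h2, h3, h4⟩ := gramInv_two b (fun v w => q v w)
  simp only [hodgeTwo, volForm_three, volCoeff_split b B hB0 hB1 hB2 hβ hg ho, hη',
    gramInv_split b B hB0 hB1 hB2 hq hβ hg, Basis.repr_self, r0, r1, r2, hodgeOne_eq]
  simp [Fin.sum_univ_three]
  simp only [h1, h2, h3, h4]
  rw [hq.symm (b 1) (b 0)] at hσ hd ⊢
  rw [← hσ] at hd ⊢
  have hσ0 : volCoeff b (fun v w => q v w) o' ≠ 0 := fun h => by rw [h] at hd; norm_num at hd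
  field_simp
  linear_combination (-(2 * β ^ 2 * K (b 0) (b 1) * a)) * hσ

omit B hB0 hB1 hB2 in
-- Two-forms on a plane are determined by a single coefficient.
theorem volForm_two_eq_iff {K : V →ₗ[ℝ] V →ₗ[ℝ] ℝ} (hK : ∀ v w, K v w = -K w v)
    (g : V → V → ℝ) (o : V [⋀^Fin 2]→ₗ[ℝ] ℝ) (F : ℝ) :
    (∀ v w, K v w = F * volForm b g o ![v, w]) ↔ K (b 0) (b 1) = F * volCoeff b g o := by
  constructor
  · intro h
    rw [h, volForm_two]
    simp
  · intro h v w
    have hK0 : ∀ v, K v v = 0 := fun v => by linarith [hK v v]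
    have e : K v w = K (b 0) (b 1) * (b.repr v 0 * b.repr w 1 - b.repr w 0 * b.repr v 1) := by
      have key : ∀ r s r' s' : ℝ, K (r • b 0 + s • b 1) (r' • b 0 + s' • b 1)
          = K (b 0) (b 1) * (r * s' - r' * s) := fun r s r' s' => by
        simp [hK0, hK (b 1) (b 0)]
        ring
      have hv := b.sum_repr v
      have hw := b.sum_repr w
      rw [Fin.sum_univ_two] at hv hw
      have := key (b.repr v 0) (b.repr v 1) (b.repr w 0) (b.repr w 1)
      rwa [hv, hw] at this
    rw [e, h, volForm_two]
    ring

omit B hB0 hB1 hB2 in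
theorem hodgeOne_smul (g : V → V → ℝ) (o : V [⋀^Fin 2]→ₗ[ℝ] ℝ) (c : ℝ) (θ : V → ℝ) (v : V) :
    hodgeOne b g o (fun w => c * θ w) v = c * hodgeOne b g o θ v := by
  rw [hodgeOne_eq, hodgeOne_eq]
  ring

omit B hB0 hB1 hB2 in
theorem gram_det_pos (hs : ∀ v w, q v w = q w v) (hpos : ∀ v, v ≠ 0 → 0 < q v v) :
    0 < q (b 0) (b 0) * q (b 1) (b 1) - q (b 0) (b 1) * q (b 1) (b 0) := by
  have h1 : 0 < q (b 1) (b 1) := hpos _ (b.ne_zero 1)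
  -- The part of `b 0` orthogonal to `b 1`, multiplied by `q (b 1) (b 1)`; its square length is `q
  -- (b 1) (b 1)` times the Gram determinant.
  have hx : q (b 1) (b 1) • b 0 - q (b 0) (b 1) • b 1 ≠ 0 := fun h => by
    have := congrArg (fun z => b.repr z 0) h
    simp at this
    exact h1.ne' this
  have h2 := hpos _ hx
  have e : q (q (b 1) (b 1) • b 0 - q (b 0) (b 1) • b 1)
      (q (b 1) (b 1) • b 0 - q (b 0) (b 1) • b 1)
      = q (b 1) (b 1) * (q (b 0) (b 0) * q (b 1) (b 1) - q (b 0) (b 1) * q (b 1) (b 0)) := by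
    simp [hs (b 1) (b 0)]
    ring
  rw [e] at h2
  exact (pos_iff_pos_of_mul_pos h2).mp h1

/-- The equation `α = ∗dα` for `α = Fβ dt + θ` and `dα = dt ∧ A + K`. -/
theorem contact_split (hq : IsMetric q) (hβ : β ≠ 0)
    (hd : 0 < q (b 0) (b 0) * q (b 1) (b 1) - q (b 0) (b 1) * q (b 1) (b 0))
    (hg : ∀ a c v w, g (a, v) (c, w) = -β ^ 2 * (a * c) + q v w)
    {o : (ℝ × V) [⋀^Fin 3]→ₗ[ℝ] ℝ} {o' : V [⋀^Fin 2]→ₗ[ℝ] ℝ} (ho : o' b = β⁻¹ * o B)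
    (ho' : o' b ≠ 0) {η : ℝ × V → ℝ × V → ℝ} {A : V →ₗ[ℝ] ℝ} {K : V →ₗ[ℝ] V →ₗ[ℝ] ℝ}
    (hK : ∀ v w, K v w = -K w v)
    (hη : ∀ a c v w, η (a, v) (c, w) = a * A w - c * A v + K v w)
    {F : ℝ} {θ : V →ₗ[ℝ] ℝ} {α : ℝ × V →ₗ[ℝ] ℝ} (hα : ∀ a v, α (a, v) = F * β * a + θ v) :
    (∀ z, α z = hodgeTwo B (fun v w => g v w) o η z)
      ↔ (∀ v w, K v w = F * volForm b (fun v w => q v w) o' ![v, w])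
        ∧ ∀ v, β * hodgeOne b (fun v w => q v w) o' θ v = A v := by
  have hσ := volCoeff_sq (g := fun v w => q v w) ho' hd
  have hσ0 : volCoeff b (fun v w => q v w) o' ≠ 0 := fun h => by
    rw [h] at hσ
    norm_num at hσ
    linarith
  have hh := hodgeOne_hodgeOne (g := fun v w => q v w) ho' (hq.symm _ _) hd
  have h0 : hodgeOne b (fun v w => q v w) o' A 0 = 0 := by
    rw [hodgeOne_eq]
    simp
  rw [volForm_two_eq_iff b hK]
  constructor
  · intro h
    have h1 : ∀ a v, F * β * a + θ v = a * (β * K (b 0) (b 1) / volCoeff b (fun v w => q v w) o')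
        - β⁻¹ * hodgeOne b (fun v w => q v w) o' A v := fun a v => by
      rw [← hα, h, hodgeTwo_split b B hB0 hB1 hB2 hq hβ hd hg ho ho' hK hη]
    refine ⟨?_, fun v => ?_⟩
    -- The time component, obtained by evaluation on `∂_t`.
    · have h2 := h1 1 0
      rw [h0, map_zero] at h2
      field_simp at h2
      refine mul_left_cancel₀ (pow_ne_zero 2 hβ) ?_
      linear_combination -h2
    -- The space component is `θ = -β⁻¹ ∗A`; applying `∗` and using `∗∗ = -1` solves it for `A`.
    · have h2 : (θ : V → ℝ) = fun v => (-β⁻¹) * hodgeOne b (fun v w => q v w) o' A v :=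
        funext fun v => by
          have := h1 0 v
          linarith
      rw [h2, hodgeOne_smul, hh]
      field_simp
  · rintro ⟨h1, h2⟩ ⟨a, v⟩
    have h3 : (A : V → ℝ) = fun v => β * hodgeOne b (fun v w => q v w) o' θ v :=
      funext fun v => (h2 v).symm
    rw [hα, hodgeTwo_split b B hB0 hB1 hB2 hq hβ hd hg ho ho' hK hη, h1, h3, hodgeOne_smul, hh]
    field_simp
    ring

end SplitHodge

/-! ### The Einstein equation for a split metric -/

section SplitEinstein

/-- Linearity in the first argument suffices: with the symmetry of the Ricci tensor it yields
bilinearity. -/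
theorem SmoothMetricOn.localRicci_linear {ι E : Type*} [Fintype ι] [DecidableEq ι]
    [NormedAddCommGroup E] [NormedSpace ℝ E] {Ω : Set E} {Q : E → E →ₗ[ℝ] E →ₗ[ℝ] ℝ}
    (h : SmoothMetricOn Ω Q) (b : Basis ι ℝ E) {p : E} (hp : p ∈ Ω) (z : E) :
    IsLinearMap ℝ (fun w => localRicci b (fun u v w => Q u v w) p w z) := by
  let Γ := connection b LinearMap.id Q
  have hΓ : ∀ v w, DifferentiableAt ℝ (fun y => Γ y v w) p := fun v w =>
    (h.contDiffAt_connection b _ hp v w).diff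
  have l : ∀ y ∈ Ω, ∀ z, IsLinearMap ℝ (fun w => Γ y w z) := fun y hy z => by
    simp only [Γ, fun w => h.connection_symm b LinearMap.id hy w z]
    exact h.connection_linear b _ hy z
  have r : ∀ v, IsLinearMap ℝ (Γ p v) := fun v => h.connection_linear b _ hp v
  have e : ∀ w, localRicci b (fun u v w => Q u v w) p w z
      = basisTrace b (fun v => fderiv ℝ (fun y => Γ y w z) p v - fderiv ℝ (fun y => Γ y v z) p w
        + Γ p v (Γ p w z) - Γ p w (Γ p v z)) := fun w => rfl
  constructor
  · intro w w'
    have e1 : fderiv ℝ (fun y => Γ y (w + w') z) p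
        = fderiv ℝ (fun y => Γ y w z) p + fderiv ℝ (fun y => Γ y w' z) p := by
      rw [← fderiv_fun_add (hΓ w z) (hΓ w' z)]
      exact Filter.EventuallyEq.fderiv_eq (Filter.eventually_of_mem (h.mem_nhds hp)
        fun y hy => (l y hy z).map_add w w')
    rw [e, e, e, ← basisTrace_add, e1]
    congr 1
    funext v
    rw [(l p hp z).map_add, (l p hp _).map_add, (r v).map_add, map_add, add_apply]
    abel
  · intro c w
    have e1 : fderiv ℝ (fun y => Γ y (c • w) z) p = c • fderiv ℝ (fun y => Γ y w z) p := by
      rw [← fderiv_fun_const_smul (hΓ w z)]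
      exact Filter.EventuallyEq.fderiv_eq (Filter.eventually_of_mem (h.mem_nhds hp)
        fun y hy => (l y hy z).map_smul c w)
    rw [e, e, smul_eq_mul, ← basisTrace_smul, e1]
    congr 1
    funext v
    rw [(l p hp z).map_smul, (l p hp _).map_smul, (r v).map_smul, map_smul, smul_apply]
    module

/-- The Einstein equation of a split metric in terms of its components. -/
theorem SplitMetricOn.einstein_iff {κ E : Type*} [Fintype κ] [DecidableEq κ]
    [NormedAddCommGroup E] [NormedSpace ℝ E]
    {Ω : Set (ℝ × E)} {β : ℝ × E → ℝ} {Q : ℝ × E → E →ₗ[ℝ] E →ₗ[ℝ] ℝ}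
    {G : ℝ × E → (ℝ × E) →ₗ[ℝ] (ℝ × E) →ₗ[ℝ] ℝ} (h : SplitMetricOn Ω β Q G)
    (b : Basis (Fin 2) ℝ E) {p : ℝ × E} (hp : p ∈ Ω) (B : Basis κ ℝ (ℝ × E))
    (hB : ∀ f : ℝ × E → ℝ × E,
      basisTrace B f = (f (1, 0)).1 + basisTrace b (fun v => (f (0, v)).2))
    {lam k ε F : ℝ} {θ : E →ₗ[ℝ] ℝ} {α : ℝ × E → ℝ} (hα : ∀ a v, α (a, v) = F * β p * a + θ v)
    (hn : normSqForm b (fun v w => Q p v w) θ = ε + F ^ 2) :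
    (∀ v w, localRicci B (fun u v w => G u v w) p v w
        = -(1 / 2) * (lam ^ 2 + k * ε) * G p v w + k * (α v * α w))
      ↔ (trMetric b (fun v w => Q p v w) (spatialRicci b Q p)
          - basisTrace b (fun v => shape b β Q p (shape b β Q p v))
          + trMetric b (fun v w => Q p v w) (extrinsic β Q p) ^ 2 + (lam ^ 2 - k * ε) / 2
          = 2 * k * F ^ 2)
        ∧ (∀ w, fderiv ℝ (fun y => trMetric b (fun v w => Q y v w) (extrinsic β Q y)) p (0, w)
          + -trMetric b (fun v w => Q p v w) (fun v x => spatialCovExtrinsic b β Q p v x w)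
          = k * F * θ w)
        ∧ (∀ v w, spatialRicci b Q p v w
          + trMetric b (fun v w => Q p v w) (extrinsic β Q p) * extrinsic β Q p v w
          - 2 * extrinsic β Q p v (shape b β Q p w)
          - 1 / β p * (fderiv ℝ (fun y => extrinsic β Q y v w) p (1, 0)
            + spatialHess b β Q p v w)
          = k * (θ v * θ w) - 1 / 2 * (lam ^ 2 + k * ε) * Q p v w) := by
  have hβ := h.lapse_ne p hp
  have hss := h.ricci_space_space b hp B hB
  have hst := h.ricci_space_time b hp B hB
  have htt := h.ricci_time_time b hp B hB
  have hsym := fun v w => h.metric.localRicci_symm B hp v w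
  have hlin := h.metric.localRicci_linear B hp
  set R := fun v w => localRicci B (fun u v w => G u v w) p v w with hR
  have hR' : ∀ v w, localRicci B (fun u v w => G u v w) p v w = R v w := fun _ _ => rfl
  simp only [hR'] at hss hst htt hsym hlin ⊢
  have hα0 : ∀ w, α (0, w) = θ w := fun w => by rw [hα]; ring
  have hα1 : α (1, 0) = F * β p := by rw [hα]; simp
  have htr : (∀ v w, R (0, v) (0, w)
      = -(1 / 2) * (lam ^ 2 + k * ε) * Q p v w + k * (θ v * θ w)) →
      trMetric b (fun v w => Q p v w) (fun v w => R (0, v) (0, w))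
        = -(lam ^ 2 + k * ε) + k * (ε + F ^ 2) := fun hs => by
    -- The squared norm of `θ` is by definition the trace of `θ ⊗ θ`; this is where the norm
    -- equation enters.
    have e1 : trMetric b (fun v w => Q p v w) (fun v w => θ v * θ w) = ε + F ^ 2 := hn
    have e2 : trMetric b (fun v w => Q p v w) (fun v w => Q p v w) = 2 := by
      rw [(h.spatial.isMetric hp).trMetric_eq b (S := fun v => v) fun v w => rfl]
      simp [basisTrace]
    simp only [hs]
    rw [trMetric_add, trMetric_smul, trMetric_smul, e1, e2]
    ring
  constructor
  · intro hE
    have hs : ∀ v w, R (0, v) (0, w)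
        = -(1 / 2) * (lam ^ 2 + k * ε) * Q p v w + k * (θ v * θ w) := fun v w => by
      rw [hE, h.apply p hp, hα0, hα0]
      ring
    refine ⟨?_, fun w => ?_, fun v w => ?_⟩
    -- The time-time part of the Einstein equation is combined with the trace of its space-space
    -- part; after division by `β²` the constants add up to `2κF² - (λ² - κε)/2`.
    · rw [htr hs, hE, h.apply p hp, hα1, map_zero] at htt
      refine mul_left_cancel₀ (pow_ne_zero 2 hβ) ?_
      linear_combination -htt
    · have := hst w
      rw [hE, h.apply p hp, hα0, hα1, map_zero] at this
      refine mul_left_cancel₀ hβ ?_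
      linear_combination -this
    · rw [← hss, hs]
      ring
  · rintro ⟨h1, h2, h3⟩
    have hs : ∀ v w, R (0, v) (0, w)
        = -(1 / 2) * (lam ^ 2 + k * ε) * Q p v w + k * (θ v * θ w) := fun v w => by
      rw [hss, h3]
      ring
    have ht : ∀ w, R (0, w) (1, 0) = k * (θ w * (F * β p)) := fun w => by
      rw [hst]
      linear_combination β p * h2 w
    have htt' : R (1, 0) (1, 0) = 1 / 2 * (lam ^ 2 + k * ε) * β p ^ 2 + k * (F * β p) ^ 2 := by
      rw [htr hs] at htt
      linear_combination htt + β p ^ 2 * h1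
    rintro ⟨a, v⟩ ⟨c, w⟩
    -- The three components known so far determine the Ricci tensor by bilinearity and symmetry.
    have dec : ∀ (a : ℝ) (v : E), (a, v) = a • ((1, 0) : ℝ × E) + (0, v) := fun a v => by simp
    have e1 : ∀ X, R (a, v) X = a * R (1, 0) X + R (0, v) X := fun X => by
      rw [dec a v, (hlin X).map_add, (hlin X).map_smul, smul_eq_mul]
    have e2 : ∀ X, R X (c, w) = c * R X (1, 0) + R X (0, w) := fun X => by
      rw [hsym X, hsym X (1, 0), hsym X (0, w), dec c w, (hlin X).map_add, (hlin X).map_smul,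
        smul_eq_mul]
    rw [e1, e2, e2, hsym (1, 0) (0, w), htt', ht, ht, hs, h.apply p hp, hα, hα]
    ring

end SplitEinstein

/-! ### The adapted basis of the model space -/

theorem basis3_zero : basis3 0 = (1, 0) := by
  have : (0 : Fin 3) = (finSumFinEquiv : Fin 1 ⊕ Fin 2 ≃ Fin (1 + 2)) (Sum.inl 0) := rfl
  rw [basis3, Basis.reindex_apply, this, Equiv.symm_apply_apply]
  simp

theorem basis3_one : basis3 1 = (0, basis2 0) := by
  have : (1 : Fin 3) = finSumFinEquiv (Sum.inr (0 : Fin 2)) := rfl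
  rw [basis3, Basis.reindex_apply, this, Equiv.symm_apply_apply]
  simp

theorem basis3_two : basis3 2 = (0, basis2 1) := by
  have : (2 : Fin 3) = finSumFinEquiv (Sum.inr (1 : Fin 2)) := rfl
  rw [basis3, Basis.reindex_apply, this, Equiv.symm_apply_apply]
  simp

/-! ### Pointwise equivalence of the spacetime equations and the system -/

namespace SplitTuple

variable {X : Type*} [TopologicalSpace X] [ChartedSpace Plane X] (D : SplitTuple X) (t : ℝ) (x : X)

/-- The metric `g` at a point as a bilinear form on the model space. -/
def metricAt : (ℝ × Plane) →ₗ[ℝ] (ℝ × Plane) →ₗ[ℝ] ℝ := D.metric (t, x)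

/-- The one-form `α` at a point as a linear form on the model space. -/
def formAt : ℝ × Plane →ₗ[ℝ] ℝ := D.form (t, x)

/-- The metric `q_t` at a point as a bilinear form on the model space. -/
def qAt : Plane →ₗ[ℝ] Plane →ₗ[ℝ] ℝ := D.q t x

/-- The one-form `α_t^⊥` at a point as a linear form on the model space. -/
def perpAt : Plane →ₗ[ℝ] ℝ := D.α t x

theorem metricAt_apply (a c : ℝ) (v w : Plane) :
    D.metricAt t x (a, v) (c, w) = -(D.β t x) ^ 2 * (a * c) + D.qAt t x v w := rfl

theorem formAt_apply (a : ℝ) (v : Plane) :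
    D.formAt t x (a, v) = D.F t x * D.β t x * a + D.perpAt t x v := rfl

theorem isMetric_qAt : IsMetric (D.qAt t x) := D.isMetric_q t x

theorem qAt_det_pos : 0 < D.qAt t x (basis2 0) (basis2 0) * D.qAt t x (basis2 1) (basis2 1)
    - D.qAt t x (basis2 0) (basis2 1) * D.qAt t x (basis2 1) (basis2 0) :=
  gram_det_pos basis2 (D.q_symm t x) (D.q_pos t x)

variable {o : ∀ p : ℝ × X, TangentSpace modelRX p [⋀^Fin 3]→ₗ[ℝ] ℝ}

/-- An orientation form at a point as an alternating form on the model space. -/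
def orientAt (o : ∀ p : ℝ × X, TangentSpace modelRX p [⋀^Fin 3]→ₗ[ℝ] ℝ) (t : ℝ) (x : X) :
    (ℝ × Plane) [⋀^Fin 3]→ₗ[ℝ] ℝ := o (t, x)

/-- The induced orientation at a point as an alternating form on the model space. -/
def inducedAt (o : ∀ p : ℝ × X, TangentSpace modelRX p [⋀^Fin 3]→ₗ[ℝ] ℝ) :
    Plane [⋀^Fin 2]→ₗ[ℝ] ℝ := D.inducedOrientation o t x

/-- The factor is that of `n_t = β⁻¹ ∂_t`. This is the orientation hypothesis of `volCoeff_split`.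
-/
theorem inducedAt_basis2 : D.inducedAt t x o basis2 = (D.β t x)⁻¹ * orientAt o t x basis3 := by
  have e1 : D.inducedAt t x o basis2
      = ((orientAt o t x).curryLeft ((D.β t x)⁻¹ • ((1, 0) : ℝ × Plane)))
        (fun i => LinearMap.inr ℝ ℝ Plane (basis2 i)) := rfl
  have e2 : (Matrix.vecCons ((1, 0) : ℝ × Plane)
      (fun i => LinearMap.inr ℝ ℝ Plane (basis2 i)) : Fin 3 → ℝ × Plane) = basis3 := by
    funext i
    fin_cases i
    · exact basis3_zero.symm
    · exact basis3_one.symm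
    · exact basis3_two.symm
  rw [e1, map_smul, AlternatingMap.smul_apply, AlternatingMap.curryLeft_apply_apply, e2]
  rfl

theorem orientAt_basis3 (ho : IsOrientationForm modelRX o) : orientAt o t x basis3 ≠ 0 :=
  (AlternatingMap.map_basis_ne_zero_iff basis3 (orientAt o t x)).mpr (ho.ne_zero (t, x))

theorem inducedAt_ne_zero (ho : IsOrientationForm modelRX o) : D.inducedAt t x o basis2 ≠ 0 := by
  rw [D.inducedAt_basis2]
  exact mul_ne_zero (inv_ne_zero (D.β_ne_zero t x)) (orientAt_basis3 t x ho)

theorem norm_iff (ε : ℝ) :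
    normSqForm (coordBasis modelRX basis3 (t, x)) (fun a c => D.metric (t, x) a c)
        (fun a => D.form (t, x) a) = ε
      ↔ normSqForm (coordBasis 𝓘(ℝ, Plane) basis2 x) (D.metricX t x) (D.formX t x)
        = ε + D.F t x ^ 2 := by
  have h : normSqForm (coordBasis modelRX basis3 (t, x)) (fun a c => D.metric (t, x) a c)
        (fun a => D.form (t, x) a)
      = -D.F t x ^ 2
        + normSqForm (coordBasis 𝓘(ℝ, Plane) basis2 x) (D.metricX t x) (D.formX t x) :=
    normSqForm_split basis2 basis3 (D.isMetric_qAt t x) (D.β_ne_zero t x) (D.metricAt_apply t x)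
      (D.F t x) (D.perpAt t x) (D.formAt t x) (D.formAt_apply t x)
  rw [h]
  constructor <;> intro h <;> linarith

theorem contDiffAt_coordPerp {p : ℝ × Plane} (hp : p ∈ cylinder x) (v : Plane) :
    ContDiffAt ℝ ∞ (fun y => D.coordPerp x y v) p :=
  (D.α_smooth x v).contDiffAt ((isOpen_cylinder x).mem_nhds hp)

variable [IsManifold 𝓘(ℝ, Plane) ∞ X]

theorem contDiffAt_coordF_mul_coordLapse {p : ℝ × Plane} (hp : p ∈ cylinder x) :
    ContDiffAt ℝ ∞ (fun y => D.coordF x y * D.coordLapse x y) p :=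
  ((D.contDiffOn_coordF x).mul (D.contDiffOn_coordLapse x)).contDiffAt
    ((isOpen_cylinder x).mem_nhds hp)

omit [IsManifold 𝓘(ℝ, Plane) ∞ X] in
/-- The exterior derivative of `α_t^⊥` is an alternating form. -/
theorem exists_dForm_formX : ∃ K : Plane →ₗ[ℝ] Plane →ₗ[ℝ] ℝ,
    (∀ v w, K v w = fderiv ℝ (fun y => D.coordPerp x y w) (base t x) (0, v)
      - fderiv ℝ (fun y => D.coordPerp x y v) (base t x) (0, w))
    ∧ ∀ v w, dForm 𝓘(ℝ, Plane) (D.formX t) x v w = K v w := by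
  have hd := fun v => (D.contDiffAt_coordPerp x (base_mem t x) v).diff
  choose η hη using fun Y => exists_linear_fderiv hd Y
  have a1 : ∀ v v' w, η (0, v + v') w = η (0, v) w + η (0, v') w := fun v v' w => by
    rw [← hη, ← hη, ← hη, ← map_add]
    simp
  have a2 : ∀ (c : ℝ) v w, η (0, c • v) w = c * η (0, v) w := fun c v w => by
    rw [← hη, ← hη, ← smul_eq_mul, ← map_smul]
    simp
  refine ⟨LinearMap.mk₂ ℝ (fun v w => η (0, v) w - η (0, w) v)
    (fun v v' w => by rw [a1, map_add]; ring)
    (fun c v w => by rw [a2, map_smul, smul_eq_mul, smul_eq_mul]; ring)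
    (fun v w w' => by rw [a1, map_add]; ring)
    (fun c v w => by rw [a2, map_smul, smul_eq_mul, smul_eq_mul]; ring),
    fun v w => ?_, fun v w => ?_⟩
  · rw [hη, hη]
    rfl
  · have e : ∀ v w : Plane, fderiv ℝ (fun u => coordForm 𝓘(ℝ, Plane) (D.formX t) x u w)
        (extChartAt 𝓘(ℝ, Plane) x x) v = η (0, v) w := fun v w =>
      (fderiv_slice (f := fun y => D.coordPerp x y w) (hd w) v).trans (hη _ _)
    exact congrArg₂ (· - ·) (e v w) (e w v)

omit [IsManifold 𝓘(ℝ, Plane) ∞ X] in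
/-- The form `∂_t α_t^⊥ - d_X (β_t F_t)`. -/
theorem exists_electric : ∃ A : Plane →ₗ[ℝ] ℝ,
    ∀ v, A v = fderiv ℝ (fun y => D.coordPerp x y v) (base t x) (1, 0)
      - fderiv ℝ (fun y => D.coordF x y * D.coordLapse x y) (base t x) (0, v) := by
  obtain ⟨η, hη⟩ := exists_linear_fderiv
    (fun v => (D.contDiffAt_coordPerp x (base_mem t x) v).diff) (1, 0)
  refine ⟨η - (fderiv ℝ (fun y => D.coordF x y * D.coordLapse x y) (base t x)).toLinearMap ∘ₗ
    LinearMap.inr ℝ ℝ Plane, fun v => ?_⟩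
  rw [hη]
  rfl

/-- This is `dα = dt ∧ A + K`. The time derivative of `Fβ` drops out because it multiplies `dt ∧
dt`. -/
theorem dForm_form {K : Plane →ₗ[ℝ] Plane →ₗ[ℝ] ℝ} {A : Plane →ₗ[ℝ] ℝ}
    (hK : ∀ v w, K v w = fderiv ℝ (fun y => D.coordPerp x y w) (base t x) (0, v)
      - fderiv ℝ (fun y => D.coordPerp x y v) (base t x) (0, w))
    (hA : ∀ v, A v = fderiv ℝ (fun y => D.coordPerp x y v) (base t x) (1, 0)
      - fderiv ℝ (fun y => D.coordF x y * D.coordLapse x y) (base t x) (0, v))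
    (a c : ℝ) (v w : Plane) :
    dForm modelRX (fun y a => D.form y a) (t, x) ((a, v) : ℝ × Plane) ((c, w) : ℝ × Plane)
      = a * A w - c * A v + K v w := by
  have hp := base_mem t x
  have e : ∀ (a c : ℝ) (v w : Plane),
      fderiv ℝ (fun u => coordForm modelRX (fun y a => D.form y a) (t, x) u (c, w)) (base t x) (a, v)
        = fderiv ℝ (fun y => D.coordF x y * D.coordLapse x y) (base t x) (a, v) * c
          + fderiv ℝ (fun y => D.coordPerp x y w) (base t x) (a, v) := fun a c v w => by
    have e1 : (fun u => coordForm modelRX (fun y a => D.form y a) (t, x) u (c, w))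
        =ᶠ[𝓝 (base t x)] fun y => D.coordF x y * D.coordLapse x y * c + D.coordPerp x y w :=
      Filter.eventually_of_mem ((isOpen_cylinder x).mem_nhds hp)
        fun y hy => D.coordForm_form x t hy c w
    have h1 := (D.contDiffAt_coordF_mul_coordLapse x hp).diff
    rw [e1.fderiv_eq, fderiv_fun_add (h1.mul_const c) (D.contDiffAt_coordPerp x hp w).diff,
      fderiv_mul_const h1, add_apply, smul_apply, smul_eq_mul, mul_comm c]
  have e2 : dForm modelRX (fun y a => D.form y a) (t, x) ((a, v) : ℝ × Plane)
      ((c, w) : ℝ × Plane)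
      = fderiv ℝ (fun u => coordForm modelRX (fun y a => D.form y a) (t, x) u (c, w))
          (base t x) (a, v)
        - fderiv ℝ (fun u => coordForm modelRX (fun y a => D.form y a) (t, x) u (a, v))
          (base t x) (c, w) := rfl
  rw [e2, e, e, hK, hA, hA]
  rw [fderiv_prod_apply _ _ a v, fderiv_prod_apply _ _ c w, fderiv_prod_apply _ _ a v,
    fderiv_prod_apply _ _ c w]
  simp only [smul_eq_mul]
  ring

/-- Along the slice `L_{n_t} α^⊥` is `β⁻¹ ∂_t α^⊥`: the derivative of `β⁻¹` in `n_t` points along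
`∂_t`, which `α^⊥` annihilates. -/
theorem lieForm_perpForm (v : Plane) :
    lieForm modelRX D.normal (fun p a => D.perpForm p a) (t, x) (SplitTuple.incl (t, x) v)
      = (D.β t x)⁻¹ * fderiv ℝ (fun y => D.coordPerp x y v) (base t x) (1, 0) := by
  have hp := base_mem t x
  have hβ : D.coordLapse x (base t x) ≠ 0 := D.β_ne_zero _ _
  have e : coordVec modelRX D.normal (t, x)
      =ᶠ[𝓝 (base t x)] fun p => ((D.coordLapse x p)⁻¹, 0) :=
    Filter.eventually_of_mem ((isOpen_cylinder x).mem_nhds hp)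
      fun y hy => D.coordVec_normal x t hy
  have hd : HasFDerivAt (fun p : ℝ × Plane => ((D.coordLapse x p)⁻¹, (0 : Plane))) _ (base t x) :=
    (((D.splitMetricOn x t).contDiffAt_lapse hp).inv hβ).diff.hasFDerivAt.prodMk
      (hasFDerivAt_const 0 (base t x))
  have e2 : (fderiv ℝ (coordVec modelRX D.normal (t, x)) (base t x) (0, v)).2 = 0 := by
    rw [e.fderiv_eq, hd.fderiv]
    rfl
  have e3 : (fun u => coordForm modelRX (fun p a => D.perpForm p a) (t, x) u (0, v))
      =ᶠ[𝓝 (base t x)] fun y => D.coordPerp x y v :=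
    Filter.eventually_of_mem ((isOpen_cylinder x).mem_nhds hp)
      fun y hy => D.coordForm_perpForm x t hy 0 v
  have e4 : lieForm modelRX D.normal (fun p a => D.perpForm p a) (t, x)
        (SplitTuple.incl (t, x) v)
      = fderiv ℝ (fun u => coordForm modelRX (fun p a => D.perpForm p a) (t, x) u (0, v))
          (base t x) (coordVec modelRX D.normal (t, x) (base t x))
        + coordForm modelRX (fun p a => D.perpForm p a) (t, x) (base t x)
          ((fderiv ℝ (coordVec modelRX D.normal (t, x)) (base t x) (0, v)).1,
            (fderiv ℝ (coordVec modelRX D.normal (t, x)) (base t x) (0, v)).2) := rfl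
  rw [e4, D.coordForm_perpForm x t hp, e2, map_zero, add_zero, e3.fderiv_eq,
    D.coordVec_normal x t hp, fderiv_prod_apply, ← D.β_eq]
  have e5 : fderiv ℝ (fun y => D.coordPerp x y v) (base t x) (0, 0) = 0 := map_zero _
  rw [e5, add_zero, smul_eq_mul]

theorem dFun_β_mul_F (v : Plane) : dFun 𝓘(ℝ, Plane) (fun y => D.β t y * D.F t y) x v
    = fderiv ℝ (fun y => D.coordF x y * D.coordLapse x y) (base t x) (0, v) := by
  have hd := (D.contDiffAt_coordF_mul_coordLapse x (base_mem t x)).diff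
  have e : (fun y => D.β t y * D.F t y) ∘ (extChartAt 𝓘(ℝ, Plane) x).symm
      = fun u => D.coordF x (t, u) * D.coordLapse x (t, u) :=
    funext fun u => mul_comm _ _
  have hd' : DifferentiableAt ℝ (fun u => D.coordF x (t, u) * D.coordLapse x (t, u))
        (extChartAt 𝓘(ℝ, Plane) x x) :=
    hd.comp (extChartAt 𝓘(ℝ, Plane) x x) (hasFDerivAt_prodMk_right (𝕜 := ℝ) t _).differentiableAt
  rw [dFun_eq 𝓘(ℝ, Plane) (by rw [e]; exact hd'), e]
  exact fderiv_slice (f := fun y => D.coordF x y * D.coordLapse x y) hd v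

theorem contact_iff (ho : IsOrientationForm modelRX o) :
    (∀ v, D.form (t, x) v = hodgeTwo (coordBasis modelRX basis3 (t, x))
        (fun a c => D.metric (t, x) a c) (o (t, x)) (dForm modelRX (fun y a => D.form y a) (t, x)) v)
      ↔ (∀ v w, dForm 𝓘(ℝ, Plane) (D.formX t) x v w
          = D.F t x * volForm (coordBasis 𝓘(ℝ, Plane) basis2 x) (D.metricX t x)
            (D.inducedOrientation o t x) ![v, w])
        ∧ ∀ v, hodgeOne (coordBasis 𝓘(ℝ, Plane) basis2 x) (D.metricX t x)
            (D.inducedOrientation o t x) (D.formX t x) v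
          + 1 / D.β t x * dFun 𝓘(ℝ, Plane) (fun y => D.β t y * D.F t y) x v
          = lieForm modelRX D.normal (fun p a => D.perpForm p a) (t, x)
            (SplitTuple.incl (t, x) v) := by
  obtain ⟨K, hK, hK'⟩ := D.exists_dForm_formX t x
  obtain ⟨A, hA⟩ := D.exists_electric t x
  have hβ := D.β_ne_zero t x
  have key := contact_split basis2 basis3 basis3_zero basis3_one basis3_two (D.isMetric_qAt t x)
    hβ (D.qAt_det_pos t x) (D.metricAt_apply t x) (o := orientAt o t x)
    (o' := D.inducedAt t x o) (D.inducedAt_basis2 t x) (D.inducedAt_ne_zero t x ho) (K := K) (A := A)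
    (η := fun v w => dForm modelRX (fun y a => D.form y a) (t, x) v w)
    (fun v w => by rw [hK, hK]; ring) (D.dForm_form t x hK hA) (F := D.F t x)
    (θ := D.perpAt t x) (α := D.formAt t x) (D.formAt_apply t x)
  refine key.trans (and_congr ?_ ?_)
  · exact forall_congr' fun v => forall_congr' fun w => by rw [← hK' v w]; rfl
  · refine forall_congr' fun v => ?_
    have e1 := D.lieForm_perpForm t x v
    have e2 := D.dFun_β_mul_F t x v
    have e3 := hA v
    set H : ℝ := hodgeOne basis2 (fun v w => D.qAt t x v w) (D.inducedAt t x o) (D.perpAt t x) v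
    have e4 : hodgeOne (coordBasis 𝓘(ℝ, Plane) basis2 x) (D.metricX t x)
            (D.inducedOrientation o t x) (D.formX t x) v = H := rfl
    rw [e1, e2, e4, e3]
    constructor
    · intro h
      field_simp
      linear_combination h
    · intro h
      field_simp at h
      linear_combination h

theorem einstein_iff {ε lam κ : ℝ}
    (hn : normSqForm (coordBasis 𝓘(ℝ, Plane) basis2 x) (D.metricX t x) (D.formX t x)
        = ε + D.F t x ^ 2) :
    (∀ v w, ricci modelRX basis3 (fun y a c => D.metric y a c) (t, x) v w
      = -(1 / 2) * (lam ^ 2 + κ * ε) * D.metric (t, x) v w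
        + κ * (D.form (t, x) v * D.form (t, x) w))
      ↔ (scalarCurv 𝓘(ℝ, Plane) basis2 (D.metricX t) x
          - normSqBilin (coordBasis 𝓘(ℝ, Plane) basis2 x) (D.metricX t x) (D.secondFF t x)
          + D.meanCurv t x ^ 2 + (lam ^ 2 - κ * ε) / 2 = 2 * κ * D.F t x ^ 2)
        ∧ (∀ v, dFun 𝓘(ℝ, Plane) (D.meanCurv t) x v
          + divBilin 𝓘(ℝ, Plane) basis2 (D.metricX t) (D.secondFF t) x v
          = κ * D.F t x * D.formX t x v)
        ∧ ∀ v w, ricci 𝓘(ℝ, Plane) basis2 (D.metricX t) x v w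
          + D.meanCurv t x * D.secondFF t x v w - 2 * D.secondFF t x v (D.weingarten t x w)
          - 1 / D.β t x * (D.secondFFDot t x v w
            + covForm 𝓘(ℝ, Plane) basis2 (D.metricX t) (dFun 𝓘(ℝ, Plane) (D.β t)) x v w)
          = κ * (D.formX t x v * D.formX t x w)
            - 1 / 2 * (lam ^ 2 + κ * ε) * D.metricX t x v w := by
  have h := D.splitMetricOn x t
  have hp := base_mem t x
  have hn' : normSqForm basis2 (fun v w => D.coordq x (base t x) v w) (D.coordPerp x (base t x))
      = ε + D.F t x ^ 2 := by
    rw [← hn, D.metricX_funext t x, D.formX_funext t x]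
    rfl
  have key := h.einstein_iff basis2 hp basis3
    (basisTrace_split basis2 basis3 basis3_zero basis3_one basis3_two) (lam := lam) (k := κ)
    (α := D.formAt t x) (θ := D.coordPerp x (base t x))
    (fun a v => by rw [D.formAt_apply, ← D.β_eq, ← D.formX_eq]; rfl) hn'
  refine Iff.trans ?_ (key.trans (and_congr ?_ (and_congr ?_ ?_)))
  · refine forall_congr' fun v => forall_congr' fun w => ?_
    have e : D.coordMetric x t (base t x) v w = D.metricAt t x v w :=
      coordBilin_self modelRX (fun y a c => D.metric y a c) (t, x) v w
    rw [e]
    rfl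
  · rw [D.scalarCurv_metricX, D.normSqBilin_secondFF, D.meanCurv_eq]
  · refine forall_congr' fun v => ?_
    have e1 := D.dFun_meanCurv t x v
    have e2 := D.divBilin_secondFF t x v
    have e3 := D.formX_eq t x v
    rw [e1, e2, e3]
  · refine forall_congr' fun v => forall_congr' fun w => ?_
    have e1 := D.ricci_metricX t x v w
    have e2 := D.secondFF_eq t x v w
    have e3 := (D.secondFF_eq t x v (D.weingarten t x w)).trans (congrArg _ (D.weingarten_eq t x w))
    have e4 := D.secondFFDot_eq t x v w
    have e5 := D.covForm_dFun_β t x v w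
    have e6 := D.metricX_eq t x v w
    rw [e1, e2, e3, e4, e5, e6, D.meanCurv_eq, D.formX_eq t x v, D.formX_eq t x w, D.β_eq]

end SplitTuple

/-! ### Signature, regularity and the final equivalence -/

theorem exists_orthonormal_pair {V : Type*} [AddCommGroup V] [Module ℝ V]
    (b : Basis (Fin 2) ℝ V) {q : V →ₗ[ℝ] V →ₗ[ℝ] ℝ}
    (hpos : ∀ v, v ≠ 0 → 0 < q v v) : ∃ v w, q v v = 1 ∧ q w w = 1 ∧ q v w = 0 := by
  have unit : ∀ v, v ≠ 0 → q ((√(q v v))⁻¹ • v) ((√(q v v))⁻¹ • v) = 1 := fun v hv => by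
    have h := hpos v hv
    have h1 := Real.sq_sqrt h.le
    have h2 : √(q v v) ≠ 0 := (Real.sqrt_pos.mpr h).ne'
    simp only [map_smul, LinearMap.smul_apply, smul_eq_mul]
    field_simp
    exact h1.symm
  have h0 := hpos _ (b.ne_zero 0)
  have hx : q (b 0) (b 0) • b 1 - q (b 0) (b 1) • b 0 ≠ 0 := fun h => by
    have := congrArg (fun z => b.repr z 1) h
    simp at this
    exact h0.ne' this
  refine ⟨_, _, unit _ (b.ne_zero 0), unit _ hx, ?_⟩
  simp only [map_smul, map_sub, LinearMap.smul_apply, smul_eq_mul]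
  ring

namespace SplitTuple

variable {X : Type*} [TopologicalSpace X] [ChartedSpace Plane X] (D : SplitTuple X) (t : ℝ) (x : X)

theorem exists_lorentzian_basis : ∃ e : Basis (Fin 3) ℝ (ℝ × Plane), ∀ i j,
    D.metricAt t x (e i) (e j) = if i = j then (if i = 0 then -1 else 1) else 0 := by
  obtain ⟨v, w, hv, hw, hvw⟩ := exists_orthonormal_pair basis2 (q := D.qAt t x)
    (D.q_pos t x)
  have hwv : D.qAt t x w v = 0 := (D.q_symm t x w v).trans hvw
  have hβ := D.β_ne_zero t x
  let e : Fin 3 → ℝ × Plane := ![((D.β t x)⁻¹, 0), (0, v), (0, w)]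
  have he : ∀ i j, D.metricAt t x (e i) (e j) = if i = j then (if i = 0 then -1 else 1) else 0 :=
    fun i j => by
      fin_cases i <;> fin_cases j <;> simp [e, D.metricAt_apply, hv, hw, hvw, hwv]
      field_simp
  -- Pairing a vanishing combination with `e j` isolates the `j`-th coefficient up to sign.
  have hli : LinearIndependent ℝ e := by
    rw [Fintype.linearIndependent_iff]
    intro c hc j
    have h := congrArg (fun z => D.metricAt t x z (e j)) hc
    simp only [map_sum, map_smul, LinearMap.sum_apply, LinearMap.smul_apply, he, smul_eq_mul,
      map_zero, LinearMap.zero_apply] at h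
    fin_cases j <;> simpa [Fin.sum_univ_three] using h
  refine ⟨basisOfLinearIndependentOfCardEqFinrank hli (by simp), fun i j => ?_⟩
  rw [coe_basisOfLinearIndependentOfCardEqFinrank, he]

variable [IsManifold 𝓘(ℝ, Plane) ∞ X]

theorem smoothBilin_metric : SmoothBilin modelRX D.metric := fun p v w => by
  rw [show p = (p.1, p.2) from rfl, target_modelRX]
  exact (D.splitMetricOn p.2 p.1).metric.smooth v w

theorem smoothForm_form : SmoothForm modelRX D.form := fun p v => by
  rw [show p = (p.1, p.2) from rfl, target_modelRX]
  refine ContDiffOn.congr ?_ fun u hu => D.coordForm_form p.2 p.1 hu v.1 v.2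
  exact (((D.contDiffOn_coordF p.2).mul (D.contDiffOn_coordLapse p.2)).mul contDiffOn_const).add
    (D.α_smooth p.2 v.2)

theorem continuousOn_coordVec_normal (p : ℝ × X) :
    ContinuousOn (coordVec modelRX D.normal p) (extChartAt modelRX p).target := by
  rw [show p = (p.1, p.2) from rfl, target_modelRX]
  refine ContinuousOn.congr ?_ fun u hu => D.coordVec_normal p.2 p.1 hu
  exact ((D.contDiffOn_coordLapse p.2).continuousOn.inv₀ fun u _ => D.β_ne_zero _ _).prodMk
    continuousOn_const

omit [IsManifold 𝓘(ℝ, Plane) ∞ X] in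
theorem metric_normal (p : ℝ × X) : D.metric p (D.normal p) (D.normal p) < 0 := by
  have hβ := D.β_ne_zero p.1 p.2
  have e : D.metric p (D.normal p) (D.normal p) = D.metricAt p.1 p.2
      ((D.β p.1 p.2)⁻¹ • (1, 0)) ((D.β p.1 p.2)⁻¹ • (1, 0)) := rfl
  rw [e]
  simp only [map_smul, LinearMap.smul_apply, metricAt_apply]
  simp
  field_simp
  norm_num

theorem isLorentzianEtaEinstein_iff
    {o : ∀ p : ℝ × X, TangentSpace modelRX p [⋀^Fin 3]→ₗ[ℝ] ℝ} (ho : IsOrientationForm modelRX o)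
    {ε lam κ : ℝ} (hε : ε = -1 ∨ ε = 0 ∨ ε = 1) (hκ : 0 ≤ κ) :
    IsLorentzianEtaEinstein modelRX basis3 o D.normal D.metric D.form ε lam κ
      ↔ EtaEinsteinSystem o D ε lam κ := by
  constructor
  · intro h
    -- The norm equation comes first because the splitting of the Einstein equation assumes it.
    have hn := fun t x => (D.norm_iff t x ε).mp (h.norm (t, x))
    have hc := fun t x => (D.contact_iff t x ho).mp (h.contact (t, x))
    have he := fun t x => (D.einstein_iff t x (hn t x)).mp (h.einstein (t, x))
    exact
      { contact_d := fun t x => (hc t x).1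
        contact_evol := fun t x => (hc t x).2
        norm := hn
        hamiltonian := fun t x => (he t x).1
        momentum := fun t x => (he t x).2.1
        evolution := fun t x => (he t x).2.2 }
  · intro h
    exact
      { orientation := ho
        smooth_metric := D.smoothBilin_metric
        symm := D.metric_symm
        lorentzian := fun p => D.exists_lorentzian_basis p.1 p.2
        time_continuous := D.continuousOn_coordVec_normal
        timelike := D.metric_normal
        epsilon := hε
        smooth_form := D.smoothForm_form
        contact := fun p => (D.contact_iff p.1 p.2 ho).mpr
          ⟨h.contact_d p.1 p.2, h.contact_evol p.1 p.2⟩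
        norm := fun p => (D.norm_iff p.1 p.2 ε).mpr (h.norm p.1 p.2)
        kappa_nonneg := hκ
        einstein := fun p => (D.einstein_iff p.1 p.2 (h.norm p.1 p.2)).mpr
          ⟨h.hamiltonian p.1 p.2, h.momentum p.1 p.2, h.evolution p.1 p.2⟩ }

/-- The constraints hold on every slice. Symmetry and bilinearity of `Θ_t` are inherited from `q_t`
by differentiation in time; the rest is contained in the system. -/
theorem constraintEquations {o : ∀ p : ℝ × X, TangentSpace modelRX p [⋀^Fin 3]→ₗ[ℝ] ℝ}
    {ε lam κ : ℝ} (h : EtaEinsteinSystem o D ε lam κ) :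
    ConstraintEquations (D.inducedOrientation o t) (D.metricX t) (D.secondFF t) (D.F t)
      (D.formX t) ε lam κ where
  bilinear_symm x := ⟨D.secondFFL t x, fun v w => ⟨rfl, D.secondFF_symm t x v w⟩⟩
  contact_d := h.contact_d t
  norm := h.norm t
  hamiltonian := h.hamiltonian t
  momentum := h.momentum t

end SplitTuple

end

theorem mainTheorem11 {X : Type*} [TopologicalSpace X] [ChartedSpace Plane X]
    [IsManifold 𝓘(ℝ, Plane) ∞ X]
    (o : ∀ p : ℝ × X, TangentSpace modelRX p [⋀^Fin 3]→ₗ[ℝ] ℝ) (ho : IsOrientationForm modelRX o)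
    (D : SplitTuple X) (ε lam κ : ℝ) (hε : ε = -1 ∨ ε = 0 ∨ ε = 1) (hκ : 0 ≤ κ) :
    (IsLorentzianEtaEinstein modelRX basis3 o D.normal D.metric D.form ε lam κ
      ↔ EtaEinsteinSystem o D ε lam κ)
    ∧ (EtaEinsteinSystem o D ε lam κ →
      ConstraintEquations (D.inducedOrientation o 0) (D.metricX 0) (D.secondFF 0) (D.F 0)
        (D.formX 0) ε lam κ) :=
  ⟨D.isLorentzianEtaEinstein_iff ho hε hκ, D.constraintEquations 0⟩
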